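/- All graphs are finite and undirected, $\log$ is the natural logarithm. A coalition structure over a graph $G=(N,E)$ is a partition of $N$; it is connected if each of its parts (coalitions) induces a connected subgraph of $G$. A function $v:2^N\to\mathbb R$ is independent of disconnected members if $$v(C\cup\{i\})-v(C)=v(C\cup\{i,j\})-v(C\cup\{j\})$$ for all $C\subseteq N$ and all distinct $i,j\in N\setminus C$ such that $C$ separates $i$ from $j$ in the subgraph induced on $C\cup\{i,j\}$, i.e. such that $(i,j)\notin E$. An instance of the graph coalition structure generation (GCSG) problem over a connected graph $G$ is such a function $v$ with $v(\emptyset)=0$, given by an oracle; the task is to find a connected coalition structure $\mathcal C$ that maximises $\sum_{C\in\mathcal C}v(C)$ over all coalition structures over $N$. A class of graphs $S$ satisfies an $f(n)$-separator theorem with constant $\alpha<1$ if every $G\in S$ with $n\ge 1$ nodes has two subgraphs $A,B$ with $A\cup B=G$ such that $A\cap B$ has at most $f(n)$ nodes and each of $A\setminus B$ and $B\setminus A$ has at most $\alpha n$ nodes. Computation steps are the unit-cost steps of a random access machine with integer registers (addition, subtraction), real registers (addition, subtraction, comparison), adjacency look-ups and oracle calls for $v$. **Corollary.** Let $S$ be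 a class of graphs closed under taking subgraphs (and isomorphism), and let $g$ be an increasing function such that every $G\in S$ with $n\ge 1$ nodes has at most $g(n)$ connected coalition structures. Suppose that $S$ satisfies an $f(n)$-separator theorem with constant $\alpha<1$, where $f$ is an increasing function with $f(n)=o(n)$, and that for every $G\in S$ with $n$ nodes such a separator can be found in $o\bigl(g(f(n))^2 f(n)^{2f(n)}\bigr)$ steps. Then for every $\beta$ with $\alpha<\beta<1$, the GCSG problem over graphs from $S$ with $n$ nodes can be solved in $$O\Bigl(n^{\,\log(2)\,c\,f(n)^2+2c\,f(n)\log(c\log(n)f(n))}\Bigr)$$ computation steps, where $c=1/|\log\beta|$. -/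

import Mathlib

open Filter Asymptotics

namespace GCSG

/-! ### Coalition structures over a graph -/

/-- The total value of a coalition structure, i.e. of a partition of the node set. -/
noncomputable def value {n : ℕ} (v : Finset (Fin n) → ℝ)
    (P : Finpartition (Finset.univ : Finset (Fin n))) : ℝ :=
  ∑ C ∈ P.parts, v C

/-- A coalition structure is connected if every coalition induces a connected subgraph. -/
def IsConnectedCS {n : ℕ} (G : SimpleGraph (Fin n))
    (P : Finpartition (Finset.univ : Finset (Fin n))) : Prop :=
  ∀ C ∈ P.parts, (G.induce (C : Set (Fin n))).Connected

/-- The number of connected coalition structures over `G`. -/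
noncomputable def numConnectedCS {n : ℕ} (G : SimpleGraph (Fin n)) : ℕ :=
  {P : Finpartition (Finset.univ : Finset (Fin n)) | IsConnectedCS G P}.ncard

/-- The coalition `C` is a vertex separator of the nodes `i` and `j` outside it: every path from
`i` to `j` inside the coalition `C ∪ {i, j}` passes through a node of `C`. -/
def IsSeparatorOf {n : ℕ} (G : SimpleGraph (Fin n)) (C : Finset (Fin n)) (i j : Fin n) : Prop :=
  i ≠ j ∧ i ∉ C ∧ j ∉ C ∧
    ∀ p : G.Walk i j, (∀ x ∈ p.support, x ∈ C ∪ {i, j}) → ∃ x ∈ p.support, x ∈ C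

/-- `C` separates `i` and `j` exactly when there is no direct link between `i` and `j`. -/
theorem isSeparatorOf_iff {n : ℕ} (G : SimpleGraph (Fin n)) (C : Finset (Fin n)) (i j : Fin n) :
    IsSeparatorOf G C i j ↔ i ≠ j ∧ i ∉ C ∧ j ∉ C ∧ ¬ G.Adj i j := by
  unfold IsSeparatorOf
  refine and_congr_right fun hij => and_congr_right fun hi => and_congr_right fun hj => ?_
  constructor
  · intro h hadj
    obtain ⟨x, hx, hxC⟩ := h hadj.toWalk (by
      intro x hx
      simp at hx
      rcases hx with rfl | rfl <;> simp)
    simp at hx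
    rcases hx with rfl | rfl
    · exact hi hxC
    · exact hj hxC
  · intro hadj p hp
    cases p with
    | nil => exact absurd rfl hij
    | @cons _ w _ hw q =>
      refine ⟨w, by simp, ?_⟩
      have hmem := hp w (by simp)
      simp only [Finset.mem_union, Finset.mem_insert, Finset.mem_singleton] at hmem
      rcases hmem with h | rfl | rfl
      · exact h
      · exact absurd hw (G.loopless.irrefl _)
      · exact absurd hw hadj

/-- Independence of disconnected members. -/
def IDM {n : ℕ} (G : SimpleGraph (Fin n)) (v : Finset (Fin n) → ℝ) : Prop :=
  ∀ (i j : Fin n) (C : Finset (Fin n)), IsSeparatorOf G C i j →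
    v (C ∪ {i}) - v C = v (C ∪ {i, j}) - v (C ∪ {j})

/-- An instance of graph coalition structure generation: a connected graph with a coalition
valuation function that is independent of disconnected members. -/
def IsInstance {n : ℕ} (G : SimpleGraph (Fin n)) (v : Finset (Fin n) → ℝ) : Prop :=
  G.Connected ∧ v ∅ = 0 ∧ IDM G v

/-- A solution of an instance: a connected coalition structure whose value is the maximum over
all coalition structures, connected or not. -/
def IsSolution {n : ℕ} (G : SimpleGraph (Fin n)) (v : Finset (Fin n) → ℝ)
    (P : Finpartition (Finset.univ : Finset (Fin n))) : Prop :=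
  IsConnectedCS G P ∧ ∀ Q : Finpartition (Finset.univ : Finset (Fin n)), value v Q ≤ value v P

/-! ### Classes of graphs and separator theorems -/

/-- A class of finite graphs; every finite graph is represented on the nodes `0, …, n - 1`. -/
abbrev GraphClass : Type := ∀ n : ℕ, Set (SimpleGraph (Fin n))

/-- Closed under taking subgraphs, up to isomorphism. -/
def GraphClass.SubgraphClosed (S : GraphClass) : Prop :=
  ∀ (m n : ℕ) (H : SimpleGraph (Fin m)) (G : SimpleGraph (Fin n)),
    G ∈ S n → H.IsContained G → H ∈ S m

/-- `A` and `B` cover `G`, have at most `s` nodes in common, and each has at most `α n` nodes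
outside the other. -/
def IsSeparation {n : ℕ} (G : SimpleGraph (Fin n)) (s α : ℝ) (A B : G.Subgraph) : Prop :=
  A ⊔ B = ⊤ ∧ ((A.verts ∩ B.verts).ncard : ℝ) ≤ s ∧
    ((A.verts \ B.verts).ncard : ℝ) ≤ α * n ∧ ((B.verts \ A.verts).ncard : ℝ) ≤ α * n

/-- The class satisfies an `f(n)`-separator theorem with constant `α`. -/
def GraphClass.SeparatorTheorem (S : GraphClass) (f : ℕ → ℝ) (α : ℝ) : Prop :=
  ∀ n : ℕ, 0 < n → ∀ G ∈ S n, ∃ A B : G.Subgraph, IsSeparation G (f n) α A B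

/-! ### The machine model

A random access machine with unit-cost steps. It has registers and an unbounded indirectly
addressed memory for natural numbers (with addition and truncated subtraction only), registers and
an unbounded indirectly addressed memory for real numbers (with addition, subtraction and
comparison only), unit-cost look-up of the adjacency of two nodes, and an oracle for the
valuation function. Programs are structured (sequence, conditional, loop) and finite, and one
program has to serve inputs of every size. -/

/-- The contents of the registers and of the memories. -/
structure State where
  reg : ℕ → ℕ
  mem : ℕ → ℕ
  rreg : ℕ → ℝ
  rmem : ℕ → ℝ

/-- The initial state: register `0` holds the number of nodes, everything else is zero. -/
def State.init (n : ℕ) : State where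
  reg := Function.update (fun _ => 0) 0 n
  mem := fun _ => 0
  rreg := fun _ => 0
  rmem := fun _ => 0

/-- Elementary instructions; the arguments are numbers of registers, except that the second
argument of `const` is the constant. -/
inductive Instr : Type
  | const (r k : ℕ)
  | add (r a b : ℕ)
  | sub (r a b : ℕ)
  | load (r a : ℕ)
  | store (a r : ℕ)
  | adj (r a b : ℕ)
  | radd (r a b : ℕ)
  | rsub (r a b : ℕ)
  | rlt (r a b : ℕ)
  | rload (r a : ℕ)
  | rstore (a r : ℕ)
  | query (r a : ℕ)

/-- `1` if `x` and `y` are adjacent nodes of `G`, and `0` otherwise. -/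
noncomputable def adjBit {n : ℕ} (G : SimpleGraph (Fin n)) (x y : ℕ) : ℕ :=
  open Classical in
  if ∃ i j : Fin n, (i : ℕ) = x ∧ (j : ℕ) = y ∧ G.Adj i j then 1 else 0

/-- `1` if `x < y`, and `0` otherwise. -/
noncomputable def ltBit (x y : ℝ) : ℕ :=
  open Classical in
  if x < y then 1 else 0

/-- The coalition whose characteristic vector is stored in the `n` memory cells from address `a`
on. -/
def coalitionAt (n : ℕ) (mem : ℕ → ℕ) (a : ℕ) : Finset (Fin n) :=
  Finset.univ.filter fun i => mem (a + i) ≠ 0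

/-- The effect of one elementary instruction. -/
noncomputable def Instr.run {n : ℕ} (G : SimpleGraph (Fin n)) (v : Finset (Fin n) → ℝ) :
    Instr → State → State
  | .const r k, s => { s with reg := Function.update s.reg r k }
  | .add r a b, s => { s with reg := Function.update s.reg r (s.reg a + s.reg b) }
  | .sub r a b, s => { s with reg := Function.update s.reg r (s.reg a - s.reg b) }
  | .load r a, s => { s with reg := Function.update s.reg r (s.mem (s.reg a)) }
  | .store a r, s => { s with mem := Function.update s.mem (s.reg a) (s.reg r) }
  | .adj r a b, s => { s with reg := Function.update s.reg r (adjBit G (s.reg a) (s.reg b)) }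
  | .radd r a b, s => { s with rreg := Function.update s.rreg r (s.rreg a + s.rreg b) }
  | .rsub r a b, s => { s with rreg := Function.update s.rreg r (s.rreg a - s.rreg b) }
  | .rlt r a b, s =>
      { s with reg := Function.update s.reg r (ltBit (s.rreg a) (s.rreg b)) }
  | .rload r a, s => { s with rreg := Function.update s.rreg r (s.rmem (s.reg a)) }
  | .rstore a r, s => { s with rmem := Function.update s.rmem (s.reg a) (s.rreg r) }
  | .query r a, s =>
      { s with rreg := Function.update s.rreg r (v (coalitionAt n s.mem (s.reg a))) }

/-- Programs. Conditionals and loops test whether a register is nonzero. -/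
inductive Program : Type
  | instr (i : Instr)
  | seq (p q : Program)
  | ite (r : ℕ) (p q : Program)
  | loop (r : ℕ) (p : Program)

/-- `Exec G v p s s' t`: with adjacency look-ups answered by `G` and oracle calls by `v`, the
program `p` started in the state `s` halts in the state `s'` after exactly `t` steps. Each
instruction and each test is one step. -/
inductive Exec {n : ℕ} (G : SimpleGraph (Fin n)) (v : Finset (Fin n) → ℝ) :
    Program → State → State → ℕ → Prop
  | instr (i : Instr) (s : State) : Exec G v (.instr i) s (i.run G v s) 1
  | seq {p q : Program} {s s' s'' : State} {t t' : ℕ} (hp : Exec G v p s s' t)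
      (hq : Exec G v q s' s'' t') : Exec G v (.seq p q) s s'' (t + t')
  | ite_true {r : ℕ} {p q : Program} {s s' : State} {t : ℕ} (hr : s.reg r ≠ 0)
      (hp : Exec G v p s s' t) : Exec G v (.ite r p q) s s' (1 + t)
  | ite_false {r : ℕ} {p q : Program} {s s' : State} {t : ℕ} (hr : s.reg r = 0)
      (hq : Exec G v q s s' t) : Exec G v (.ite r p q) s s' (1 + t)
  | loop_done {r : ℕ} {p : Program} {s : State} (hr : s.reg r = 0) :
      Exec G v (.loop r p) s s 1
  | loop_step {r : ℕ} {p : Program} {s s' s'' : State} {t t' : ℕ} (hr : s.reg r ≠ 0)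
      (hp : Exec G v p s s' t) (hl : Exec G v (.loop r p) s' s'' t') :
      Exec G v (.loop r p) s s'' (1 + t + t')

/-! ### Solving the two problems within a time bound -/

/-- The first `n` memory cells hold labels of the nodes, equal exactly for nodes in the same
coalition of `P`. -/
def EncodesCS {n : ℕ} (mem : ℕ → ℕ) (P : Finpartition (Finset.univ : Finset (Fin n))) : Prop :=
  ∀ i j : Fin n, mem i = mem j ↔ ∃ C ∈ P.parts, i ∈ C ∧ j ∈ C

/-- The first `n` memory cells hold the side of each node: `0` for nodes of `A` only, `1` for
nodes of both, larger for nodes of `B` only. (Edges joining two common nodes may be put on both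
sides, and all other edges have a determined side.) -/
def EncodesSeparation {n : ℕ} {G : SimpleGraph (Fin n)} (mem : ℕ → ℕ) (A B : G.Subgraph) : Prop :=
  ∀ i : Fin n, (i ∈ A.verts ↔ mem i ≤ 1) ∧ (i ∈ B.verts ↔ 1 ≤ mem i)

/-- On every instance over an `n`-node graph of the class, the program halts within `T n` steps
with a solution as its output. -/
def SolvesWithin (S : GraphClass) (p : Program) (T : ℕ → ℕ) : Prop :=
  ∀ (n : ℕ) (G : SimpleGraph (Fin n)) (v : Finset (Fin n) → ℝ), G ∈ S n → IsInstance G v →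
    ∃ (s : State) (t : ℕ) (P : Finpartition (Finset.univ : Finset (Fin n))),
      Exec G v p (State.init n) s t ∧ t ≤ T n ∧ IsSolution G v P ∧ EncodesCS s.mem P

/-- On every `n`-node graph of the class, the program halts within `T n` steps with a separation
as its output. There is no valuation function in this problem, so all oracle calls return `0`. -/
def FindsSeparatorsWithin (S : GraphClass) (f : ℕ → ℝ) (α : ℝ) (p : Program) (T : ℕ → ℕ) : Prop :=
  ∀ (n : ℕ) (G : SimpleGraph (Fin n)), 0 < n → G ∈ S n →
    ∃ (s : State) (t : ℕ) (A B : G.Subgraph),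
      Exec G (fun _ => 0) p (State.init n) s t ∧ t ≤ T n ∧
        IsSeparation G (f n) α A B ∧ EncodesSeparation s.mem A B

end GCSG

/-! The algorithm is dynamic programming over an elimination forest, that is, a rooted forest on the
nodes in which adjacent nodes are always comparable. Independence of disconnected members makes the
marginal value of a node over a coalition depend only on its neighbours there (`IDM.marginal_eq`).
Adding the nodes of a coalition from the roots downwards, all neighbours already present are
ancestors. So the value of a coalition is a sum of terms, one for each node, that depend only on
which ancestors share its coalition (`ElimForest.value_eq_sum`).

If every node has fewer than `L` ancestors, then `L` labels are enough to record these relations for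
any coalition structure (`ElimForest.exists_labelling`), and the total value is a sum of gains
determined by labels along root paths (`ElimForest.value_eq_sum_gain`). A table indexed by a node
and the labels of its ancestors stores the best gain of the subtree. Choosing best labels from the
roots downwards is optimal by telescoping (`ElimForest.greedy_optimal`). The label classes may be
disconnected, but splitting them into components leaves the sum of gains unchanged, so the output is
connected and optimal among all coalition structures (`ElimForest.isSolution`).

The forest comes from recursive separation: a separator of a component of the remaining graph
becomes a chain of ancestors of the rest of that component. With a rational ratio `p / q` strictly
between `max α 0` and `β`, a node lies below at most `log n / log (q / p)` separators before its
component is used up, so the depth is at most `L = (c' log n + 1) f(n)` with `c' = 1 / |log (p / q)|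
< c` (`separateRound_runs`, `le_log_of_pow_le`). Separators are found by exhaustive search over the
sets of at most `f(n)` nodes, in time `n ^ O(f(n))`.

The machine neither multiplies nor divides, so a code of ancestor labels is decoded in time linear
in its value. With `(L + 1) ^ L` codes the table takes time `(L + 1) ^ (2 L)` up to polynomial
factors. The slack `c' < c` absorbs these factors and the search, leaving `n ^ (2 c f log (c log n
f))`; the term `log 2 * c * f ^ 2` is nonnegative and only enlarges the bound (`timeBound_le`).

Running times are proved through a small command language that is compiled to the machine. Total
correctness with a step bound (`Runs`) is established by rules for sequences, conditionals and
loops. -/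

namespace GCSG

set_option linter.unusedSimpArgs false

/-! ### A small imperative language over the machine model -/

/-- The state seen by commands: variables, arrays of length `n`, real variables, real memory. -/
structure St where
  x : ℕ → ℕ
  A : ℕ → ℕ → ℕ
  y : ℕ → ℝ
  M : ℕ → ℝ

/-- Side-effect free expressions with natural number values. -/
inductive NExpr : Type
  | size
  | var (r : ℕ)
  | lit (k : ℕ)
  | add (a b : NExpr)
  | sub (a b : NExpr)
  | arr (k : ℕ) (i : NExpr)
  | adj (a b : NExpr)

/-- The set of nodes with a nonzero entry in the array `k`. -/
def St.set (σ : St) (n k : ℕ) : Finset (Fin n) := Finset.univ.filter fun i => σ.A k i ≠ 0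

/-- The value of an expression; array accesses out of bounds give `0`. -/
noncomputable def NExpr.eval {n : ℕ} (G : SimpleGraph (Fin n)) (σ : St) : NExpr → ℕ
  | size => n
  | var r => σ.x r
  | lit k => k
  | add a b => a.eval G σ + b.eval G σ
  | sub a b => a.eval G σ - b.eval G σ
  | arr k i => if i.eval G σ < n then σ.A k (i.eval G σ) else 0
  | adj a b => adjBit G (a.eval G σ) (b.eval G σ)

/-- Commands. -/
inductive Cmd : Type
  | skip
  | asg (r : ℕ) (e : NExpr)
  | put (k : ℕ) (i e : NExpr)
  | query (r k : ℕ)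
  | radd (r a b : ℕ)
  | rsub (r a b : ℕ)
  | rlt (r a b : ℕ)
  | rload (r : ℕ) (e : NExpr)
  | rstore (e : NExpr) (r : ℕ)
  | seq (p q : Cmd)
  | ite (e : NExpr) (p q : Cmd)
  | while (e : NExpr) (p : Cmd)

infixr:60 " ;; " => Cmd.seq

/-- The effect of a command without loops. -/
noncomputable def Cmd.run {n : ℕ} (G : SimpleGraph (Fin n)) (v : Finset (Fin n) → ℝ) :
    Cmd → St → St
  | skip, σ => σ
  | asg r e, σ => { σ with x := Function.update σ.x r (e.eval G σ) }
  | put k i e, σ =>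
      if i.eval G σ < n then
        { σ with A := Function.update σ.A k (Function.update (σ.A k) (i.eval G σ) (e.eval G σ)) }
      else σ
  | query r k, σ => { σ with y := Function.update σ.y r (v (σ.set n k)) }
  | radd r a b, σ => { σ with y := Function.update σ.y r (σ.y a + σ.y b) }
  | rsub r a b, σ => { σ with y := Function.update σ.y r (σ.y a - σ.y b) }
  | rlt r a b, σ => { σ with x := Function.update σ.x r (ltBit (σ.y a) (σ.y b)) }
  | rload r e, σ => { σ with y := Function.update σ.y r (σ.M (e.eval G σ)) }
  | rstore e r, σ => { σ with M := Function.update σ.M (e.eval G σ) (σ.y r) }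
  | seq p q, σ => q.run G v (p.run G v σ)
  | ite e p q, σ => if e.eval G σ ≠ 0 then p.run G v σ else q.run G v σ
  | .while _ _, σ => σ

/-- Commands without loops. -/
def Cmd.flat : Cmd → Bool
  | seq p q => p.flat && q.flat
  | ite _ p q => p.flat && q.flat
  | .while _ _ => false
  | _ => true

/-- The variables a command may write. -/
def Cmd.wx : Cmd → ℕ → Bool
  | asg r _, i => r == i
  | rlt r _ _, i => r == i
  | seq p q, i => p.wx i || q.wx i
  | ite _ p q, i => p.wx i || q.wx i
  | .while _ p, i => p.wx i
  | _, _ => false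

/-- The arrays a command may write. -/
def Cmd.wA : Cmd → ℕ → Bool
  | put k _ _, i => k == i
  | seq p q, i => p.wA i || q.wA i
  | ite _ p q, i => p.wA i || q.wA i
  | .while _ p, i => p.wA i
  | _, _ => false

/-- The real variables a command may write. -/
def Cmd.wy : Cmd → ℕ → Bool
  | query r _, i => r == i
  | radd r _ _, i => r == i
  | rsub r _ _, i => r == i
  | rload r _, i => r == i
  | seq p q, i => p.wy i || q.wy i
  | ite _ p q, i => p.wy i || q.wy i
  | .while _ p, i => p.wy i
  | _, _ => false

/-- Whether a command may write the real memory. -/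
def Cmd.wM : Cmd → Bool
  | rstore _ _ => true
  | seq p q => p.wM || q.wM
  | ite _ p q => p.wM || q.wM
  | .while _ p => p.wM
  | _ => false

/-! ### Compilation -/

/-- Variables live in the registers `2, 4, 6, …`, temporaries in the odd registers. -/
def vreg (r : ℕ) : ℕ := 2 * (r + 1)

/-- The register of a temporary. -/
def treg (d : ℕ) : ℕ := 2 * d + 1

/-- Adds `k` times the number of nodes to the temporary `d`. -/
def addSize (d : ℕ) : ℕ → Program
  | 0 => .instr (.const (treg (d + 1)) 0)
  | k + 1 => .seq (.instr (.add (treg d) (treg d) 0)) (addSize d k)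

/-- Evaluates an expression into the temporary `d`. -/
def NExpr.compile : NExpr → ℕ → Program
  | size, d => .seq (.instr (.const (treg d) 0)) (.instr (.add (treg d) (treg d) 0))
  | var r, d => .seq (.instr (.const (treg d) 0)) (.instr (.add (treg d) (treg d) (vreg r)))
  | lit k, d => .instr (.const (treg d) k)
  | add a b, d => .seq (a.compile d)
      (.seq (b.compile (d + 1)) (.instr (.add (treg d) (treg d) (treg (d + 1)))))
  | sub a b, d => .seq (a.compile d)
      (.seq (b.compile (d + 1)) (.instr (.sub (treg d) (treg d) (treg (d + 1)))))
  | arr k i, d => .seq (i.compile d) (.seq (.instr (.sub (treg (d + 1)) 0 (treg d)))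
      (.ite (treg (d + 1)) (.seq (addSize d k) (.instr (.load (treg d) (treg d))))
        (.instr (.const (treg d) 0))))
  | adj a b, d => .seq (a.compile d)
      (.seq (b.compile (d + 1)) (.instr (.adj (treg d) (treg d) (treg (d + 1)))))

/-- The number of steps for the evaluation of an expression. -/
def NExpr.cost : NExpr → ℕ
  | size => 2
  | var _ => 2
  | lit _ => 1
  | add a b => a.cost + b.cost + 1
  | sub a b => a.cost + b.cost + 1
  | arr k i => i.cost + k + 4
  | adj a b => a.cost + b.cost + 1

/-- The machine program of a command. -/
def Cmd.compile : Cmd → Program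
  | skip => .instr (.const (treg 0) 0)
  | asg r e => .seq (e.compile 0) (.seq (.instr (.const (treg 1) 0))
      (.instr (.add (vreg r) (treg 0) (treg 1))))
  | put k i e => .seq (e.compile 0) (.seq (i.compile 2) (.seq (.instr (.sub (treg 3) 0 (treg 2)))
      (.ite (treg 3) (.seq (addSize 2 k) (.instr (.store (treg 2) (treg 0))))
        (.instr (.const (treg 3) 0)))))
  | query r k => .seq (.instr (.const (treg 0) 0)) (.seq (addSize 0 k)
      (.instr (.query r (treg 0))))
  | radd r a b => .instr (.radd r a b)
  | rsub r a b => .instr (.rsub r a b)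
  | rlt r a b => .instr (.rlt (vreg r) a b)
  | rload r e => .seq (e.compile 0) (.instr (.rload r (treg 0)))
  | rstore e r => .seq (e.compile 0) (.instr (.rstore (treg 0) r))
  | seq p q => .seq p.compile q.compile
  | ite e p q => .seq (e.compile 0) (.ite (treg 0) p.compile q.compile)
  | .while e p => .seq (e.compile 0) (.loop (treg 0) (.seq p.compile (e.compile 0)))

/-- A bound for the number of steps of a command without loops. -/
def Cmd.cost : Cmd → ℕ
  | skip => 1
  | asg _ e => e.cost + 2
  | put k i e => e.cost + i.cost + k + 4
  | query _ k => k + 3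
  | radd _ _ _ => 1
  | rsub _ _ _ => 1
  | rlt _ _ _ => 1
  | rload _ e => e.cost + 1
  | rstore e _ => e.cost + 1
  | seq p q => p.cost + q.cost
  | ite e p q => e.cost + 1 + p.cost + q.cost
  | .while _ _ => 0

/-- The machine state `s` represents the state `σ`. -/
structure Rel (n : ℕ) (σ : St) (s : State) : Prop where
  len : s.reg 0 = n
  reg : ∀ r, s.reg (vreg r) = σ.x r
  mem : ∀ k i, i < n → s.mem (k * n + i) = σ.A k i
  rreg : s.rreg = σ.y
  rmem : s.rmem = σ.M

theorem vreg_ne_treg (d r : ℕ) : vreg r ≠ treg d := by unfold treg vreg; omega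
theorem treg_ne_zero (d : ℕ) : treg d ≠ 0 := by unfold treg; omega
theorem vreg_ne_zero (d : ℕ) : vreg d ≠ 0 := by unfold vreg; omega
theorem treg_inj {d e : ℕ} : treg d = treg e ↔ d = e := by unfold treg; omega
theorem vreg_inj {d e : ℕ} : vreg d = vreg e ↔ d = e := by unfold vreg; omega

theorem Rel.setTemp {n : ℕ} {σ : St} {s : State} (h : Rel n σ s) (d a : ℕ) :
    Rel n σ { s with reg := Function.update s.reg (treg d) a } where
  len := by simp [Function.update_apply, (treg_ne_zero d).symm, h.len]
  reg r := by simp [Function.update_apply, vreg_ne_treg, h.reg]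
  mem := h.mem
  rreg := h.rreg
  rmem := h.rmem

variable {n : ℕ} {G : SimpleGraph (Fin n)} {v : Finset (Fin n) → ℝ}

/-- The offset of an array is a multiple of the input size; since its number `k` is fixed in the
program, repeated addition costs a constant number of steps. -/
theorem addSize_exec (d : ℕ) : ∀ (k : ℕ) {σ : St} {s : State}, Rel n σ s →
    ∃ s', Exec G v (addSize d k) s s' (k + 1) ∧ Rel n σ s' ∧
      s'.reg (treg d) = s.reg (treg d) + k * n ∧ (∀ d' < d, s'.reg (treg d') = s.reg (treg d'))
  | 0, σ, s, h => ⟨_, .instr _ _, h.setTemp _ _, by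
      simp [Instr.run, Function.update_apply, treg_inj], fun d' hd => by
      have : d' ≠ d + 1 := by omega
      simp [Instr.run, Function.update_apply, treg_inj, this]⟩
  | k + 1, σ, s, h => by
      obtain ⟨s', he, hr, hd, ho⟩ := addSize_exec d k
        (h.setTemp d (s.reg (treg d) + s.reg 0))
      refine ⟨s', ?_, hr, ?_, ?_⟩
      · have := Exec.seq (Exec.instr (G := G) (v := v) (.add (treg d) (treg d) 0) s) he
        rwa [add_comm] at this
      · rw [hd]; simp [h.len]; ring
      · intro d' hd'
        rw [ho d' hd']
        have : d' ≠ d := by omega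
        simp [Function.update_apply, treg_inj, this]

/-- The last clause carries the induction: temporaries below `d` survive, so a left operand held in
temporary `d` is intact after the right one has been evaluated in `d + 1`. -/
theorem NExpr.compile_exec : ∀ (e : NExpr) (d : ℕ) {σ : St} {s : State}, Rel n σ s →
    ∃ s' t, Exec G v (e.compile d) s s' t ∧ t ≤ e.cost ∧ Rel n σ s' ∧
      s'.reg (treg d) = e.eval G σ ∧ (∀ d' < d, s'.reg (treg d') = s.reg (treg d'))
  | size, d, σ, s, h => by
      refine ⟨_, _, .seq (.instr _ _) (.instr _ _), le_rfl, (h.setTemp _ _).setTemp _ _, ?_, ?_⟩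
      · simp [Instr.run, Function.update_apply, (treg_ne_zero d).symm, h.len, NExpr.eval]
      · intro d' hd
        have : d' ≠ d := by omega
        simp [Instr.run, Function.update_apply, treg_inj, this]
  | var r, d, σ, s, h => by
      refine ⟨_, _, .seq (.instr _ _) (.instr _ _), le_rfl, (h.setTemp _ _).setTemp _ _, ?_, ?_⟩
      · simp [Instr.run, Function.update_apply, vreg_ne_treg, h.reg, NExpr.eval]
      · intro d' hd
        have : d' ≠ d := by omega
        simp [Instr.run, Function.update_apply, treg_inj, this]
  | lit k, d, σ, s, h => by
      refine ⟨_, _, .instr _ _, le_rfl, h.setTemp _ _, ?_, ?_⟩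
      · simp [Instr.run, NExpr.eval]
      · intro d' hd
        have : d' ≠ d := by omega
        simp [Instr.run, Function.update_apply, treg_inj, this]
  | add a b, d, σ, s, h => by
      obtain ⟨s1, t1, e1, c1, r1, v1, o1⟩ := a.compile_exec d h
      obtain ⟨s2, t2, e2, c2, r2, v2, o2⟩ := b.compile_exec (d + 1) r1
      refine ⟨_, _, .seq e1 (.seq e2 (.instr _ _)), ?_, r2.setTemp _ _, ?_, ?_⟩
      · simp only [NExpr.cost]; omega
      · simp [Instr.run, v2, o2 d (by omega), v1, NExpr.eval]
      · intro d' hd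
        have : d' ≠ d := by omega
        simp [Instr.run, Function.update_apply, treg_inj, this, o2 d' (by omega), o1 d' hd]
  | sub a b, d, σ, s, h => by
      obtain ⟨s1, t1, e1, c1, r1, v1, o1⟩ := a.compile_exec d h
      obtain ⟨s2, t2, e2, c2, r2, v2, o2⟩ := b.compile_exec (d + 1) r1
      refine ⟨_, _, .seq e1 (.seq e2 (.instr _ _)), ?_, r2.setTemp _ _, ?_, ?_⟩
      · simp only [NExpr.cost]; omega
      · simp [Instr.run, v2, o2 d (by omega), v1, NExpr.eval]
      · intro d' hd
        have : d' ≠ d := by omega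
        simp [Instr.run, Function.update_apply, treg_inj, this, o2 d' (by omega), o1 d' hd]
  | adj a b, d, σ, s, h => by
      obtain ⟨s1, t1, e1, c1, r1, v1, o1⟩ := a.compile_exec d h
      obtain ⟨s2, t2, e2, c2, r2, v2, o2⟩ := b.compile_exec (d + 1) r1
      refine ⟨_, _, .seq e1 (.seq e2 (.instr _ _)), ?_, r2.setTemp _ _, ?_, ?_⟩
      · simp only [NExpr.cost]; omega
      · simp [Instr.run, v2, o2 d (by omega), v1, NExpr.eval]
      · intro d' hd
        have : d' ≠ d := by omega
        simp [Instr.run, Function.update_apply, treg_inj, this, o2 d' (by omega), o1 d' hd]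
  | arr k i, d, σ, s, h => by
      obtain ⟨s1, t1, e1, c1, r1, v1, o1⟩ := i.compile_exec d h
      have r2 := r1.setTemp (d + 1) (s1.reg 0 - s1.reg (treg d))
      have hv : (Instr.run G v (.sub (treg (d + 1)) 0 (treg d)) s1).reg (treg d) =
          i.eval G σ := by
        simp [Instr.run, Function.update_apply, treg_inj, v1]
      -- Truncated subtraction turns the bounds check into a test for a nonzero register.
      have ht : (Instr.run G v (.sub (treg (d + 1)) 0 (treg d)) s1).reg (treg (d + 1)) =
          n - i.eval G σ := by
        simp [Instr.run, v1, r1.len]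
      have ho : ∀ d' < d, (Instr.run G v (.sub (treg (d + 1)) 0 (treg d)) s1).reg (treg d') =
          s.reg (treg d') := by
        intro d' hd
        have : d' ≠ d + 1 := by omega
        simp [Instr.run, Function.update_apply, treg_inj, this, o1 d' hd]
      by_cases hi : i.eval G σ < n
      · obtain ⟨s3, e3, r3, v3, o3⟩ := addSize_exec (G := G) (v := v) d k r2
        refine ⟨_, _, .seq e1 (.seq (.instr _ _) (.ite_true (by rw [ht]; omega)
          (.seq e3 (.instr _ _)))), ?_, r3.setTemp _ _, ?_, ?_⟩
        · simp only [NExpr.cost]; omega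
        · have v3' : s3.reg (treg d) = i.eval G σ + k * n := by
            rw [v3]; exact congrArg (· + k * n) hv
          simp only [Instr.run, NExpr.eval, hi, if_true, Function.update_self]
          rw [v3', add_comm, r3.mem _ _ hi]
        · intro d' hd
          have : d' ≠ d := by omega
          have h3 := o3 d' hd
          have h4 := ho d' hd
          simp only [Instr.run] at h4
          simp [Instr.run, Function.update_apply, treg_inj, this]
          exact h3.trans h4
      · refine ⟨_, _, .seq e1 (.seq (.instr _ _) (.ite_false (by rw [ht]; omega)
          (.instr _ _))), ?_, r2.setTemp _ _, ?_, ?_⟩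
        · simp only [NExpr.cost]; omega
        · simp [Instr.run, NExpr.eval, hi]
        · intro d' hd
          have : d' ≠ d := by omega
          have h4 := ho d' hd
          simp only [Instr.run] at h4
          simp [Instr.run, Function.update_apply, treg_inj, this]
          simpa [Function.update_apply, treg_inj] using h4

/-! ### Time-bounded total correctness -/

/-- What is not written stays unchanged. -/
structure Frame (p : Cmd) (σ σ' : St) : Prop where
  x : ∀ r, p.wx r = false → σ'.x r = σ.x r
  A : ∀ k, p.wA k = false → σ'.A k = σ.A k
  y : ∀ r, p.wy r = false → σ'.y r = σ.y r
  M : p.wM = false → σ'.M = σ.M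

theorem Frame.refl (p : Cmd) (σ : St) : Frame p σ σ :=
  ⟨fun _ _ => rfl, fun _ _ => rfl, fun _ _ => rfl, fun _ => rfl⟩

theorem Frame.trans {p : Cmd} {σ σ' σ'' : St} (h : Frame p σ σ') (h' : Frame p σ' σ'') :
    Frame p σ σ'' :=
  ⟨fun r hr => (h'.x r hr).trans (h.x r hr), fun r hr => (h'.A r hr).trans (h.A r hr),
    fun r hr => (h'.y r hr).trans (h.y r hr), fun hr => (h'.M hr).trans (h.M hr)⟩

theorem Frame.mono {p q : Cmd} {σ σ' : St} (h : Frame p σ σ')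
    (hx : ∀ r, q.wx r = false → p.wx r = false) (hA : ∀ r, q.wA r = false → p.wA r = false)
    (hy : ∀ r, q.wy r = false → p.wy r = false) (hM : q.wM = false → p.wM = false) :
    Frame q σ σ' :=
  ⟨fun r hr => h.x r (hx r hr), fun r hr => h.A r (hA r hr), fun r hr => h.y r (hy r hr),
    fun hr => h.M (hM hr)⟩

theorem Frame.seq_left {p q : Cmd} {σ σ' : St} (h : Frame p σ σ') : Frame (p ;; q) σ σ' := by
  apply h.mono <;> simp +contextual [Cmd.wx, Cmd.wA, Cmd.wy, Cmd.wM]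

theorem Frame.seq_right {p q : Cmd} {σ σ' : St} (h : Frame q σ σ') : Frame (p ;; q) σ σ' := by
  apply h.mono <;> simp +contextual [Cmd.wx, Cmd.wA, Cmd.wy, Cmd.wM]

theorem Frame.ite_left {e : NExpr} {p q : Cmd} {σ σ' : St} (h : Frame p σ σ') :
    Frame (.ite e p q) σ σ' := by
  apply h.mono <;> simp +contextual [Cmd.wx, Cmd.wA, Cmd.wy, Cmd.wM]

theorem Frame.ite_right {e : NExpr} {p q : Cmd} {σ σ' : St} (h : Frame q σ σ') :
    Frame (.ite e p q) σ σ' := by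
  apply h.mono <;> simp +contextual [Cmd.wx, Cmd.wA, Cmd.wy, Cmd.wM]

theorem Frame.while {e : NExpr} {p : Cmd} {σ σ' : St} (h : Frame p σ σ') :
    Frame (.while e p) σ σ' := by
  apply h.mono <;> simp [Cmd.wx, Cmd.wA, Cmd.wy, Cmd.wM]

/-- Started in `σ`, the compiled command halts within `T` steps in a state satisfying `Q`. -/
def Runs (G : SimpleGraph (Fin n)) (v : Finset (Fin n) → ℝ) (p : Cmd) (σ : St) (T : ℕ)
    (Q : St → Prop) : Prop :=
  ∀ s, Rel n σ s → ∃ s' t σ', Exec G v p.compile s s' t ∧ t ≤ T ∧ Rel n σ' s' ∧ Frame p σ σ' ∧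
    Q σ'

theorem Runs.mono {p : Cmd} {σ : St} {T T' : ℕ} {Q Q' : St → Prop} (h : Runs G v p σ T Q)
    (hT : T ≤ T') (hQ : ∀ σ', Frame p σ σ' → Q σ' → Q' σ') : Runs G v p σ T' Q' := by
  intro s hs
  obtain ⟨s', t, σ', he, ht, hr, hf, hq⟩ := h s hs
  exact ⟨s', t, σ', he, ht.trans hT, hr, hf, hQ σ' hf hq⟩

theorem Runs.seq {p q : Cmd} {σ : St} {T T₁ T₂ : ℕ} {Q Q₁ : St → Prop} (h : Runs G v p σ T₁ Q₁)
    (h' : ∀ σ', Frame p σ σ' → Q₁ σ' → Runs G v q σ' T₂ Q) (hT : T₁ + T₂ ≤ T) :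
    Runs G v (p ;; q) σ T Q := by
  intro s hs
  obtain ⟨s1, t1, σ1, e1, c1, r1, f1, q1⟩ := h s hs
  obtain ⟨s2, t2, σ2, e2, c2, r2, f2, q2⟩ := h' σ1 f1 q1 s1 r1
  exact ⟨s2, _, σ2, .seq e1 e2, by omega, r2, f1.seq_left.trans f2.seq_right, q2⟩

theorem Runs.ite {e : NExpr} {p q : Cmd} {σ : St} {T : ℕ} {Q : St → Prop}
    (h : e.eval G σ ≠ 0 → Runs G v p σ T Q) (h' : e.eval G σ = 0 → Runs G v q σ T Q) {T' : ℕ}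
    (hT : T + e.cost + 1 ≤ T') : Runs G v (.ite e p q) σ T' Q := by
  intro s hs
  obtain ⟨s1, t1, e1, c1, r1, v1, -⟩ := e.compile_exec (G := G) (v := v) 0 hs
  by_cases he : e.eval G σ = 0
  · obtain ⟨s2, t2, σ2, e2, c2, r2, f2, q2⟩ := h' he s1 r1
    exact ⟨s2, _, σ2, .seq e1 (.ite_false (by rw [v1, he]) e2), by omega, r2, f2.ite_right, q2⟩
  · obtain ⟨s2, t2, σ2, e2, c2, r2, f2, q2⟩ := h he s1 r1
    exact ⟨s2, _, σ2, .seq e1 (.ite_true (by rwa [v1]) e2), by omega, r2, f2.ite_left, q2⟩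

/-- The induction is on a bound `m` for the measure, so a measure that drops by more than one is
harmless. Frames refer to the fixed state `σ₀` before the loop, so invariants need not list what the
body leaves alone. -/
theorem Runs.while_aux {e : NExpr} {p : Cmd} (σ₀ : St) (C : ℕ) (I : St → Prop) (μ : St → ℕ)
    (hstep : ∀ σ', Frame p σ₀ σ' → I σ' → e.eval G σ' ≠ 0 →
      Runs G v p σ' C (fun σ'' => I σ'' ∧ μ σ'' < μ σ')) :
    ∀ (m : ℕ) (σ : St) (s : State), μ σ ≤ m → Frame p σ₀ σ → I σ → Rel n σ s →
      s.reg (treg 0) = e.eval G σ →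
      ∃ s' t σ', Exec G v (.loop (treg 0) (.seq p.compile (e.compile 0))) s s' t ∧
        t ≤ m * (C + e.cost + 1) + 1 ∧ Rel n σ' s' ∧ Frame p σ₀ σ' ∧ I σ' ∧ e.eval G σ' = 0 := by
  intro m
  induction m with
  | zero =>
    intro σ s hm hf hI hr hv
    by_cases he : e.eval G σ = 0
    · exact ⟨s, 1, σ, .loop_done (by rw [hv, he]), by omega, hr, hf, hI, he⟩
    · obtain ⟨s1, t1, σ1, e1, c1, r1, f1, I1, m1⟩ := hstep σ hf hI he s hr
      omega
  | succ m ih =>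
    intro σ s hm hf hI hr hv
    by_cases he : e.eval G σ = 0
    · exact ⟨s, 1, σ, .loop_done (by rw [hv, he]), by omega, hr, hf, hI, he⟩
    · obtain ⟨s1, t1, σ1, e1, c1, r1, f1, I1, m1⟩ := hstep σ hf hI he s hr
      obtain ⟨s2, t2, e2, c2, r2, v2, -⟩ := e.compile_exec (G := G) (v := v) 0 r1
      obtain ⟨s3, t3, σ3, e3, c3, r3, f3, I3, z3⟩ :=
        ih σ1 s2 (by omega) (hf.trans f1) I1 r2 v2
      refine ⟨s3, _, σ3, .loop_step (by rwa [hv]) (.seq e1 e2) e3, ?_, r3, f3, I3, z3⟩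
      have : (m + 1) * (C + e.cost + 1) = m * (C + e.cost + 1) + (C + e.cost + 1) := by ring
      omega

theorem Runs.while {e : NExpr} {p : Cmd} {σ : St} (C : ℕ) (I : St → Prop) (μ : St → ℕ)
    (h0 : I σ)
    (hstep : ∀ σ', Frame p σ σ' → I σ' → e.eval G σ' ≠ 0 →
      Runs G v p σ' C (fun σ'' => I σ'' ∧ μ σ'' < μ σ')) {T : ℕ}
    (hT : (μ σ + 1) * (C + e.cost + 1) ≤ T) :
    Runs G v (.while e p) σ T (fun σ' => I σ' ∧ e.eval G σ' = 0) := by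
  intro s hs
  obtain ⟨s1, t1, e1, c1, r1, v1, -⟩ := e.compile_exec (G := G) (v := v) 0 hs
  obtain ⟨s2, t2, σ2, e2, c2, r2, f2, q2⟩ :=
    Runs.while_aux (v := v) σ C I μ hstep (μ σ) σ s1 le_rfl (.refl _ _) h0 r1 v1
  refine ⟨s2, _, σ2, .seq e1 e2, ?_, r2, f2.while, q2⟩
  have : (μ σ + 1) * (C + e.cost + 1) = μ σ * (C + e.cost + 1) + (C + e.cost + 1) := by ring
  omega

/-! ### Loop-free commands and counting loops -/

theorem index_ne {n k k' i i' : ℕ} (hi : i < n) (hi' : i' < n) (h : k * n + i = k' * n + i') :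
    k = k' ∧ i = i' := by
  have h1 := congrArg (· / n) h
  have h2 := congrArg (· % n) h
  have hn : 0 < n := by omega
  simp only [Nat.mul_add_mod_self_right, Nat.mod_eq_of_lt hi, Nat.mod_eq_of_lt hi'] at h2
  rw [mul_comm k, mul_comm k'] at h1
  simp only [Nat.mul_add_div hn, Nat.div_eq_of_lt hi, Nat.div_eq_of_lt hi'] at h1
  exact ⟨by simpa using h1, h2⟩

theorem Rel.setVar {σ : St} {s : State} (h : Rel n σ s) (r a : ℕ) :
    Rel n { σ with x := Function.update σ.x r a }
      { s with reg := Function.update s.reg (vreg r) a } where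
  len := by simp [Function.update_apply, (vreg_ne_zero r).symm, h.len]
  reg r := by simp [Function.update_apply, vreg_inj, h.reg]
  mem := h.mem
  rreg := h.rreg
  rmem := h.rmem

theorem Rel.setReal {σ : St} {s : State} (h : Rel n σ s) (r : ℕ) (a : ℝ) :
    Rel n { σ with y := Function.update σ.y r a }
      { s with rreg := Function.update s.rreg r a } where
  len := h.len
  reg := h.reg
  mem := h.mem
  rreg := by simp [h.rreg]
  rmem := h.rmem

theorem Rel.coalitionAt {σ : St} {s : State} (h : Rel n σ s) (k : ℕ) :
    coalitionAt n s.mem (k * n) = σ.set n k := by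
  ext i
  simp [GCSG.coalitionAt, St.set, h.mem k i i.2]

theorem update_of_beq {α : Type*} {f : ℕ → α} {r i : ℕ} {a : α} (h : (r == i) = false) :
    Function.update f r a i = f i :=
  Function.update_of_ne (by rintro rfl; simp at h) _ _

/-- A conditional is charged for both branches, so the bound depends on the syntax alone and
concrete bounds can be computed. -/
theorem Runs.flat : ∀ {p : Cmd} {σ : St}, p.flat = true →
    Runs G v p σ p.cost (fun σ' => σ' = p.run G v σ)
  | .skip, σ, _ => fun s hs =>
      ⟨_, _, _, .instr _ _, le_rfl, hs.setTemp _ _, .refl _ _, rfl⟩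
  | .asg r e, σ, _ => fun s hs => by
      obtain ⟨s1, t1, e1, c1, r1, v1, -⟩ := e.compile_exec (G := G) (v := v) 0 hs
      refine ⟨_, _, _, .seq e1 (.seq (.instr _ _) (.instr _ _)), ?_, ?_, ?_, rfl⟩
      · simp only [Cmd.cost]; omega
      · have := (r1.setTemp 1 0).setVar r (e.eval G σ)
        simpa [Instr.run, Cmd.run, Function.update_apply, treg_inj, v1] using this
      · exact ⟨fun _ h => update_of_beq h, fun _ _ => rfl, fun _ _ => rfl, fun _ => rfl⟩
  | .put k i e, σ, _ => fun s hs => by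
      obtain ⟨s1, t1, e1, c1, r1, v1, -⟩ := e.compile_exec (G := G) (v := v) 0 hs
      obtain ⟨s2, t2, e2, c2, r2, v2, o2⟩ := i.compile_exec (G := G) (v := v) 2 r1
      have h0 := (o2 0 (by omega)).trans v1
      have r3 := r2.setTemp 3 (s2.reg 0 - s2.reg (treg 2))
      have hv : (Instr.run G v (.sub (treg 3) 0 (treg 2)) s2).reg (treg 2) =
          i.eval G σ := by
        simp [Instr.run, Function.update_apply, treg_inj, v2]
      have ht : (Instr.run G v (.sub (treg 3) 0 (treg 2)) s2).reg (treg 3) =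
          n - i.eval G σ := by
        simp [Instr.run, v2, r2.len]
      have hz : (Instr.run G v (.sub (treg 3) 0 (treg 2)) s2).reg (treg 0) =
          e.eval G σ := by
        simp [Instr.run, Function.update_apply, treg_inj, h0]
      by_cases hi : i.eval G σ < n
      · obtain ⟨s4, e4, r4, v4, o4⟩ := addSize_exec (G := G) (v := v) 2 k r3
        have v4' : s4.reg (treg 2) = i.eval G σ + k * n := by
          rw [v4]; exact congrArg (· + k * n) hv
        have o4' : s4.reg (treg 0) = e.eval G σ := by
          rw [o4 0 (by omega)]; exact hz
        refine ⟨_, _, _, .seq e1 (.seq e2 (.seq (.instr _ _) (.ite_true (by rw [ht]; omega)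
          (.seq e4 (.instr _ _))))), ?_, ?_, ?_, rfl⟩
        · simp only [Cmd.cost]; omega
        · simp only [Cmd.run, hi, if_true, Instr.run, v4', o4']
          refine ⟨r4.len, r4.reg, ?_, r4.rreg, r4.rmem⟩
          intro k' i' hi'
          simp only [Function.update_apply]
          by_cases hk : k' = k
          · subst hk
            by_cases hii : i' = i.eval G σ
            · subst hii
              simp [add_comm]
            · rw [if_neg (by omega)]
              simp [hii, r4.mem _ _ hi']
          · rw [if_neg, if_neg hk]
            · exact r4.mem _ _ hi'
            · intro h
              -- Different arrays occupy disjoint blocks of the memory, by uniqueness of quotient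
              -- and remainder modulo `n`.
              exact hk (index_ne hi' hi (h.trans (add_comm _ _))).1
        · simp only [Cmd.run, hi, if_true]
          exact ⟨fun _ _ => rfl, fun _ h => update_of_beq h, fun _ _ => rfl, fun _ => rfl⟩
      · refine ⟨_, _, _, .seq e1 (.seq e2 (.seq (.instr _ _) (.ite_false (by rw [ht]; omega)
          (.instr _ _)))), ?_, r3.setTemp _ _, .refl _ _, ?_⟩
        · simp only [Cmd.cost]; omega
        · simp [Cmd.run, hi]
  | .query r k, σ, _ => fun s hs => by
      obtain ⟨s1, e1, r1, v1, -⟩ := addSize_exec (G := G) (v := v) 0 k (hs.setTemp 0 0)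
      refine ⟨_, _, _, .seq (.instr _ _) (.seq e1 (.instr _ _)), ?_, ?_, ?_, rfl⟩
      · simp only [Cmd.cost]; omega
      · simp only [Function.update_self, zero_add] at v1
        have := r1.setReal r (v (σ.set n k))
        rw [← r1.coalitionAt k, ← v1] at this
        simpa [Instr.run, Cmd.run, ← r1.coalitionAt k, v1] using this
      · exact ⟨fun _ _ => rfl, fun _ _ => rfl, fun _ h => update_of_beq h, fun _ => rfl⟩
  | .radd r a b, σ, _ => fun s hs => by
      refine ⟨_, _, _, .instr _ _, le_rfl, ?_, ?_, rfl⟩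
      · have := hs.setReal r (σ.y a + σ.y b)
        simpa [Instr.run, Cmd.run, hs.rreg] using this
      · exact ⟨fun _ _ => rfl, fun _ _ => rfl, fun _ h => update_of_beq h, fun _ => rfl⟩
  | .rsub r a b, σ, _ => fun s hs => by
      refine ⟨_, _, _, .instr _ _, le_rfl, ?_, ?_, rfl⟩
      · have := hs.setReal r (σ.y a - σ.y b)
        simpa [Instr.run, Cmd.run, hs.rreg] using this
      · exact ⟨fun _ _ => rfl, fun _ _ => rfl, fun _ h => update_of_beq h, fun _ => rfl⟩
  | .rlt r a b, σ, _ => fun s hs => by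
      refine ⟨_, _, _, .instr _ _, le_rfl, ?_, ?_, rfl⟩
      · have := hs.setVar r (ltBit (σ.y a) (σ.y b))
        simpa [Instr.run, Cmd.run, hs.rreg] using this
      · exact ⟨fun _ h => update_of_beq h, fun _ _ => rfl, fun _ _ => rfl, fun _ => rfl⟩
  | .rload r e, σ, _ => fun s hs => by
      obtain ⟨s1, t1, e1, c1, r1, v1, -⟩ := e.compile_exec (G := G) (v := v) 0 hs
      refine ⟨_, _, _, .seq e1 (.instr _ _), ?_, ?_, ?_, rfl⟩
      · simp only [Cmd.cost]; omega
      · have := r1.setReal r (σ.M (e.eval G σ))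
        simpa [Instr.run, Cmd.run, v1, r1.rmem] using this
      · exact ⟨fun _ _ => rfl, fun _ _ => rfl, fun _ h => update_of_beq h, fun _ => rfl⟩
  | .rstore e r, σ, _ => fun s hs => by
      obtain ⟨s1, t1, e1, c1, r1, v1, -⟩ := e.compile_exec (G := G) (v := v) 0 hs
      refine ⟨_, _, _, .seq e1 (.instr _ _), ?_, ?_, ?_, rfl⟩
      · simp only [Cmd.cost]; omega
      · simp only [Instr.run, v1, Cmd.run]
        exact ⟨r1.len, r1.reg, r1.mem, r1.rreg, by simp [r1.rmem, r1.rreg]⟩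
      · constructor <;> simp +contextual [Cmd.run, Cmd.wM]
  | .seq p q, σ, h => by
      simp only [Cmd.flat, Bool.and_eq_true] at h
      exact Runs.seq (Runs.flat h.1) (fun σ' _ hσ => by
        subst hσ; exact Runs.flat h.2) le_rfl
  | .ite e p q, σ, h => by
      simp only [Cmd.flat, Bool.and_eq_true] at h
      refine Runs.ite (T := p.cost + q.cost) (fun he => ?_) (fun he => ?_)
        (by simp only [Cmd.cost]; omega)
      · exact (Runs.flat h.1).mono (by omega) (fun σ' _ hσ => by
          rw [hσ]; simp [Cmd.run, he])
      · exact (Runs.flat h.2).mono (by omega) (fun σ' _ hσ => by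
          rw [hσ]; simp [Cmd.run, he])

theorem Runs.of_flat {p : Cmd} {σ : St} {T : ℕ} {Q : St → Prop} (h : p.flat = true)
    (hQ : Q (p.run G v σ)) (hT : p.cost ≤ T) : Runs G v p σ T Q :=
  (Runs.flat h).mono hT fun _ _ hσ => hσ ▸ hQ

/-- The loop `for i = 0, …, e - 1`. -/
def Cmd.for (i : ℕ) (e : NExpr) (p : Cmd) : Cmd :=
  .asg i (.lit 0) ;; .while (.sub e (.var i)) (p ;; .asg i (.add (.var i) (.lit 1)))

/-- The bound `e` is evaluated anew in each round, so it must have the value `N` in every state that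
agrees with `σ` outside the footprint of the loop. The step has to produce the invariant after the
increment of the counter. -/
theorem Runs.for {i : ℕ} {e : NExpr} {p : Cmd} {σ : St} (N C : ℕ) (I : ℕ → St → Prop)
    (hi : p.wx i = false) (hN : ∀ σ', Frame (.for i e p) σ σ' → e.eval G σ' = N)
    (h0 : ∀ σ', σ' = { σ with x := Function.update σ.x i 0 } → I 0 σ')
    (hstep : ∀ k < N, ∀ σ', Frame (.for i e p) σ σ' → σ'.x i = k → I k σ' →
      Runs G v p σ' C (fun σ'' => σ''.x i = k →
        I (k + 1) { σ'' with x := Function.update σ''.x i (k + 1) })) {T : ℕ}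
    (hT : (N + 1) * (C + e.cost + 13) ≤ T) :
    Runs G v (.for i e p) σ T (fun σ' => I N σ' ∧ σ'.x i = N) := by
  unfold Cmd.for at *
  refine Runs.seq (T₁ := 3) (T₂ := (N + 1) * (C + e.cost + 10))
    (Runs.of_flat (Q := fun σ' => σ' = { σ with x := Function.update σ.x i 0 }) rfl rfl
      le_rfl) ?_ (by
      have : (N + 1) * (C + e.cost + 13) = (N + 1) * (C + e.cost + 10) + (N + 1) * 3 := by ring
      have : 3 ≤ (N + 1) * 3 := by omega
      omega)
  intro σ₁ hf₁ hσ₁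
  have key : ∀ σ', Frame (p ;; .asg i (.add (.var i) (.lit 1))) σ₁ σ' →
      Frame (.asg i (.lit 0) ;; .while (.sub e (.var i))
        (p ;; .asg i (.add (.var i) (.lit 1)))) σ σ' := fun σ' h =>
    hf₁.seq_left.trans h.while.seq_right
  refine Runs.mono (T := (N + 1) * (C + e.cost + 10))
    (Runs.while (C + 6) (fun σ' => σ'.x i ≤ N ∧ I (σ'.x i) σ') (fun σ' => N - σ'.x i)
    ?_ ?_ (T := (N + 1) * (C + e.cost + 10)) ?_) le_rfl ?_
  · have : σ₁.x i = 0 := by simp [hσ₁]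
    exact ⟨by omega, by rw [this]; exact h0 _ hσ₁⟩
  · intro σ' hf hI he
    have hf' := key σ' hf
    have hlt : σ'.x i < N := by
      simp only [NExpr.eval, hN _ hf'] at he
      omega
    refine Runs.seq (hstep _ hlt σ' hf' rfl hI.2) ?_ le_rfl
    intro σ'' hf'' hQ
    have hx := hf''.x i hi
    refine Runs.of_flat rfl ?_ (by simp [Cmd.cost, NExpr.cost])
    simp only [Cmd.run, NExpr.eval, Function.update_self, hx]
    exact ⟨⟨hlt, hQ hx⟩, by omega⟩
  · have : σ₁.x i = 0 := by simp [hσ₁]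
    simp only [this, NExpr.cost]
    have : C + 6 + (e.cost + 2 + 1) + 1 = C + e.cost + 10 := by ring
    rw [this]
    simp
  · intro σ' hf h
    obtain ⟨⟨hle, hI⟩, he⟩ := h
    have hf' := hf₁.seq_left.trans hf.seq_right
    simp only [NExpr.eval, hN _ hf'] at he
    have : σ'.x i = N := by omega
    exact ⟨this ▸ hI, this⟩

/-- The initial state. -/
def St.init : St := ⟨fun _ => 0, fun _ _ => 0, fun _ => 0, fun _ => 0⟩

theorem rel_init (n : ℕ) : Rel n St.init (State.init n) where
  len := by simp [State.init]
  reg r := by simp [State.init, St.init, vreg_ne_zero, Function.update_apply]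
  mem _ _ _ := rfl
  rreg := rfl
  rmem := rfl

/-! ### Marginal values -/

/-- The elements of `D` are added one at a time; each addition is one instance of independence, with
the set built so far as the separator. -/
theorem IDM.union_insert (h : IDM G v) {x : Fin n} {C D : Finset (Fin n)} (hx : x ∉ C)
    (hD : ∀ y ∈ D, y ∉ C ∧ y ≠ x ∧ ¬ G.Adj x y) :
    v (insert x (C ∪ D)) - v (C ∪ D) = v (insert x C) - v C := by
  induction D using Finset.induction_on with
  | empty => simp
  | insert d D hd ih =>
    have ih := ih fun y hy => hD y (Finset.mem_insert_of_mem hy)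
    obtain ⟨h1, h2, h3⟩ := hD d (Finset.mem_insert_self _ _)
    have hxD : x ∉ D := fun hxD => (hD x (Finset.mem_insert_of_mem hxD)).2.1 rfl
    have := h x d (C ∪ D) ((isSeparatorOf_iff _ _ _ _).2 ⟨h2.symm, by simp [hx, hxD],
      by simp [h1, hd], h3⟩)
    rw [← ih]
    have e1 : C ∪ D ∪ {x} = insert x (C ∪ D) := by grind
    have e2 : C ∪ D ∪ {x, d} = insert x (C ∪ insert d D) := by grind
    have e3 : C ∪ D ∪ {d} = C ∪ insert d D := by grind
    rw [e1, e2, e3] at this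
    exact this.symm

/-- No node of `C \ C'` is adjacent to `x`, so these nodes have no influence on its marginal value.
-/
theorem IDM.marginal_eq (h : IDM G v) {x : Fin n} {C C' : Finset (Fin n)} (hx : x ∉ C)
    (hC : C' ⊆ C) (hadj : ∀ y ∈ C, G.Adj x y → y ∈ C') :
    v (insert x C) - v C = v (insert x C') - v C' := by
  have := h.union_insert (x := x) (C := C') (D := C \ C') (fun h => hx (hC h)) (by
    intro y hy
    rw [Finset.mem_sdiff] at hy
    exact ⟨hy.2, fun h => hx (h ▸ hy.1), fun h => hy.2 (hadj y hy.1 h)⟩)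
  rwa [Finset.union_sdiff_of_subset hC] at this

/-! ### Elimination forests and labellings -/

/-- `anc` assigns to every node its set of proper ancestors in a rooted forest with parent
function `par` (where `0` means no parent), such that adjacent nodes are comparable. -/
structure ElimForest (G : SimpleGraph (Fin n)) (par : Fin n → ℕ) (anc : Fin n → Finset (Fin n)) :
    Prop where
  step : ∀ v, (par v = 0 ∧ anc v = ∅) ∨
    ∃ p : Fin n, par v = p + 1 ∧ p ∉ anc p ∧ anc v = insert p (anc p)
  edge : ∀ u v, G.Adj u v → u ∈ anc v ∨ v ∈ anc u

namespace ElimForest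
variable {par : Fin n → ℕ} {anc : Fin n → Finset (Fin n)} (hF : ElimForest G par anc)
include hF

theorem card_parent {v p : Fin n} (h : par v = p + 1) :
    p ∉ anc p ∧ anc v = insert p (anc p) ∧ (anc v).card = (anc p).card + 1 := by
  rcases hF.step v with ⟨h0, -⟩ | ⟨q, hq, hq', hv⟩
  · omega
  · have : q = p := Fin.ext (by omega)
    subst this
    exact ⟨hq', hv, by rw [hv, Finset.card_insert_of_notMem hq']⟩

/-- Induction on the depth, passing from `v` to its parent. Ancestor sets are therefore chains on
which the depth is strictly monotone. -/
theorem anc_of_mem : ∀ (k : ℕ) (v : Fin n), (anc v).card = k → ∀ u ∈ anc v,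
    anc u ⊆ anc v ∧ (anc u).card < (anc v).card ∧
      ∀ w ∈ anc v, w = u ∨ w ∈ anc u ∨ u ∈ anc w := by
  intro k
  induction k using Nat.strong_induction_on with
  | _ k ih =>
    intro v hv u hu
    rcases hF.step v with ⟨-, h0⟩ | ⟨p, hp, -, -⟩
    · simp [h0] at hu
    · obtain ⟨hpp, hvp, hcard⟩ := hF.card_parent hp
      have ihp := ih (anc p).card (by omega) p rfl
      rw [hvp, Finset.mem_insert] at hu
      rcases hu with rfl | hu
      · refine ⟨by rw [hvp]; exact Finset.subset_insert _ _, by omega, ?_⟩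
        intro w hw
        rw [hvp, Finset.mem_insert] at hw
        tauto
      · obtain ⟨h1, h2, h3⟩ := ihp u hu
        refine ⟨h1.trans (by rw [hvp]; exact Finset.subset_insert _ _), by omega, ?_⟩
        intro w hw
        rw [hvp, Finset.mem_insert] at hw
        rcases hw with rfl | hw
        · exact Or.inr (Or.inr hu)
        · exact h3 w hw

theorem card_lt {u v : Fin n} (h : u ∈ anc v) : (anc u).card < (anc v).card :=
  (hF.anc_of_mem _ v rfl u h).2.1

theorem chain {u w v : Fin n} (hu : u ∈ anc v) (hw : w ∈ anc v) :
    w = u ∨ w ∈ anc u ∨ u ∈ anc w := (hF.anc_of_mem _ v rfl u hu).2.2 w hw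

theorem not_mem_self (v : Fin n) : v ∉ anc v := fun h => lt_irrefl _ (hF.card_lt h)

/-- Build `C` in order of increasing depth. A new node of greatest depth is an ancestor of none of
the others, so their terms do not change, and its neighbours among them are ancestors, so its
marginal value is the one over its ancestors. -/
theorem value_eq_sum (hv : v ∅ = 0) (h : IDM G v) (C : Finset (Fin n)) :
    v C = ∑ x ∈ C, (v (insert x (C ∩ anc x)) - v (C ∩ anc x)) := by
  induction C using Finset.induction_on_max_value (fun x => (anc x).card) with
  | empty => simp [hv]
  | insert a s ha hmax ih =>
    rw [Finset.sum_insert ha]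
    have h1 : ∀ x ∈ s, insert a s ∩ anc x = s ∩ anc x := by
      intro x hx
      ext y
      simp only [Finset.mem_inter, Finset.mem_insert]
      constructor
      · rintro ⟨rfl | h1, h2⟩
        · have := hF.card_lt h2
          have := hmax x hx
          omega
        · exact ⟨h1, h2⟩
      · rintro ⟨h1, h2⟩
        exact ⟨Or.inr h1, h2⟩
    rw [Finset.sum_congr rfl fun x hx => by rw [h1 x hx], ← ih]
    have h2 : insert a s ∩ anc a = s ∩ anc a := by
      ext y
      simp only [Finset.mem_inter, Finset.mem_insert]
      constructor
      · rintro ⟨rfl | h1, h2⟩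
        · exact absurd h2 (hF.not_mem_self _)
        · exact ⟨h1, h2⟩
      · rintro ⟨h1, h2⟩
        exact ⟨Or.inr h1, h2⟩
    rw [h2]
    have := h.marginal_eq (x := a) (C := s) (C' := s ∩ anc a) ha Finset.inter_subset_left (by
      intro y hy hadj
      rcases hF.edge _ _ hadj with h' | h'
      · have := hF.card_lt h'
        have := hmax y hy
        omega
      · exact Finset.mem_inter.2 ⟨hy, h'⟩)
    linarith

end ElimForest

/-- The marginal value of `x` over its ancestors with label `l`. -/
noncomputable def gain (v : Finset (Fin n) → ℝ) (anc : Fin n → Finset (Fin n)) (lam : Fin n → ℕ)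
    (x : Fin n) (l : ℕ) : ℝ :=
  v (insert x ((anc x).filter fun y => lam y = l)) - v ((anc x).filter fun y => lam y = l)

theorem gain_congr {anc : Fin n → Finset (Fin n)} {lam lam' : Fin n → ℕ} {x : Fin n} (l : ℕ)
    (h : ∀ y ∈ anc x, lam y = lam' y) : gain v anc lam x l = gain v anc lam' x l := by
  unfold gain
  rw [Finset.filter_congr fun y hy => by rw [h y hy]]

/-- Ancestors of `x` with its label but outside its coalition are harmless as long as they are not
adjacent to `x`. This weak compatibility covers both an exact labelling of a given structure and the
components of the label classes of a given labelling. -/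
theorem ElimForest.value_eq_sum_gain {par : Fin n → ℕ} {anc : Fin n → Finset (Fin n)}
    (hF : ElimForest G par anc) (hv : v ∅ = 0) (h : IDM G v)
    (P : Finpartition (Finset.univ : Finset (Fin n))) (lam : Fin n → ℕ)
    (h1 : ∀ x, ∀ y ∈ anc x, y ∈ P.part x → lam y = lam x)
    (h2 : ∀ x, ∀ y ∈ anc x, G.Adj x y → lam y = lam x → y ∈ P.part x) :
    value v P = ∑ x, gain v anc lam x (lam x) := by
  have key : ∀ C ∈ P.parts, v C = ∑ x ∈ C, gain v anc lam x (lam x) := by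
    intro C hC
    rw [hF.value_eq_sum hv h C]
    refine Finset.sum_congr rfl fun x hx => ?_
    have hpart : P.part x = C := P.part_eq_of_mem hC hx
    unfold gain
    refine (h.marginal_eq ?_ ?_ ?_).symm
    · simp [hF.not_mem_self]
    · intro y hy
      rw [Finset.mem_inter] at hy
      exact Finset.mem_filter.2 ⟨hy.2, h1 x y hy.2 (hpart ▸ hy.1)⟩
    · intro y hy hadj
      rw [Finset.mem_filter] at hy
      exact Finset.mem_inter.2 ⟨hpart ▸ h2 x y hy.1 hadj hy.2, hy.1⟩
  unfold value
  rw [Finset.sum_congr rfl key, ← Finset.sum_biUnion]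
  · exact Finset.sum_congr P.biUnion_parts fun _ _ => rfl
  intro a ha b hb hab
  exact P.disjoint ha hb hab

/-- Labels are assigned by increasing depth. A node with an ancestor in its coalition copies that
label, consistently because the ancestors form a chain; otherwise it has fewer than `L` ancestors
and some label is free. Unrelated nodes may share a label. -/
theorem ElimForest.exists_labelling {par : Fin n → ℕ} {anc : Fin n → Finset (Fin n)}
    (hF : ElimForest G par anc) {L : ℕ} (hL : ∀ x, (anc x).card < L)
    (P : Finpartition (Finset.univ : Finset (Fin n))) :
    ∃ lam : Fin n → ℕ, (∀ x, 1 ≤ lam x ∧ lam x ≤ L) ∧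
      ∀ x, ∀ y ∈ anc x, (lam y = lam x ↔ y ∈ P.part x) := by
  suffices H : ∀ k, ∃ lam : Fin n → ℕ, (∀ x, 1 ≤ lam x ∧ lam x ≤ L) ∧
      ∀ x, (anc x).card < k → ∀ y ∈ anc x, (lam y = lam x ↔ y ∈ P.part x) by
    obtain ⟨lam, h1, h2⟩ := H L
    exact ⟨lam, h1, fun x => h2 x (hL x)⟩
  have hsymm : ∀ x y, y ∈ P.part x ↔ P.part y = P.part x := fun x y =>
    P.mem_part_iff_part_eq_part (Finset.mem_univ _) (Finset.mem_univ _)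
  intro k
  induction k with
  | zero => exact ⟨fun _ => 1, fun x => ⟨le_rfl, Nat.one_le_of_lt (hL x)⟩, fun x hx => by omega⟩
  | succ k ih =>
    obtain ⟨lam, h1, h2⟩ := ih
    have hchoice : ∀ x, (anc x).card = k → ∃ l, 1 ≤ l ∧ l ≤ L ∧
        ∀ y ∈ anc x, (lam y = l ↔ y ∈ P.part x) := by
      intro x hx
      by_cases hy : ∃ y ∈ anc x, y ∈ P.part x
      · obtain ⟨y, hya, hyP⟩ := hy
        refine ⟨lam y, (h1 y).1, (h1 y).2, fun z hz => ?_⟩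
        rw [hsymm] at hyP
        rw [hsymm, ← hyP]
        rcases hF.chain hya hz with rfl | hzy | hyz
        · simp
        · rw [h2 y (by have := hF.card_lt hya; omega) z hzy, hsymm]
        · rw [eq_comm, h2 z (by have := hF.card_lt hz; omega) y hyz, hsymm, eq_comm]
      · have : ∃ l ∈ Finset.Icc 1 L, l ∉ (anc x).image lam := by
          apply Finset.exists_mem_notMem_of_card_lt_card
          have := hL x
          have := Finset.card_image_le (s := anc x) (f := lam)
          simp
          omega
        obtain ⟨l, hl, hl'⟩ := this
        rw [Finset.mem_Icc] at hl
        refine ⟨l, hl.1, hl.2, fun z hz => ?_⟩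
        constructor
        · rintro rfl
          exact absurd (Finset.mem_image_of_mem _ hz) hl'
        · intro h
          exact absurd ⟨z, hz, h⟩ hy
    choose! c hc1 hc2 hc3 using hchoice
    refine ⟨fun x => if (anc x).card = k then c x else lam x, ?_, ?_⟩
    · intro x
      dsimp only
      split_ifs with hx
      · exact ⟨hc1 x hx, hc2 x hx⟩
      · exact h1 x
    · intro x hx y hy
      have := hF.card_lt hy
      dsimp only
      rw [if_neg (by omega : ¬ (anc y).card = k)]
      split_ifs with hx'
      · exact hc3 x hx' y hy
      · exact h2 x (by omega) y hy

/-! ### The table of optimal values -/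

/-- Horner's scheme for the digits `w 0, …, w (k - 1)` after the leading digit `u`. -/
def horner (B u : ℕ) (w : ℕ → ℕ) : ℕ → ℕ
  | 0 => u
  | k + 1 => horner B u w k * B + w k

theorem horner_inj {B u u' : ℕ} {w w' : ℕ → ℕ} : ∀ {k : ℕ}, (∀ i < k, w i < B) →
    (∀ i < k, w' i < B) → horner B u w k = horner B u' w' k → u = u' ∧ ∀ i < k, w i = w' i
  | 0, _, _, h => ⟨h, fun i hi => by omega⟩
  | k + 1, h1, h2, h => by
    have := index_ne (h1 k (by omega)) (h2 k (by omega)) h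
    obtain ⟨h3, h4⟩ := horner_inj (fun i hi => h1 i (by omega)) (fun i hi => h2 i (by omega)) this.1
    refine ⟨h3, fun i hi => ?_⟩
    rcases Nat.lt_succ_iff_lt_or_eq.1 hi with h | rfl
    · exact h4 i h
    · exact this.2

/-- Extension of a finite sequence by zero. -/
def ext0 (w : Fin n → ℕ) (i : ℕ) : ℕ := if h : i < n then w ⟨i, h⟩ else 0

theorem ext0_coe (w : Fin n → ℕ) (i : Fin n) : ext0 w i = w i := by simp [ext0]

/-- The address of the table entry for the node `u` and the labels `w`. -/
def key (B : ℕ) (u : Fin n) (w : Fin n → ℕ) : ℕ := horner B u (ext0 w) n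

/-- The node is the leading digit in Horner's scheme, so only the labels have to be smaller than the
base. -/
theorem key_inj {B : ℕ} {u u' : Fin n} {w w' : Fin n → ℕ} (h : ∀ i, w i < B) (h' : ∀ i, w' i < B)
    (he : key B u w = key B u' w') : u = u' ∧ w = w' := by
  have aux : ∀ (w : Fin n → ℕ), (∀ i, w i < B) → ∀ i < n, ext0 w i < B := by
    intro w hw i hi
    have := ext0_coe w ⟨i, hi⟩
    simp only at this
    rw [this]
    exact hw _
  obtain ⟨h1, h2⟩ := horner_inj (aux w h) (aux w' h') he
  refine ⟨Fin.ext h1, funext fun i => ?_⟩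
  have := h2 i i.2
  rwa [ext0_coe, ext0_coe] at this

/-- The value of giving the label `l` to the node `x` when its ancestors have the labels `w`. -/
noncomputable def obj (v : Finset (Fin n) → ℝ) (par : Fin n → ℕ) (anc : Fin n → Finset (Fin n))
    (B : ℕ) (M : ℕ → ℝ) (x : Fin n) (w : Fin n → ℕ) (l : ℕ) : ℝ :=
  gain v anc w x l + ∑ u with par u = x + 1, M (key B u (Function.update w x l))

/-- The labels of the ancestors of `x`. -/
def restr (anc : Fin n → Finset (Fin n)) (lam : Fin n → ℕ) (x : Fin n) : Fin n → ℕ :=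
  fun y => if y ∈ anc x then lam y else 0

/-- `a` is the maximum of `F` on `1, …, L`. -/
def IsMaxLabel (L : ℕ) (F : ℕ → ℝ) (a : ℝ) : Prop :=
  (∀ l, 1 ≤ l → l ≤ L → F l ≤ a) ∧ ∃ l, 1 ≤ l ∧ l ≤ L ∧ F l = a

namespace ElimForest
variable {par : Fin n → ℕ} {anc : Fin n → Finset (Fin n)} (hF : ElimForest G par anc)
include hF

theorem update_restr {lam : Fin n → ℕ} {x u : Fin n} (h : par u = x + 1) :
    Function.update (restr anc lam x) x (lam x) = restr anc lam u := by
  obtain ⟨h1, h2, -⟩ := hF.card_parent h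
  funext y
  by_cases hy : y = x
  · subst hy; simp [restr, h2]
  · simp [restr, h2, hy]

theorem obj_restr (B : ℕ) (M : ℕ → ℝ) (x : Fin n) (lam : Fin n → ℕ) :
    obj v par anc B M x (restr anc lam x) (lam x) =
      gain v anc lam x (lam x) + ∑ u with par u = x + 1, M (key B u (restr anc lam u)) := by
  unfold obj
  congr 1
  · exact gain_congr _ fun y hy => by simp [restr, hy]
  · refine Finset.sum_congr rfl fun u hu => ?_
    rw [hF.update_restr (by simpa using hu)]

/-- Every node that is not a root is the child of exactly one node. -/
theorem sum_children (F : Fin n → ℝ) :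
    ∑ x : Fin n, ∑ u with par u = x + 1, F u = ∑ u with par u ≠ 0, F u := by
  simp only [Finset.sum_filter]
  rw [Finset.sum_comm]
  refine Finset.sum_congr rfl fun u _ => ?_
  rcases hF.step u with ⟨h0, -⟩ | ⟨p, hp, -, -⟩
  · simp [h0]
  · rw [Finset.sum_eq_single p]
    · simp [hp]
    · intro b _ hb
      rw [if_neg]
      intro h
      exact hb (Fin.ext (by omega))
    · simp

/-- For each node compare its gain with its table entry minus the entries of its children. Summed
over all nodes these differences telescope to the entries of the roots, which have no ancestors, so
the sum is the same for every labelling. Each difference bounds the gain from above for any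
labelling, and from below for the greedy one. -/
theorem greedy_optimal {L B : ℕ} {M : ℕ → ℝ}
    (hM : ∀ x lam, (∀ y, 1 ≤ lam y ∧ lam y ≤ L) →
      IsMaxLabel L (obj v par anc B M x (restr anc lam x)) (M (key B x (restr anc lam x))))
    {lam lam' : Fin n → ℕ} (hl : ∀ y, 1 ≤ lam y ∧ lam y ≤ L) (hl' : ∀ y, 1 ≤ lam' y ∧ lam' y ≤ L)
    (hg : ∀ x l, 1 ≤ l → l ≤ L → obj v par anc B M x (restr anc lam x) l ≤
      obj v par anc B M x (restr anc lam x) (lam x)) :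
    ∑ x, gain v anc lam' x (lam' x) ≤ ∑ x, gain v anc lam x (lam x) := by
  have htel : ∀ mu : Fin n → ℕ,
      ∑ x, (M (key B x (restr anc mu x)) - ∑ u with par u = x + 1, M (key B u (restr anc mu u))) =
      ∑ u with par u = 0, M (key B u (fun _ => 0)) := by
    intro mu
    rw [Finset.sum_sub_distrib, hF.sum_children fun u => M (key B u (restr anc mu u)),
      ← Finset.sum_filter_add_sum_filter_not Finset.univ (fun u => par u = 0)
        fun u => M (key B u (restr anc mu u)), add_sub_cancel_right]
    refine Finset.sum_congr rfl fun u hu => ?_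
    rcases hF.step u with ⟨-, h0⟩ | ⟨p, hp, -, -⟩
    · congr 2
      funext y
      simp [restr, h0]
    · simp [hp] at hu
  calc ∑ x, gain v anc lam' x (lam' x)
      ≤ ∑ x, (M (key B x (restr anc lam' x)) -
          ∑ u with par u = x + 1, M (key B u (restr anc lam' u))) := by
        refine Finset.sum_le_sum fun x _ => ?_
        have := (hM x lam' hl').1 (lam' x) (hl' x).1 (hl' x).2
        rw [hF.obj_restr] at this
        linarith
    _ = ∑ x, (M (key B x (restr anc lam x)) -
          ∑ u with par u = x + 1, M (key B u (restr anc lam u))) := by rw [htel, htel]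
    _ ≤ _ := by
        refine Finset.sum_le_sum fun x _ => ?_
        obtain ⟨l, hl1, hl2, hl3⟩ := (hM x lam hl).2
        have := hg x l hl1 hl2
        rw [hF.obj_restr] at this
        linarith

end ElimForest

/-! ### Components -/

open Classical in
/-- The nodes that can be reached from `u` by walks that stay in `S` after `u`. -/
noncomputable def comp (G : SimpleGraph (Fin n)) (S : Finset (Fin n)) (u : Fin n) :
    Finset (Fin n) :=
  Finset.univ.filter fun i => Relation.ReflTransGen (fun a b => G.Adj a b ∧ b ∈ S) u i

theorem mem_comp {S : Finset (Fin n)} {u i : Fin n} :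
    i ∈ comp G S u ↔ Relation.ReflTransGen (fun a b => G.Adj a b ∧ b ∈ S) u i := by
  simp [comp]

theorem self_mem_comp (S : Finset (Fin n)) (u : Fin n) : u ∈ comp G S u :=
  mem_comp.2 .refl

theorem comp_tail {S : Finset (Fin n)} {u i j : Fin n} (h : i ∈ comp G S u) (hij : G.Adj i j)
    (hj : j ∈ S) : j ∈ comp G S u := mem_comp.2 ((mem_comp.1 h).tail ⟨hij, hj⟩)

/-- The component is the least set containing `u` that is closed under adjacency within `S`. -/
theorem comp_subset {S T : Finset (Fin n)} {u : Fin n} (hu : u ∈ T)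
    (h : ∀ i ∈ T, ∀ j ∈ S, G.Adj i j → j ∈ T) : comp G S u ⊆ T := by
  intro i hi
  rw [mem_comp] at hi
  induction hi with
  | refl => exact hu
  | tail _ hij ih => exact h _ ih _ hij.2 hij.1

theorem comp_subset_self {S : Finset (Fin n)} {u : Fin n} (hu : u ∈ S) : comp G S u ⊆ S :=
  comp_subset hu fun _ _ _ hj _ => hj

theorem comp_trans {S : Finset (Fin n)} {u i : Fin n} (h : i ∈ comp G S u) :
    comp G S i ⊆ comp G S u :=
  comp_subset h fun _ hi _ hj hij => comp_tail hi hij hj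

/-- The starting node of a walk need not lie in `S`, so reversing the walk requires `u ∈ S`. -/
theorem comp_symm {S : Finset (Fin n)} {u i : Fin n} (hu : u ∈ S) (h : i ∈ comp G S u) :
    u ∈ comp G S i := by
  have : i ∈ S ∧ u ∈ comp G S i := by
    rw [mem_comp] at h
    induction h with
    | refl => exact ⟨hu, self_mem_comp _ _⟩
    | tail _ hij ih =>
      exact ⟨hij.2, comp_trans (mem_comp.2 (.single ⟨hij.1.symm, ih.1⟩)) ih.2⟩
  exact this.2

theorem comp_eq {S : Finset (Fin n)} {u i : Fin n} (hu : u ∈ S) (h : i ∈ comp G S u) :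
    comp G S i = comp G S u :=
  (comp_trans h).antisymm (comp_trans (comp_symm hu h))

theorem comp_mono {S T : Finset (Fin n)} (h : S ⊆ T) (u : Fin n) : comp G S u ⊆ comp G T u :=
  comp_subset (self_mem_comp _ _) fun _ hi _ hj hij => comp_tail hi hij (h hj)

theorem comp_connected {S : Finset (Fin n)} {u : Fin n} :
    (G.induce (comp G S u : Set (Fin n))).Connected := by
  have hu : u ∈ (comp G S u : Set (Fin n)) := self_mem_comp _ _
  rw [SimpleGraph.connected_iff_exists_forall_reachable]
  refine ⟨⟨u, hu⟩, ?_⟩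
  rintro ⟨i, hi⟩
  have hi' := mem_comp.1 (Finset.mem_coe.1 hi)
  induction hi' with
  | refl => exact SimpleGraph.Reachable.refl _
  | @tail b c hb hbc ih =>
    exact (ih (Finset.mem_coe.2 (mem_comp.2 hb))).trans
      (SimpleGraph.Adj.reachable (by simpa using hbc.1))

/-! ### Elementary programs -/

theorem St.mem_set {σ : St} {k : ℕ} {i : Fin n} : i ∈ σ.set n k ↔ σ.A k i ≠ 0 := by
  simp [St.set]

theorem St.set_congr {σ σ' : St} {k k' : ℕ} (h : σ.A k = σ'.A k') : σ.set n k = σ'.set n k' := by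
  simp [St.set, h]

/-- The test for equality. -/
def NExpr.eqb (a b : NExpr) : NExpr := .sub (.lit 1) (.add (.sub a b) (.sub b a))

theorem NExpr.eval_eqb (a b : NExpr) (σ : St) :
    (NExpr.eqb a b).eval G σ = if a.eval G σ = b.eval G σ then 1 else 0 := by
  simp only [NExpr.eqb, NExpr.eval]
  split_ifs <;> omega

theorem adjBit_ne_zero {i j : Fin n} : adjBit G i j ≠ 0 ↔ G.Adj i j := by
  unfold adjBit
  split_ifs with h
  · simp only [ne_eq, one_ne_zero, not_false_eq_true, true_iff]
    obtain ⟨i', j', hi, hj, h⟩ := h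
    rwa [Fin.ext hi, Fin.ext hj] at h
  · simp only [ne_eq, not_true_eq_false, false_iff]
    exact fun h' => h ⟨i, j, rfl, rfl, h'⟩

/-- A loop that sets the entries of the array `k` one after the other. -/
theorem Runs.map {i k : ℕ} {p : Cmd} {σ : St} (F : Fin n → ℕ) (hp : p.flat = true)
    (hi : p.wx i = false)
    (hstep : ∀ j : Fin n, ∀ σ', Frame (.for i .size p) σ σ' → σ'.x i = j →
      σ'.A k j = σ.A k j → (p.run G v σ').A k j = F j ∧
        ∀ j' : Fin n, j' ≠ j → (p.run G v σ').A k j' = σ'.A k j')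
    {T : ℕ} (hT : (n + 1) * (p.cost + 15) ≤ T) :
    Runs G v (.for i .size p) σ T (fun σ' => ∀ j : Fin n, σ'.A k j = F j) := by
  refine (Runs.for (G := G) (v := v) n p.cost
    (fun m σ' => ∀ j : Fin n, σ'.A k j = if (j : ℕ) < m then F j else σ.A k j)
    hi (fun σ' _ => rfl) ?_ ?_ (T := T) ?_).mono le_rfl ?_
  · rintro σ' rfl j
    simp
  · intro m hm σ' hf hx hI
    refine Runs.of_flat hp ?_ le_rfl
    intro _ j
    obtain ⟨h1, h2⟩ := hstep ⟨m, hm⟩ σ' hf hx (by simpa using hI ⟨m, hm⟩)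
    by_cases hj : j = ⟨m, hm⟩
    · subst hj
      simpa using h1
    · have hj' : (j : ℕ) ≠ m := fun h => hj (Fin.ext h)
      show (p.run G v σ').A k j = _
      rw [h2 j hj, hI j]
      by_cases h : (j : ℕ) < m
      · rw [if_pos h, if_pos (by omega)]
      · rw [if_neg h, if_neg (by omega)]
  · simpa [NExpr.cost] using hT
  · intro σ' _ h j
    simpa using h.1 j

/-- Sets every entry of the array `k` to the value of `e` at its index. -/
def Cmd.fill (i k : ℕ) (e : NExpr) : Cmd := .for i .size (.put k (.var i) e)

theorem Runs.fill {i k : ℕ} {e : NExpr} {σ : St} (F : Fin n → ℕ)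
    (hstep : ∀ j : Fin n, ∀ σ', Frame (.fill i k e) σ σ' → σ'.x i = j →
      σ'.A k j = σ.A k j → e.eval G σ' = F j)
    {T : ℕ} (hT : (n + 1) * (e.cost + k + 21) ≤ T) :
    Runs G v (.fill i k e) σ T (fun σ' => ∀ j : Fin n, σ'.A k j = F j) := by
  refine Runs.map F rfl rfl ?_ ?_
  · intro j σ' hf hx hA
    have := hstep j σ' hf hx hA
    simp only [Cmd.run, NExpr.eval, hx, j.2, if_true, Function.update_self, this, true_and]
    intro j' hj'
    rw [Function.update_of_ne]
    exact fun h => hj' (Fin.ext h)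
  · refine le_trans (Nat.mul_le_mul_left _ ?_) hT
    simp only [Cmd.cost, NExpr.cost]
    omega

/-- The body of the search for the component. -/
def reachStep : Cmd :=
  .ite (.arr 2 (.var 3)) (.ite (.arr 1 (.var 4)) (.ite (.adj (.var 3) (.var 4))
    (.put 2 (.var 4) (.lit 1)) .skip) .skip) .skip

/-- Marks in array `2` the component of the node in variable `1` within the set in array `1`. -/
def reach : Cmd :=
  .fill 2 2 (.lit 0) ;; .put 2 (.var 1) (.lit 1) ;;
    .for 2 .size (.for 3 .size (.for 4 .size reachStep))

theorem reachStep_run {σ : St} {i j : Fin n} (hi : σ.x 3 = i) (hj : σ.x 4 = j) :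
    ((i ∈ σ.set n 2 ∧ j ∈ σ.set n 1 ∧ G.Adj i j) ∧
      (reachStep.run G v σ).set n 2 = insert j (σ.set n 2)) ∨
    (¬ (i ∈ σ.set n 2 ∧ j ∈ σ.set n 1 ∧ G.Adj i j) ∧
      (reachStep.run G v σ).set n 2 = σ.set n 2) := by
  have hadj : adjBit G i j = 0 ↔ ¬ G.Adj i j := by rw [← adjBit_ne_zero, not_not]
  simp only [reachStep, Cmd.run, NExpr.eval, hi, hj, i.2, j.2, if_true, St.mem_set]
  by_cases h1 : σ.A 2 i = 0
  · simp [h1]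
  by_cases h2 : σ.A 1 j = 0
  · simp [h1, h2, hi, hj]
  by_cases h3 : G.Adj i j
  · left
    refine ⟨⟨h1, h2, h3⟩, ?_⟩
    ext l
    by_cases hl : l = j
    · subst hl; simp [St.mem_set, h1, h2, h3, hi, hj, hadj]
    · have : (l : ℕ) ≠ j := fun h => hl (Fin.ext h)
      simp [St.mem_set, h1, h2, h3, hi, hj, hadj, hl, this, Function.update_apply]
  · simp [h1, h2, h3, hi, hj, hadj]

/-- Nodes marked during the round may already be used in it; this can only help. The closed set `K`
keeps the marks inside the component, and the last clause says that all neighbours of the old marks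
are reached. -/
theorem reach_round {σ : St} {K : Finset (Fin n)}
    (hK : ∀ i ∈ K, ∀ j ∈ σ.set n 1, G.Adj i j → j ∈ K) (h2 : σ.set n 2 ⊆ K) :
    Runs G v (.for 3 .size (.for 4 .size reachStep)) σ ((n + 1) * ((n + 1) * 60 + 15))
      (fun σ' => σ.set n 2 ⊆ σ'.set n 2 ∧ σ'.set n 2 ⊆ K ∧
        ∀ i ∈ σ.set n 2, ∀ j ∈ σ.set n 1, G.Adj i j → j ∈ σ'.set n 2) := by
  refine (Runs.for n ((n + 1) * 60) (fun m σ' => σ.set n 2 ⊆ σ'.set n 2 ∧ σ'.set n 2 ⊆ K ∧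
    ∀ i ∈ σ.set n 2, (i : ℕ) < m → ∀ j ∈ σ.set n 1, G.Adj i j → j ∈ σ'.set n 2) rfl
    (fun _ _ => rfl) ?_ ?_ (by simp [NExpr.cost])).mono le_rfl ?_
  · rintro _ rfl
    exact ⟨subset_rfl, h2, fun i _ hi => by omega⟩
  · intro m hm σ₁ hf₁ hx₁ hI
    have hS₁ : σ₁.set n 1 = σ.set n 1 := St.set_congr (hf₁.A 1 rfl)
    refine (Runs.for n 36 (fun l σ' => σ₁.set n 2 ⊆ σ'.set n 2 ∧ σ'.set n 2 ⊆ K ∧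
      ((⟨m, hm⟩ : Fin n) ∈ σ.set n 2 → ∀ j ∈ σ.set n 1, (j : ℕ) < l → G.Adj ⟨m, hm⟩ j →
        j ∈ σ'.set n 2)) rfl (fun _ _ => rfl) ?_ ?_ ?_).mono le_rfl ?_
    · rintro _ rfl
      exact ⟨subset_rfl, hI.2.1, fun _ j _ hj => by omega⟩
    · intro l hl σ₂ hf₂ hx₂ hJ
      have hx₃ : σ₂.x 3 = (⟨m, hm⟩ : Fin n) := (hf₂.x 3 rfl).trans hx₁
      have hx₄ : σ₂.x 4 = (⟨l, hl⟩ : Fin n) := hx₂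
      have hS₂ : σ₂.set n 1 = σ.set n 1 := (St.set_congr (hf₂.A 1 rfl)).trans hS₁
      refine Runs.of_flat rfl ?_ (by decide)
      intro _
      obtain ⟨h1, h2, h3⟩ := hJ
      show _ ⊆ (reachStep.run G v σ₂).set n 2 ∧ (reachStep.run G v σ₂).set n 2 ⊆ K ∧
        (_ → ∀ j ∈ _, _ → _ → j ∈ (reachStep.run G v σ₂).set n 2)
      rcases reachStep_run (G := G) (v := v) hx₃ hx₄ with ⟨⟨c1, c2, c3⟩, he⟩ | ⟨hc, he⟩ <;> rw [he]
      · refine ⟨h1.trans (Finset.subset_insert _ _),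
          Finset.insert_subset (hK _ (h2 c1) _ (hS₂ ▸ c2) c3) h2, ?_⟩
        intro hm' j hj hjl hadj
        rcases Nat.lt_succ_iff_lt_or_eq.1 hjl with h | h
        · exact Finset.mem_insert_of_mem (h3 hm' j hj h hadj)
        · rw [show j = ⟨l, hl⟩ from Fin.ext h]
          exact Finset.mem_insert_self _ _
      · refine ⟨h1, h2, ?_⟩
        intro hm' j hj hjl hadj
        rcases Nat.lt_succ_iff_lt_or_eq.1 hjl with h | h
        · exact h3 hm' j hj h hadj
        · have : j = ⟨l, hl⟩ := Fin.ext h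
          subst this
          exact absurd ⟨h1 (hI.1 hm'), hS₂ ▸ hj, hadj⟩ hc
    · simp only [NExpr.cost]; omega
    · rintro σ' _ ⟨⟨h1, h2, h3⟩, -⟩ -
      refine ⟨hI.1.trans h1, h2, ?_⟩
      intro i hi him j hj hadj
      show j ∈ σ'.set n 2
      rcases Nat.lt_succ_iff_lt_or_eq.1 him with h | h
      · exact h1 (hI.2.2 i hi h j hj hadj)
      · have : i = ⟨m, hm⟩ := Fin.ext h
        subst this
        exact h3 hi j hj j.2 hadj
  · rintro σ' _ ⟨⟨h1, h2, h3⟩, -⟩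
    exact ⟨h1, h2, fun i hi => h3 i hi i.2⟩

/-- A round that marks nothing new shows that the marked set is closed, hence the whole component.
Every other round adds a node, so `n` rounds suffice. -/
theorem reach_runs {σ : St} (u : Fin n) (hu : σ.x 1 = u) :
    Runs G v reach σ (200 * (n + 1) ^ 3)
      (fun σ' => σ'.set n 2 = comp G (σ.set n 1) u) := by
  unfold reach
  refine Runs.seq (T₁ := (n + 1) * 24) (T₂ := 10 + (n + 1) * ((n + 1) * ((n + 1) * 60 + 15) + 15))
    (Runs.fill (fun _ => 0) (fun _ _ _ _ _ => rfl) (by simp [NExpr.cost])) ?_ ?_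
  swap
  · have h1 : 1 ≤ n + 1 := by omega
    have h2 : (n + 1) ≤ (n + 1) ^ 2 := by nlinarith
    have h3 : (n + 1) ^ 2 ≤ (n + 1) ^ 3 := by nlinarith [sq_nonneg (n + 1)]
    nlinarith
  intro σ₁ hf₁ h₁
  refine Runs.seq (T₁ := 10) (T₂ := (n + 1) * ((n + 1) * ((n + 1) * 60 + 15) + 15))
    (Runs.of_flat (Q := fun σ' => σ'.set n 2 = {u}) rfl ?_ (by decide)) ?_ le_rfl
  · have hx : σ₁.x 1 = u := (hf₁.x 1 rfl).trans hu
    simp only [Cmd.run, NExpr.eval, hx, u.2, if_true]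
    ext i
    by_cases hi : i = u
    · subst hi; simp [St.mem_set]
    · have : (i : ℕ) ≠ u := fun h => hi (Fin.ext h)
      simp [St.mem_set, Function.update_apply, hi, this, h₁]
  intro σ₂ hf₂ h₂
  have hS₂ : σ₂.set n 1 = σ.set n 1 := by
    rw [St.set_congr (hf₂.A 1 rfl), St.set_congr (hf₁.A 1 rfl)]
  set K := comp G (σ.set n 1) u with hKdef
  have hK : ∀ i ∈ K, ∀ j ∈ σ.set n 1, G.Adj i j → j ∈ K := fun i hi j hj hij => comp_tail hi hij hj
  refine (Runs.for n ((n + 1) * ((n + 1) * 60 + 15))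
    (fun m σ' => u ∈ σ'.set n 2 ∧ σ'.set n 2 ⊆ K ∧ (σ'.set n 2 = K ∨ m < (σ'.set n 2).card)) rfl
    (fun _ _ => rfl) ?_ ?_ (by simp [NExpr.cost])).mono le_rfl ?_
  · rintro _ rfl
    show u ∈ σ₂.set n 2 ∧ σ₂.set n 2 ⊆ K ∧ (σ₂.set n 2 = K ∨ 0 < (σ₂.set n 2).card)
    rw [h₂]
    simp [hKdef, self_mem_comp]
  · intro m hm σ₃ hf₃ hx₃ hI
    have hS₃ : σ₃.set n 1 = σ.set n 1 := by rw [St.set_congr (hf₃.A 1 rfl), hS₂]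
    refine (reach_round (K := K) (by rwa [hS₃]) hI.2.1).mono le_rfl ?_
    rintro σ' _ ⟨h1, h2, h3⟩ -
    show u ∈ σ'.set n 2 ∧ σ'.set n 2 ⊆ K ∧ (σ'.set n 2 = K ∨ m + 1 < (σ'.set n 2).card)
    refine ⟨h1 hI.1, h2, ?_⟩
    rw [hS₃] at h3
    rcases hI.2.2 with h | h
    · exact Or.inl (h2.antisymm (h ▸ h1))
    · by_cases he : σ'.set n 2 = σ₃.set n 2
      · left
        refine h2.antisymm (comp_subset (h1 hI.1) ?_)
        intro i hi j hj hij
        exact h3 i (he ▸ hi) j hj hij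
      · right
        have := Finset.card_lt_card (h1.ssubset_of_ne (Ne.symm he))
        omega
  · rintro σ' _ ⟨⟨h1, h2, h3⟩, -⟩
    rcases h3 with h | h
    · exact h
    -- Otherwise more than `n` nodes would be marked.
    · have := Finset.card_le_univ (σ'.set n 2)
      simp at this
      omega

/-- Counts the elements of the set in array `2`. -/
def count : Cmd :=
  .asg 5 (.lit 0) ;; .for 2 .size (.ite (.arr 2 (.var 2)) (.asg 5 (.add (.var 5) (.lit 1))) .skip)

theorem count_runs (σ : St) :
    Runs G v count σ (50 * (n + 1)) (fun σ' => σ'.x 5 = (σ.set n 2).card) := by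
  refine Runs.seq (T₁ := 3) (T₂ := 45 * (n + 1))
    (Runs.of_flat (Q := fun σ' => σ'.x 5 = 0) rfl rfl le_rfl) ?_ (by omega)
  intro σ₁ hf₁ h₁
  refine (Runs.for n 22 (fun m σ' => σ'.x 5 = ((σ.set n 2).filter fun i : Fin n => (i : ℕ) < m).card) rfl
    (fun _ _ => rfl) ?_ ?_ (by simp only [NExpr.cost]; omega)).mono le_rfl ?_
  · rintro _ rfl
    simpa [Function.update_apply] using h₁
  · intro m hm σ₂ hf₂ hx₂ hI
    refine Runs.of_flat rfl ?_ (by decide)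
    intro _
    have hA : σ₂.A 2 = σ.A 2 := (hf₂.A 2 rfl).trans (hf₁.A 2 rfl)
    have hins : (σ.set n 2).filter (fun i : Fin n => (i : ℕ) < m + 1) =
        if σ.A 2 m ≠ 0 then insert (⟨m, hm⟩ : Fin n) ((σ.set n 2).filter fun i : Fin n => (i : ℕ) < m)
        else (σ.set n 2).filter fun i : Fin n => (i : ℕ) < m := by
      split_ifs with h
      · ext i
        simp only [Finset.mem_filter, Finset.mem_insert, St.mem_set, Fin.ext_iff,
          Nat.lt_succ_iff_lt_or_eq]
        constructor
        · rintro ⟨h1, h2 | h2⟩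
          · exact Or.inr ⟨h1, h2⟩
          · exact Or.inl h2
        · rintro (h1 | h1)
          · exact ⟨h1 ▸ h, Or.inr h1⟩
          · exact ⟨h1.1, Or.inl h1.2⟩
      · ext i
        simp only [Finset.mem_filter, St.mem_set, Nat.lt_succ_iff_lt_or_eq]
        constructor
        · rintro ⟨h1, h2 | h2⟩
          · exact ⟨h1, h2⟩
          · exact absurd (h2 ▸ h1) h
        · exact fun h1 => ⟨h1.1, Or.inl h1.2⟩
    rw [hins]
    simp only [Cmd.run, NExpr.eval, hx₂, hm, if_true, hA]
    split_ifs with h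
    · rw [Finset.card_insert_of_notMem (by simp)]
      simpa using hI
    · simpa using hI
  · rintro σ' _ ⟨h, -⟩
    rw [h, Finset.filter_true_of_mem fun i _ => i.2]

/-! ### Codes of sets of nodes -/

/-- The set of nodes encoded by the nonzero base `n + 1` digits of `c`. -/
def codeSet (n c : ℕ) : Finset (Fin n) :=
  Finset.univ.filter fun x => (x : ℕ) + 1 ∈ Nat.digits (n + 1) c

theorem mem_codeSet {c : ℕ} {x : Fin n} :
    x ∈ codeSet n c ↔ (x : ℕ) + 1 ∈ Nat.digits (n + 1) c := by
  simp [codeSet]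

/-- A code with `m` digits names at most `m` nodes. This bounds whichever separator the search
happens to find first. -/
theorem card_codeSet_le {c m : ℕ} (hc : c < (n + 1) ^ m) : (codeSet n c).card ≤ m := by
  rcases Nat.eq_zero_or_pos n with rfl | hn
  · simp [codeSet]
  have h1 : ((codeSet n c).image fun x : Fin n => (x : ℕ) + 1) ⊆ (Nat.digits (n + 1) c).toFinset := by
    intro y hy
    obtain ⟨x, hx, rfl⟩ := Finset.mem_image.1 hy
    exact List.mem_toFinset.2 (mem_codeSet.1 hx)
  have h2 := (Finset.card_le_card h1).trans (List.toFinset_card_le _)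
  rw [Finset.card_image_of_injective _ fun a b h => Fin.ext (by simpa using h)] at h2
  exact h2.trans ((Nat.digits_length_le_iff (by omega) _).2 hc)

/-- The elements, shifted by one, serve as digits. They are nonzero, so the leading digit is not
lost and the list is recovered from the number. For `n = 0` the base would be `1`. -/
theorem exists_codeSet_eq {X : Finset (Fin n)} {m : ℕ} (hX : X.card ≤ m) :
    ∃ c < (n + 1) ^ m, codeSet n c = X := by
  rcases Nat.eq_zero_or_pos n with rfl | hn
  · exact ⟨0, by positivity, Subsingleton.elim _ _⟩
  set l : List ℕ := X.toList.map fun x : Fin n => (x : ℕ) + 1 with hl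
  have hlt : ∀ d ∈ l, d < n + 1 := by
    intro d hd
    obtain ⟨x, -, rfl⟩ := List.mem_map.1 hd
    omega
  have hdig : Nat.digits (n + 1) (Nat.ofDigits (n + 1) l) = l := by
    refine Nat.digits_ofDigits _ (by omega) _ hlt fun h => ?_
    obtain ⟨x, -, hx⟩ := List.mem_map.1 (List.getLast_mem h)
    omega
  refine ⟨Nat.ofDigits (n + 1) l, ?_, ?_⟩
  · refine (Nat.ofDigits_lt_base_pow_length (by omega) hlt).trans_le ?_
    exact Nat.pow_le_pow_right (by omega) (by simpa [hl] using hX)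
  · ext x
    rw [mem_codeSet, hdig, hl, List.mem_map]
    constructor
    · rintro ⟨y, hy, hxy⟩
      rw [Finset.mem_toList] at hy
      rwa [← Fin.ext (by simpa using hxy : (y : ℕ) = x)]
    · exact fun hx => ⟨x, Finset.mem_toList.2 hx, rfl⟩

theorem mem_codeSet_of_ne_zero (hn : 0 < n) {q : ℕ} (hq : q ≠ 0) {x : Fin n} :
    x ∈ codeSet n q ↔ (x : ℕ) + 1 = q % (n + 1) ∨ x ∈ codeSet n (q / (n + 1)) := by
  rw [mem_codeSet, Nat.digits_def' (by omega) (by omega), List.mem_cons, mem_codeSet]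

/-- Replaces the variable `q` by its remainder modulo `e`, the variable `t` by its quotient. -/
def Cmd.divMod (q t : ℕ) (e : NExpr) : Cmd :=
  .asg t (.lit 0) ;; .while (.sub (.add (.var q) (.lit 1)) e)
    (.asg q (.sub (.var q) e) ;; .asg t (.add (.var t) (.lit 1)))

/-- Division is repeated subtraction, so its cost is linear in the dividend. This is why the number
of codes enters the time of the table with exponent `2`, and not `1`. -/
theorem divMod_runs {q t : ℕ} {e : NExpr} {σ : St} {b : ℕ} (hb : 0 < b) (hqt : q ≠ t)
    (he : ∀ σ', Frame (.divMod q t e) σ σ' → e.eval G σ' = b) :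
    Runs G v (.divMod q t e) σ ((σ.x q + 1) * (2 * e.cost + 20))
      (fun σ' => σ'.x q = σ.x q % b ∧ σ'.x t = σ.x q / b) := by
  refine Runs.seq (T₁ := 3) (T₂ := (σ.x q + 1) * (2 * e.cost + 17))
    (Runs.of_flat (Q := fun σ' => σ'.x t = 0 ∧ σ'.x q = σ.x q) rfl ?_ le_rfl) ?_ ?_
  · simp [Cmd.run, NExpr.eval, Function.update_of_ne hqt]
  swap
  · have : (σ.x q + 1) * (2 * e.cost + 20) = (σ.x q + 1) * (2 * e.cost + 17) + (σ.x q + 1) * 3 := by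
      ring
    omega
  rintro σ₁ hf₁ ⟨ht, hq⟩
  refine (Runs.while (e.cost + 11) (fun σ' => σ'.x t * b + σ'.x q = σ.x q) (fun σ' => σ'.x q)
    (by simp [ht, hq]) ?_ (by
      rw [hq]
      refine Nat.mul_le_mul_left _ ?_
      simp only [NExpr.cost]; omega)).mono le_rfl ?_
  · intro σ' hf hI hne
    have hb' : e.eval G σ' = b := he _ (hf₁.seq_left.trans hf.while.seq_right)
    simp only [NExpr.eval, hb'] at hne
    refine Runs.of_flat rfl ?_ (by simp only [Cmd.cost, NExpr.cost]; omega)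
    simp only [Cmd.run, NExpr.eval, hb', Function.update_self, Function.update_of_ne hqt,
      Function.update_of_ne hqt.symm]
    refine ⟨?_, by omega⟩
    rw [← hI, add_mul, one_mul]
    omega
  · rintro σ' hf ⟨hI, h0⟩
    have hb' : e.eval G σ' = b := he _ (hf₁.seq_left.trans hf.seq_right)
    simp only [NExpr.eval, hb'] at h0
    have hlt : σ'.x q < b := by omega
    rw [← hI]
    constructor
    · rw [mul_comm, Nat.mul_add_mod, Nat.mod_eq_of_lt hlt]
    · rw [mul_comm, Nat.mul_add_div hb, Nat.div_eq_of_lt hlt, add_zero]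

/-- Marks in array `5` the nodes encoded by variable `7`. -/
def decodeSet : Cmd :=
  .asg 9 (.var 7) ;; .fill 2 5 (.lit 0) ;; .while (.var 9)
    (.divMod 9 10 (.add .size (.lit 1)) ;;
      .ite (.var 9) (.put 5 (.sub (.var 9) (.lit 1)) (.lit 1)) .skip ;; .asg 9 (.var 10))

theorem decodeSet_runs (hn : 0 < n) (σ : St) :
    Runs G v decodeSet σ (50 * (n + 1) + (σ.x 7 + 1) * ((σ.x 7 + 1) * 28 + 40))
      (fun σ' => σ'.set n 5 = codeSet n (σ.x 7)) := by
  refine Runs.seq (T₁ := 4) (T₂ := 30 * (n + 1) + (σ.x 7 + 1) * ((σ.x 7 + 1) * 28 + 40))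
    (Runs.of_flat (Q := fun σ' => σ'.x 9 = σ.x 7) rfl rfl le_rfl) ?_ (by omega)
  intro σ₁ hf₁ h₁
  refine Runs.seq (T₁ := 30 * (n + 1)) (Runs.fill (fun _ => 0) (fun _ _ _ _ _ => rfl)
    (by simp only [NExpr.cost]; omega)) ?_ le_rfl
  intro σ₂ hf₂ h₂
  have hx₂ : σ₂.x 9 = σ.x 7 := (hf₂.x 9 rfl).trans h₁
  -- Marked nodes and nodes of the remaining code together make up the set. The remaining code
  -- itself is the measure; this overestimates the number of digits but suffices.
  refine (Runs.while ((σ.x 7 + 1) * 28 + 30)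
    (fun σ' => σ'.x 9 ≤ σ.x 7 ∧
      ∀ x, x ∈ codeSet n (σ.x 7) ↔ x ∈ σ'.set n 5 ∨ x ∈ codeSet n (σ'.x 9))
    (fun σ' => σ'.x 9) ?_ ?_ ?_).mono le_rfl ?_
  · refine ⟨hx₂.le, fun x => ?_⟩
    simp [St.mem_set, h₂, hx₂]
  · rintro σ₃ hf₃ ⟨hle, hI⟩ hne
    have hne : σ₃.x 9 ≠ 0 := hne
    refine Runs.seq (T₂ := 30) ((divMod_runs (b := n + 1) (by omega) (by decide)
      (fun _ _ => rfl)).mono (Nat.mul_le_mul_right _ (Nat.succ_le_succ hle))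
      (fun _ _ h => h)) ?_ (by simp only [NExpr.cost]; omega)
    rintro σ₄ hf₄ ⟨hq, ht⟩
    refine Runs.of_flat rfl ?_ (by decide)
    have hA : σ₄.A 5 = σ₃.A 5 := hf₄.A 5 rfl
    have hdiv : σ₃.x 9 / (n + 1) < σ₃.x 9 := Nat.div_lt_self (by omega) (by omega)
    have hmod : σ₃.x 9 % (n + 1) < n + 1 := Nat.mod_lt _ (by omega)
    have hlt : σ₃.x 9 % (n + 1) - 1 < n := by omega
    by_cases h0 : σ₃.x 9 % (n + 1) = 0
    · simp only [Cmd.run, NExpr.eval, hq, h0, ne_eq, not_true_eq_false, if_false, ht,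
        Function.update_self]
      refine ⟨⟨by omega, fun x => ?_⟩, hdiv⟩
      rw [hI x, mem_codeSet_of_ne_zero hn hne]
      simp [St.mem_set, hA, h0]
    · simp only [Cmd.run, NExpr.eval, hq, h0, ne_eq, not_false_eq_true, if_true, ht, hlt,
        Function.update_self]
      refine ⟨⟨by omega, fun x => ?_⟩, hdiv⟩
      rw [hI x, mem_codeSet_of_ne_zero hn hne]
      simp only [St.mem_set, Function.update_self, Function.update_apply, hA]
      by_cases hx : (x : ℕ) = σ₃.x 9 % (n + 1) - 1
      · have : (x : ℕ) + 1 = σ₃.x 9 % (n + 1) := by omega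
        simp [← hx, this]
      · have : (x : ℕ) + 1 ≠ σ₃.x 9 % (n + 1) := by omega
        simp [hx, this]
  · rw [hx₂]
    refine Nat.mul_le_mul_left _ ?_
    simp only [NExpr.cost]; omega
  · rintro σ' _ ⟨⟨-, hI⟩, h0⟩
    have h0 : σ'.x 9 = 0 := h0
    ext x
    rw [hI x, h0]
    simp [mem_codeSet]

/-! ### The search for a separator -/

/-- The multiple `k e`. -/
def NExpr.smul (e : NExpr) : ℕ → NExpr
  | 0 => .lit 0
  | k + 1 => .add e (e.smul k)

theorem NExpr.eval_smul (e : NExpr) (σ : St) : ∀ k, (e.smul k).eval G σ = k * e.eval G σ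
  | 0 => by simp [NExpr.smul, NExpr.eval]
  | k + 1 => by rw [NExpr.smul, NExpr.eval, eval_smul e σ k]; ring

theorem NExpr.cost_smul (r : ℕ) : ∀ k, ((NExpr.var r).smul k).cost = 3 * k + 1
  | 0 => rfl
  | k + 1 => by rw [NExpr.smul, NExpr.cost, cost_smul r k]; simp only [NExpr.cost]; ring

/-- Removing `X` from `K` leaves only components of size at most `p / q` times `k`. -/
def IsGoodSeparator (G : SimpleGraph (Fin n)) (p q k : ℕ) (K X : Finset (Fin n)) : Prop :=
  ∀ z ∈ K \ X, q * (comp G (K \ X) z).card ≤ p * k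

/-- Measures the component of the node in variable `11`. -/
def checkNode (p q : ℕ) : Cmd :=
  .asg 1 (.var 11) ;; reach ;; count ;;
    .ite (.sub ((NExpr.var 5).smul q) ((NExpr.var 6).smul p)) (.asg 8 (.lit 1)) .skip

/-- Clears variable `8` if the set in array `5` separates the set in array `4` well. -/
def checkSeparator (p q : ℕ) : Cmd :=
  .for 2 .size (.ite (.arr 5 (.var 2)) (.put 1 (.var 2) (.lit 0))
    (.put 1 (.var 2) (.arr 4 (.var 2)))) ;;
  .asg 8 (.lit 0) ;;
  .for 11 .size (.ite (.arr 1 (.var 11)) (checkNode p q) .skip)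

theorem checkNode_runs {σ : St} (p q : ℕ) (z : Fin n) (hz : σ.x 11 = z) :
    Runs G v (checkNode p q) σ (300 * ((p + q + 1) * (n + 1) ^ 3))
      (fun σ' => σ'.x 8 = if q * (comp G (σ.set n 1) z).card ≤ p * σ.x 6 then σ.x 8 else 1) := by
  have hZ : (n + 1) ≤ (n + 1) ^ 3 := Nat.le_self_pow (by norm_num) _
  have h1 : (n + 1) ^ 3 ≤ (p + q + 1) * (n + 1) ^ 3 := Nat.le_mul_of_pos_left _ (by omega)
  have h2 : p + q + 1 ≤ (p + q + 1) * (n + 1) ^ 3 := Nat.le_mul_of_pos_right _ (by positivity)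
  refine Runs.seq (T₁ := 4) (T₂ := 200 * (n + 1) ^ 3 + (50 * (n + 1) + (3 * (p + q) + 8)))
    (Runs.of_flat (Q := fun σ' => σ'.x 1 = z) rfl hz le_rfl) ?_ (by omega)
  intro σ₁ hf₁ h₁
  refine Runs.seq (reach_runs z h₁) ?_ le_rfl
  intro σ₂ hf₂ h₂
  refine Runs.seq (count_runs σ₂) ?_ le_rfl
  intro σ₃ hf₃ h₃
  refine Runs.of_flat rfl ?_ (by simp only [Cmd.cost, NExpr.cost, NExpr.cost_smul]; omega)
  have e8 : σ₃.x 8 = σ.x 8 := by rw [hf₃.x 8 rfl, hf₂.x 8 rfl, hf₁.x 8 rfl]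
  have e6 : σ₃.x 6 = σ.x 6 := by rw [hf₃.x 6 rfl, hf₂.x 6 rfl, hf₁.x 6 rfl]
  have e5 : σ₃.x 5 = (comp G (σ.set n 1) z).card := by
    rw [h₃, h₂, St.set_congr (hf₁.A 1 rfl)]
  simp only [Cmd.run, NExpr.eval, NExpr.eval_smul, e5, e6]
  by_cases h : q * (comp G (σ.set n 1) z).card ≤ p * σ.x 6
  · rw [if_pos h, if_neg (by omega), e8]
  · rw [if_neg h, if_pos (by omega)]
    simp

theorem checkSeparator_runs (p q : ℕ) (σ : St) :
    Runs G v (checkSeparator p q) σ (500 * ((p + q + 1) * (n + 1) ^ 4))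
      (fun σ' => σ'.x 8 = 0 ↔ IsGoodSeparator G p q (σ.x 6) (σ.set n 4) (σ.set n 5)) := by
  have hZ : (n + 1) ≤ (p + q + 1) * (n + 1) ^ 4 :=
    (Nat.le_self_pow (by norm_num : 4 ≠ 0) _).trans (Nat.le_mul_of_pos_left _ (by omega))
  have hZ' : (n + 1) * ((p + q + 1) * (n + 1) ^ 3) = (p + q + 1) * (n + 1) ^ 4 := by ring
  refine Runs.seq (T₁ := 60 * (n + 1))
    (T₂ := 3 + (n + 1) * (300 * ((p + q + 1) * (n + 1) ^ 3) + 30))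
    (Runs.map (k := 1) (fun j => if σ.A 5 j = 0 then σ.A 4 j else 0) rfl rfl ?_
      (by simp only [Cmd.cost, NExpr.cost]; omega)) ?_ (by
      have : (n + 1) * (300 * ((p + q + 1) * (n + 1) ^ 3) + 30) =
        300 * ((p + q + 1) * (n + 1) ^ 4) + 30 * (n + 1) := by ring
      omega)
  · intro j σ' hf hx _
    have h5 : σ'.A 5 = σ.A 5 := hf.A 5 rfl
    have h4 : σ'.A 4 = σ.A 4 := hf.A 4 rfl
    have hne : ∀ j' : Fin n, j' ≠ j → (j' : ℕ) ≠ j := fun j' h h' => h (Fin.ext h')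
    by_cases h0 : σ.A 5 j = 0
    · simp +contextual [Cmd.run, NExpr.eval, hx, h5, h4, h0, Function.update_apply, hne]
    · simp +contextual [Cmd.run, NExpr.eval, hx, h5, h4, h0, Function.update_apply, hne]
  intro σ₁ hf₁ h₁
  have hS : σ₁.set n 1 = σ.set n 4 \ σ.set n 5 := by
    ext j
    simp only [St.mem_set, h₁, Finset.mem_sdiff]
    split_ifs with h <;> simp [h]
  refine Runs.seq (T₁ := 3) (Runs.of_flat (Q := fun σ' => σ'.x 8 = 0) rfl rfl le_rfl) ?_ le_rfl
  intro σ₂ hf₂ h₂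
  have hS₂ : σ₂.set n 1 = σ.set n 4 \ σ.set n 5 := (St.set_congr (hf₂.A 1 rfl)).trans hS
  refine (Runs.for n (300 * ((p + q + 1) * (n + 1) ^ 3) + 12)
    (fun m σ' => σ'.x 8 = 0 ↔ ∀ z ∈ σ.set n 4 \ σ.set n 5, (z : ℕ) < m →
      q * (comp G (σ.set n 4 \ σ.set n 5) z).card ≤ p * σ.x 6) rfl (fun _ _ => rfl) ?_ ?_
    (by simp only [NExpr.cost]; exact Nat.mul_le_mul_left _ (by omega))).mono le_rfl ?_
  · rintro _ rfl
    simp [Function.update_apply, h₂]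
  · intro m hm σ₃ hf₃ hx₃ hI
    have hS₃ : σ₃.set n 1 = σ.set n 4 \ σ.set n 5 := (St.set_congr (hf₃.A 1 rfl)).trans hS₂
    have h6 : σ₃.x 6 = σ.x 6 := by rw [hf₃.x 6 rfl, hf₂.x 6 rfl, hf₁.x 6 rfl]
    have hm' : σ₃.A 1 m ≠ 0 ↔ (⟨m, hm⟩ : Fin n) ∈ σ.set n 4 \ σ.set n 5 := by
      rw [← hS₃, St.mem_set]
    refine Runs.ite (T := 300 * ((p + q + 1) * (n + 1) ^ 3) + 1) ?_ ?_
      (by simp only [NExpr.cost]; omega)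
    · intro he
      have hmem : (⟨m, hm⟩ : Fin n) ∈ σ.set n 4 \ σ.set n 5 := by
        simpa [NExpr.eval, hx₃, hm, hm', -Finset.mem_sdiff] using he
      refine (checkNode_runs p q ⟨m, hm⟩ hx₃).mono (by omega) ?_
      intro σ' _ h _
      rw [hS₃, h6] at h
      show σ'.x 8 = 0 ↔ _
      rw [h]
      split_ifs with hle
      · rw [hI]
        constructor
        · intro H z hz hzm
          rcases Nat.lt_succ_iff_lt_or_eq.1 hzm with h | h
          · exact H z hz h
          · rw [show z = ⟨m, hm⟩ from Fin.ext h]; exact hle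
        · exact fun H z hz hzm => H z hz (by omega)
      · simp only [one_ne_zero, false_iff, not_forall]
        exact ⟨⟨m, hm⟩, hmem, by simp, hle⟩
    · intro he
      have hmem : (⟨m, hm⟩ : Fin n) ∉ σ.set n 4 \ σ.set n 5 := by
        rw [← hm']
        simpa [NExpr.eval, hx₃, hm] using he
      refine Runs.of_flat rfl ?_ (by simp only [Cmd.cost]; omega)
      intro _
      show σ₃.x 8 = 0 ↔ _
      rw [hI]
      constructor
      · intro H z hz hzm
        rcases Nat.lt_succ_iff_lt_or_eq.1 hzm with h | h
        · exact H z hz h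
        · exact absurd (show z = ⟨m, hm⟩ from Fin.ext h) (fun h => hmem (h ▸ hz))
      · exact fun H z hz hzm => H z hz (by omega)
  · rintro σ' _ ⟨h, -⟩
    rw [h]
    exact ⟨fun H z hz => H z hz z.2, fun H z hz _ => H z hz⟩

/-- Finds the first good separator of the set in array `4`. -/
def searchSeparator (p q : ℕ) : Cmd :=
  .asg 7 (.lit 0) ;; .asg 8 (.lit 1) ;; .while (.var 8)
    (decodeSet ;; checkSeparator p q ;; .asg 7 (.add (.var 7) (.lit 1)))

/-- Codes are tried in increasing order, so the search stops at `c₀` at the latest and its result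
has a code at most `c₀`. There are up to `F` candidates, each decoded in time quadratic in `F`. -/
theorem searchSeparator_runs (hn : 0 < n) (p q : ℕ) {σ : St} {c₀ F : ℕ} (hF : c₀ < F)
    (hc₀ : IsGoodSeparator G p q (σ.x 6) (σ.set n 4) (codeSet n c₀)) :
    Runs G v (searchSeparator p q) σ (2000 * ((p + q + 1) * (n + 1) ^ 4 * F ^ 3))
      (fun σ' => IsGoodSeparator G p q (σ.x 6) (σ.set n 4) (σ'.set n 5) ∧
        ∃ c ≤ c₀, σ'.set n 5 = codeSet n c) := by
  set W := (p + q + 1) * (n + 1) ^ 4 with hW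
  have hZ : (n + 1) ≤ W :=
    (Nat.le_self_pow (by norm_num : 4 ≠ 0) _).trans (Nat.le_mul_of_pos_left _ (by omega))
  have hW1 : 1 ≤ W := by omega
  have hF1 : 1 ≤ F := by omega
  refine Runs.seq (T₁ := 3) (T₂ := 3 + (c₀ + 1 + 1) * (700 * (W * F ^ 2)))
    (Runs.of_flat (Q := fun σ' => σ'.x 7 = 0) rfl rfl le_rfl) ?_ ?_
  swap
  · have h1 : (c₀ + 1 + 1) ≤ 2 * F := by omega
    have h2 : (c₀ + 1 + 1) * (700 * (W * F ^ 2)) ≤ 2 * F * (700 * (W * F ^ 2)) :=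
      Nat.mul_le_mul_right _ h1
    have h3 : 2 * F * (700 * (W * F ^ 2)) = 1400 * (W * F ^ 3) := by ring
    have h4 : 1 ≤ W * F ^ 3 := Nat.mul_pos hW1 (by positivity)
    omega
  intro σ₁ hf₁ h₁
  refine Runs.seq (T₁ := 3) (Runs.of_flat (Q := fun σ' => σ'.x 7 = 0 ∧ σ'.x 8 = 1) rfl
    ⟨h₁, rfl⟩ le_rfl) ?_ le_rfl
  rintro σ₂ hf₂ ⟨h₂, h₂'⟩
  set good := fun X => IsGoodSeparator G p q (σ.x 6) (σ.set n 4) X with hgood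
  refine (Runs.while (650 * (W * F ^ 2))
    (fun σ' => (σ'.x 8 = 0 → good (σ'.set n 5) ∧ ∃ c ≤ c₀, σ'.set n 5 = codeSet n c) ∧
      (σ'.x 8 ≠ 0 → ∀ c < σ'.x 7, ¬ good (codeSet n c)))
    -- The counter also advances after a success, so the measure is set to zero once the flag in
    -- variable `8` is cleared.
    (fun σ' => if σ'.x 8 = 0 then 0 else c₀ + 1 - σ'.x 7) ?_ ?_ ?_).mono le_rfl ?_
  · simp [h₂, h₂']
  · rintro σ₃ hf₃ ⟨-, hI⟩ hne
    have hne : σ₃.x 8 ≠ 0 := hne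
    have hle : σ₃.x 7 ≤ c₀ := by
      by_contra hlt
      exact hI hne c₀ (by omega) hc₀
    have hF2 : F ≤ W * F ^ 2 :=
      (Nat.le_self_pow (by norm_num : 2 ≠ 0) _).trans (Nat.le_mul_of_pos_left _ (by omega))
    have hF2' : F ^ 2 ≤ W * F ^ 2 := Nat.le_mul_of_pos_left _ (by omega)
    have hF3 : W ≤ W * F ^ 2 := Nat.le_mul_of_pos_right _ (by positivity)
    refine Runs.seq (T₁ := 50 * (n + 1) + F * (F * 28 + 40)) (T₂ := 500 * W + 6)
      ((decodeSet_runs hn σ₃).mono ?_ fun _ _ h => h) ?_ ?_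
    · gcongr <;> omega
    swap
    · have : F * (F * 28 + 40) = 28 * F ^ 2 + 40 * F := by ring
      omega
    intro σ₄ hf₄ h₄
    refine Runs.seq (checkSeparator_runs p q σ₄) ?_ le_rfl
    intro σ₅ hf₅ h₅
    refine Runs.of_flat rfl ?_ (by decide)
    have e7 : σ₅.x 7 = σ₃.x 7 := by rw [hf₅.x 7 rfl, hf₄.x 7 rfl]
    have e5 : σ₅.set n 5 = codeSet n (σ₃.x 7) := by
      rw [St.set_congr (hf₅.A 5 rfl), h₄]
    have e6 : σ₄.x 6 = σ.x 6 := by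
      rw [hf₄.x 6 rfl, hf₃.x 6 rfl, hf₂.x 6 rfl, hf₁.x 6 rfl]
    have e4 : σ₄.set n 4 = σ.set n 4 := by
      rw [St.set_congr (hf₄.A 4 rfl), St.set_congr (hf₃.A 4 rfl), St.set_congr (hf₂.A 4 rfl),
        St.set_congr (hf₁.A 4 rfl)]
    rw [e6, e4, h₄] at h₅
    simp only [Cmd.run, NExpr.eval, e7, Function.update_self,
      Function.update_of_ne (show (8 : ℕ) ≠ 7 by decide)]
    refine ⟨⟨fun h8 => ⟨?_, σ₃.x 7, hle, e5⟩, fun h8 c hc => ?_⟩, ?_⟩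
    · show good (σ₅.set n 5)
      rw [e5]
      exact h₅.1 h8
    · rcases Nat.lt_succ_iff_lt_or_eq.1 hc with h | rfl
      · exact hI hne c h
      · exact fun h => h8 (h₅.2 h)
    · rw [if_neg hne]
      split_ifs <;> omega
  · simp only [h₂, h₂', one_ne_zero, if_false, NExpr.cost]
    refine Nat.mul_le_mul (by omega) ?_
    have : 1 ≤ W * F ^ 2 := Nat.mul_pos hW1 (by positivity)
    omega
  · rintro σ' _ ⟨⟨h, -⟩, h0⟩
    exact h h0

/-! ### The construction of the elimination forest -/

/-- The elimination forest of the removed nodes, together with the ancestors of the nodes that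
remain. -/
structure PartialForest (G : SimpleGraph (Fin n)) (R : Finset (Fin n)) (par dep : Fin n → ℕ)
    (anc : Fin n → Finset (Fin n)) (L : ℕ) : Prop where
  step : ∀ v, (par v = 0 ∧ anc v = ∅) ∨
    ∃ p : Fin n, par v = p + 1 ∧ p ∉ anc p ∧ anc v = insert p (anc p)
  dep_eq : ∀ v, dep v = (anc v).card
  disj : ∀ v, ∀ y ∈ anc v, y ∉ R
  edge : ∀ u v, G.Adj u v → u ∉ R → u ∈ anc v ∨ v ∈ anc u
  dep_lt : ∀ v, v ∉ R → dep v < L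

/-- All remaining nodes of `K` have the same ancestors as `x`, so `x` can be appended as their new
parent. Its remaining neighbours all lie in `K` and thus acquire `x` as an ancestor, which keeps
edges between comparable nodes. Ancestor sets of removed nodes are final. -/
theorem PartialForest.erase {R K : Finset (Fin n)} {par dep : Fin n → ℕ}
    {anc : Fin n → Finset (Fin n)} {L : ℕ} (h : PartialForest G R par dep anc L) {x : Fin n}
    (hx : x ∈ R) (hadj : ∀ y ∈ R, G.Adj x y → y ∈ K) (hanc : ∀ y ∈ R, y ∈ K → anc y = anc x)
    {par' dep' : Fin n → ℕ} {L' : ℕ}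
    (hpar : ∀ y, par' y = if y ∈ K ∧ y ∈ R.erase x then (x : ℕ) + 1 else par y)
    (hdep : ∀ y, dep' y = if y ∈ K ∧ y ∈ R.erase x then dep y + 1 else dep y)
    (hL : L ≤ L') (hL' : dep x < L') :
    PartialForest G (R.erase x) par' dep'
      (fun y => if y ∈ K ∧ y ∈ R.erase x then insert x (anc y) else anc y) L' := by
  have hxx : x ∉ anc x := fun h' => h.disj x x h' hx
  constructor
  · intro y
    rw [hpar]
    by_cases hy : y ∈ K ∧ y ∈ R.erase x
    · right
      refine ⟨x, by rw [if_pos hy], by simp [hxx], ?_⟩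
      simp only [if_pos hy]
      rw [if_neg (by simp), hanc y (Finset.mem_of_mem_erase hy.2) hy.1]
    · simp only [if_neg hy]
      rcases h.step y with h' | ⟨p, hp, hpp, hpy⟩
      · exact Or.inl h'
      · right
        have hpR : p ∉ R := h.disj y p (hpy ▸ Finset.mem_insert_self _ _)
        have : ¬ (p ∈ K ∧ p ∈ R.erase x) := fun h => hpR (Finset.mem_of_mem_erase h.2)
        exact ⟨p, hp, by rwa [if_neg this], by rwa [if_neg this]⟩
  · intro y
    rw [hdep]
    split_ifs with hy
    · rw [Finset.card_insert_of_notMem, h.dep_eq]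
      exact fun h' => h.disj y x h' hx
    · exact h.dep_eq y
  · intro y z hz hzR
    split_ifs at hz with hy
    · rw [Finset.mem_insert] at hz
      rcases hz with rfl | hz
      · simp at hzR
      · exact h.disj y z hz (Finset.mem_of_mem_erase hzR)
    · exact h.disj y z hz (Finset.mem_of_mem_erase hzR)
  · intro a b hab ha
    have hsub : ∀ y, anc y ⊆ if y ∈ K ∧ y ∈ R.erase x then insert x (anc y) else anc y := by
      intro y
      split_ifs
      · exact Finset.subset_insert _ _
      · exact subset_rfl
    by_cases haR : a ∈ R
    · have hax : a = x := by
        by_contra hne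
        exact ha (Finset.mem_erase.2 ⟨hne, haR⟩)
      subst hax
      by_cases hbR : b ∈ R
      · left
        rw [if_pos ⟨hadj b hbR hab, Finset.mem_erase.2 ⟨hab.ne', hbR⟩⟩]
        exact Finset.mem_insert_self _ _
      · rcases h.edge b a hab.symm hbR with h' | h'
        · exact Or.inr (hsub _ h')
        · exact Or.inl (hsub _ h')
    · rcases h.edge a b hab haR with h' | h'
      · exact Or.inl (hsub _ h')
      · exact Or.inr (hsub _ h')
  · intro y hy
    rw [hdep, if_neg fun h => hy h.2]
    by_cases hyx : y = x
    · rwa [hyx]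
    · exact (h.dep_lt y fun h' => hy (Finset.mem_erase.2 ⟨hyx, h'⟩)).trans_le hL

/-- Array `k` as a function on the nodes. -/
def St.fn (σ : St) (n k : ℕ) : Fin n → ℕ := fun i => σ.A k i

/-- Puts the component of the node in variable `15` into array `4`, its size into variable `6`. -/
def findComponent : Cmd :=
  .fill 2 1 (.arr 3 (.var 2)) ;; .asg 1 (.var 15) ;; reach ;; .fill 2 4 (.arr 2 (.var 2)) ;;
    count ;; .asg 6 (.var 5)

theorem findComponent_runs {σ : St} (u : Fin n) (hu : σ.x 15 = u) :
    Runs G v findComponent σ (400 * (n + 1) ^ 3)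
      (fun σ' => σ'.set n 4 = comp G (σ.set n 3) u ∧
        σ'.x 6 = (comp G (σ.set n 3) u).card) := by
  have hZ : (n + 1) ≤ (n + 1) ^ 3 := Nat.le_self_pow (by norm_num) _
  refine Runs.seq (T₁ := 40 * (n + 1))
    (T₂ := 4 + (200 * (n + 1) ^ 3 + (40 * (n + 1) + (50 * (n + 1) + 4))))
    (Runs.fill (fun j => σ.A 3 j) ?_ (by simp only [NExpr.cost]; omega)) ?_ (by omega)
  · intro j σ' hf hx _
    simp [NExpr.eval, hx, hf.A 3 rfl]
  intro σ₁ hf₁ h₁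
  have hS : σ₁.set n 1 = σ.set n 3 := by ext; simp [St.mem_set, h₁]
  refine Runs.seq (T₁ := 4) (Runs.of_flat (Q := fun σ' => σ'.x 1 = u) rfl
    ((hf₁.x 15 rfl).trans hu) le_rfl) ?_ le_rfl
  intro σ₂ hf₂ h₂
  refine Runs.seq (reach_runs u h₂) ?_ le_rfl
  intro σ₃ hf₃ h₃
  rw [St.set_congr (hf₂.A 1 rfl), hS] at h₃
  refine Runs.seq (T₁ := 40 * (n + 1))
    (Runs.fill (fun j => σ₃.A 2 j) ?_ (by simp only [NExpr.cost]; omega)) ?_ le_rfl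
  · intro j σ' hf hx _
    simp [NExpr.eval, hx, hf.A 2 rfl]
  intro σ₄ hf₄ h₄
  have h42 : σ₄.set n 2 = comp G (σ.set n 3) u := (St.set_congr (hf₄.A 2 rfl)).trans h₃
  have h44 : σ₄.set n 4 = comp G (σ.set n 3) u := by rw [← h₃]; ext; simp [St.mem_set, h₄]
  refine Runs.seq (count_runs σ₄) ?_ le_rfl
  intro σ₅ hf₅ h₅
  refine Runs.of_flat rfl ?_ (by decide)
  refine ⟨(St.set_congr (hf₅.A 4 rfl)).trans h44, ?_⟩
  simp [Cmd.run, NExpr.eval, h₅, h42]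

/-- Removes the node in variable `11`: it becomes an ancestor of the remaining nodes of the set in
array `4`. -/
def removeNode : Cmd :=
  .put 3 (.var 11) (.lit 0) ;;
  .ite (.sub (.add (.arr 7 (.var 11)) (.lit 1)) (.var 13))
    (.asg 13 (.add (.arr 7 (.var 11)) (.lit 1))) .skip ;;
  .for 2 .size (.ite (.arr 4 (.var 2)) (.ite (.arr 3 (.var 2))
    (.put 6 (.var 2) (.add (.var 11) (.lit 1))) .skip) .skip) ;;
  .for 2 .size (.ite (.arr 4 (.var 2)) (.ite (.arr 3 (.var 2))
    (.put 7 (.var 2) (.add (.arr 7 (.var 2)) (.lit 1))) .skip) .skip)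

theorem removeNode_runs {σ : St} (x : Fin n) (hx : σ.x 11 = x) :
    Runs G v removeNode σ (300 * (n + 1))
      (fun σ' => σ'.set n 3 = (σ.set n 3).erase x ∧ σ'.x 13 = max (σ.x 13) (σ.A 7 x + 1) ∧
        (∀ j, σ'.fn n 6 j = if j ∈ σ.set n 4 ∧ j ∈ (σ.set n 3).erase x then (x : ℕ) + 1
          else σ.fn n 6 j) ∧
        (∀ j, σ'.fn n 7 j = if j ∈ σ.set n 4 ∧ j ∈ (σ.set n 3).erase x then σ.fn n 7 j + 1
          else σ.fn n 7 j)) := by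
  have hne : ∀ j j' : Fin n, j' ≠ j → (j' : ℕ) ≠ j := fun j j' h h' => h (Fin.ext h')
  refine Runs.seq (T₁ := 20) (T₂ := 60 + (100 * (n + 1) + 100 * (n + 1))) (Runs.of_flat
    (Q := fun σ' => σ'.set n 3 = (σ.set n 3).erase x) rfl ?_ (by decide)) ?_ (by omega)
  · ext i
    by_cases hi : i = x
    · subst hi; simp [Cmd.run, NExpr.eval, hx, St.mem_set]
    · simp [Cmd.run, NExpr.eval, hx, St.mem_set, Function.update_apply, hi, hne _ _ hi]
  intro σ₁ hf₁ h₁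
  have hx₁ : σ₁.x 11 = x := (hf₁.x 11 rfl).trans hx
  refine Runs.seq (T₁ := 60) (Runs.of_flat
    (Q := fun σ' => σ'.x 13 = max (σ.x 13) (σ.A 7 x + 1)) rfl ?_ (by decide)) ?_ le_rfl
  · have h7 : σ₁.A 7 = σ.A 7 := hf₁.A 7 rfl
    have h13 : σ₁.x 13 = σ.x 13 := hf₁.x 13 rfl
    simp only [Cmd.run, NExpr.eval, hx₁, x.2, if_true, h7, h13]
    split_ifs with h
    · simp; omega
    · omega
  intro σ₂ hf₂ h₂
  have hx₂ : σ₂.x 11 = x := (hf₂.x 11 rfl).trans hx₁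
  have h3₂ : σ₂.set n 3 = (σ.set n 3).erase x := (St.set_congr (hf₂.A 3 rfl)).trans h₁
  have h4₂ : σ₂.set n 4 = σ.set n 4 := by
    rw [St.set_congr (hf₂.A 4 rfl), St.set_congr (hf₁.A 4 rfl)]
  have h6₂ : σ₂.A 6 = σ.A 6 := (hf₂.A 6 rfl).trans (hf₁.A 6 rfl)
  have h7₂ : σ₂.A 7 = σ.A 7 := (hf₂.A 7 rfl).trans (hf₁.A 7 rfl)
  refine Runs.seq (T₁ := 100 * (n + 1)) (Runs.map (k := 6)
    (fun j => if j ∈ σ.set n 4 ∧ j ∈ (σ.set n 3).erase x then (x : ℕ) + 1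
          else σ.A 6 j) rfl rfl ?_ (by simp only [Cmd.cost, NExpr.cost]; omega)) ?_ le_rfl
  · intro j σ' hf hj h6
    have e4 : σ'.A 4 j = 0 ↔ j ∉ σ.set n 4 := by
      rw [← h4₂, ← St.set_congr (hf.A 4 rfl), St.mem_set, not_not]
    have e3 : σ'.A 3 j = 0 ↔ j ∉ (σ.set n 3).erase x := by
      rw [← h3₂, ← St.set_congr (hf.A 3 rfl), St.mem_set, not_not]
    have e11 : σ'.x 11 = x := (hf.x 11 rfl).trans hx₂
    rw [h6₂] at h6
    by_cases c4 : j ∈ σ.set n 4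
    · by_cases c3 : j ∈ (σ.set n 3).erase x
      · have := Finset.mem_erase.1 c3
        simp +contextual [Cmd.run, NExpr.eval, hj, e4, e3, c4, this, h6, e11,
          Function.update_apply, hne]
      · simp +contextual [Cmd.run, NExpr.eval, hj, e4, e3, c4, c3, h6, e11,
          Function.update_apply, hne, -Finset.mem_erase]
    · simp +contextual [Cmd.run, NExpr.eval, hj, e4, e3, c4, h6, e11,
          Function.update_apply, hne]
  intro σ₃ hf₃ h₃
  have h3₃ : σ₃.set n 3 = (σ.set n 3).erase x := (St.set_congr (hf₃.A 3 rfl)).trans h3₂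
  have h4₃ : σ₃.set n 4 = σ.set n 4 := (St.set_congr (hf₃.A 4 rfl)).trans h4₂
  have h7₃ : σ₃.A 7 = σ.A 7 := (hf₃.A 7 rfl).trans h7₂
  refine (Runs.map (k := 7)
    (fun j => if j ∈ σ.set n 4 ∧ j ∈ (σ.set n 3).erase x then σ.A 7 j + 1
          else σ.A 7 j) rfl rfl ?_ (T := 100 * (n + 1))
          (by simp only [Cmd.cost, NExpr.cost]; omega)).mono le_rfl ?_
  · intro j σ' hf hj h7
    have e4 : σ'.A 4 j = 0 ↔ j ∉ σ.set n 4 := by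
      rw [← h4₃, ← St.set_congr (hf.A 4 rfl), St.mem_set, not_not]
    have e3 : σ'.A 3 j = 0 ↔ j ∉ (σ.set n 3).erase x := by
      rw [← h3₃, ← St.set_congr (hf.A 3 rfl), St.mem_set, not_not]
    rw [h7₃] at h7
    by_cases c4 : j ∈ σ.set n 4
    · by_cases c3 : j ∈ (σ.set n 3).erase x
      · have := Finset.mem_erase.1 c3
        simp +contextual [Cmd.run, NExpr.eval, hj, e4, e3, c4, this, h7,
          Function.update_apply, hne]
      · simp +contextual [Cmd.run, NExpr.eval, hj, e4, e3, c4, c3, h7,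
          Function.update_apply, hne, -Finset.mem_erase]
    · simp +contextual [Cmd.run, NExpr.eval, hj, e4, e3, c4, h7,
          Function.update_apply, hne]
  intro σ₄ hf₄ h₄
  refine ⟨(St.set_congr (hf₄.A 3 rfl)).trans h3₃, ?_, ?_, h₄⟩
  · rw [hf₄.x 13 rfl, hf₃.x 13 rfl, h₂]
  · intro j
    rw [St.fn, hf₄.A 6 rfl]
    exact h₃ j

/-- Removes the separator in array `5` from the set in array `4`. -/
def removeSeparator : Cmd :=
  .for 11 .size (.ite (.arr 4 (.var 11)) (.ite (.arr 5 (.var 11)) removeNode .skip) .skip)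

/-- The nodes of `K ∩ X` become a chain in order of their indices. Throughout, the surviving nodes
of `K` share one ancestor set, which grows by at most one node per removal, while nodes outside `K`
are untouched. -/
theorem removeSeparator_runs {σ : St} {R K X : Finset (Fin n)} {anc₀ : Fin n → Finset (Fin n)}
    {a L : ℕ} (hR : σ.set n 3 = R) (hK : σ.set n 4 = K) (hX : σ.set n 5 = X) (hKR : K ⊆ R)
    (hF : PartialForest G R (σ.fn n 6) (σ.fn n 7) anc₀ (σ.x 13))
    (hadj : ∀ x ∈ K, ∀ y ∈ R, G.Adj x y → y ∈ K)
    (hanc : ∀ x ∈ K, ∀ y ∈ K, anc₀ x = anc₀ y) (ha : ∀ x ∈ K, (anc₀ x).card ≤ a)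
    (hL : σ.x 13 ≤ L) (haL : a + (K ∩ X).card ≤ L) :
    Runs G v removeSeparator σ (400 * (n + 1) ^ 2)
      (fun σ' => σ'.set n 3 = R \ (K ∩ X) ∧ σ'.x 13 ≤ L ∧ ∃ anc,
        PartialForest G (R \ (K ∩ X)) (σ'.fn n 6) (σ'.fn n 7) anc (σ'.x 13) ∧
        (∀ x ∈ K, x ∉ X → ∀ y ∈ K, y ∉ X → anc x = anc y) ∧
        (∀ x ∈ K, x ∉ X → (anc x).card ≤ a + (K ∩ X).card) ∧ ∀ x, x ∉ K → anc x = anc₀ x) := by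
  -- The nodes removed before round `m`.
  set D : ℕ → Finset (Fin n) := fun m => (K ∩ X).filter fun x => (x : ℕ) < m with hD
  have hDn : D n = K ∩ X := Finset.filter_true_of_mem fun x _ => x.2
  refine (Runs.for n (300 * (n + 1) + 30) (fun m σ' => σ'.set n 3 = R \ D m ∧ σ'.x 13 ≤ L ∧ ∃ anc,
        PartialForest G (R \ D m) (σ'.fn n 6) (σ'.fn n 7) anc (σ'.x 13) ∧
        (∀ x ∈ K, x ∉ D m → ∀ y ∈ K, y ∉ D m → anc x = anc y) ∧
        (∀ x ∈ K, x ∉ D m → (anc x).card ≤ a + (D m).card) ∧ ∀ x, x ∉ K → anc x = anc₀ x)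
        rfl (fun _ _ => rfl) ?_ ?_ ?_).mono le_rfl ?_
  · rintro _ rfl
    have h0 : D 0 = ∅ := by simp [hD]
    rw [h0, Finset.sdiff_empty]
    exact ⟨hR, hL, anc₀, hF, fun x hx _ y hy _ => hanc x hx y hy,
      fun x hx _ => by simpa using ha x hx, fun _ _ => rfl⟩
  · intro m hm σ₁ hf₁ hx₁ hI
    have e4 : σ₁.set n 4 = K := (St.set_congr (hf₁.A 4 rfl)).trans hK
    have e5 : σ₁.set n 5 = X := (St.set_congr (hf₁.A 5 rfl)).trans hX
    set x : Fin n := ⟨m, hm⟩ with hxdef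
    have c4 : σ₁.A 4 m ≠ 0 ↔ x ∈ K := by rw [← e4, St.mem_set]
    have c5 : σ₁.A 5 m ≠ 0 ↔ x ∈ X := by rw [← e5, St.mem_set]
    have hxD : x ∉ D m := by simp [hD, hxdef]
    have hskip : x ∉ K ∩ X → D (m + 1) = D m := by
      intro hx
      ext y
      simp only [hD, Finset.mem_filter, Nat.lt_succ_iff_lt_or_eq]
      constructor
      · rintro ⟨h1, h2 | h2⟩
        · exact ⟨h1, h2⟩
        · exact absurd (show y = x from Fin.ext h2) fun h => hx (h ▸ h1)
      · exact fun h => ⟨h.1, Or.inl h.2⟩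
    refine Runs.ite (T := 300 * (n + 1) + 15) (fun he => ?_) (fun he => ?_)
      (by simp only [NExpr.cost]; omega)
    · have hxK : x ∈ K := c4.1 (by simpa [NExpr.eval, hx₁, hm] using he)
      refine Runs.ite (T := 300 * (n + 1)) (fun he => ?_) (fun he => ?_)
        (by simp only [NExpr.cost]; omega)
      · have hxX : x ∈ X := c5.1 (by simpa [NExpr.eval, hx₁, hm] using he)
        refine (removeNode_runs x hx₁).mono le_rfl ?_
        rintro σ' - ⟨h1, h2, h3, h4⟩ -
        obtain ⟨i1, i2, anc, i3, i4, i5, i6⟩ := hI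
        have hxR : x ∈ R \ D m := Finset.mem_sdiff.2 ⟨hKR hxK, hxD⟩
        have hins : D (m + 1) = insert x (D m) := by
          ext y
          simp only [hD, Finset.mem_filter, Nat.lt_succ_iff_lt_or_eq, Finset.mem_insert]
          constructor
          · rintro ⟨h1, h2 | h2⟩
            · exact Or.inr ⟨h1, h2⟩
            · exact Or.inl (Fin.ext h2)
          · rintro (rfl | h)
            · exact ⟨Finset.mem_inter.2 ⟨hxK, hxX⟩, Or.inr rfl⟩
            · exact ⟨h.1, Or.inl h.2⟩
        have hR' : R \ D (m + 1) = (R \ D m).erase x := by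
          rw [hins]; ext y; simp only [Finset.mem_sdiff, Finset.mem_insert, Finset.mem_erase]
          tauto
        have hcard : (D (m + 1)).card = (D m).card + 1 := by
          rw [hins, Finset.card_insert_of_notMem hxD]
        have hDle : (D (m + 1)).card ≤ (K ∩ X).card :=
          Finset.card_le_card (Finset.filter_subset _ _)
        have hdepx : σ₁.A 7 x = (anc x).card := i3.dep_eq x
        have hcx := i5 x hxK hxD
        rw [e4, i1] at h3 h4
        have hPF := i3.erase (K := K) hxR
          (fun y hy hxy => hadj x hxK y (Finset.mem_sdiff.1 hy).1 hxy)
          (fun y hy hyK => i4 y hyK (Finset.mem_sdiff.1 hy).2 x hxK hxD) h3 h4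
          (L' := σ'.x 13) (by rw [h2]; exact le_max_left _ _)
          (by rw [h2]; exact lt_of_lt_of_le (Nat.lt_succ_self _) (le_max_right _ _))
        have hmem : ∀ y ∈ K, y ∉ D (m + 1) → y ∉ D m ∧ y ∈ (R \ D m).erase x := by
          intro y hyK hyD
          rw [hins, Finset.mem_insert, not_or] at hyD
          exact ⟨hyD.2, Finset.mem_erase.2 ⟨hyD.1, Finset.mem_sdiff.2 ⟨hKR hyK, hyD.2⟩⟩⟩
        refine ⟨?_, ?_, fun y => if y ∈ K ∧ y ∈ (R \ D m).erase x then insert x (anc y) else anc y,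
          ?_, ?_, ?_, ?_⟩
        · show σ'.set n 3 = _
          rw [h1, i1, hR']
        · show σ'.x 13 ≤ L
          rw [h2, hdepx]
          exact max_le i2 (by omega)
        · rw [hR']
          exact hPF
        · intro y hy hyD z hz hzD
          obtain ⟨y1, y2⟩ := hmem y hy hyD
          obtain ⟨z1, z2⟩ := hmem z hz hzD
          dsimp only
          rw [if_pos ⟨hy, y2⟩, if_pos ⟨hz, z2⟩, i4 y hy y1 z hz z1]
        · intro y hy hyD
          obtain ⟨y1, y2⟩ := hmem y hy hyD
          dsimp only
          rw [if_pos ⟨hy, y2⟩]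
          have := Finset.card_insert_le x (anc y)
          have := i5 y hy y1
          omega
        · intro y hy
          dsimp only
          rw [if_neg fun h => hy h.1, i6 y hy]
      · have hxX : x ∉ K ∩ X := fun h => by
          have := c5.2 (Finset.mem_inter.1 h).2
          simp [NExpr.eval, hx₁, hm] at he
          exact this he
        refine Runs.of_flat rfl ?_ (by simp only [Cmd.cost]; omega)
        intro _
        rw [hskip hxX]
        exact hI
    · have hxX : x ∉ K ∩ X := fun h => by
        have := c4.2 (Finset.mem_inter.1 h).1
        simp [NExpr.eval, hx₁, hm] at he
        exact this he
      refine Runs.of_flat rfl ?_ (by simp only [Cmd.cost]; omega)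
      intro _
      rw [hskip hxX]
      exact hI
  · have : 400 * (n + 1) ^ 2 = (n + 1) * (400 * (n + 1)) := by ring
    rw [this]
    refine Nat.mul_le_mul_left _ ?_
    simp only [NExpr.cost]
    omega
  · rintro σ' - ⟨h, -⟩
    rw [hDn] at h
    obtain ⟨h1, h2, anc, h3, h4, h5, h6⟩ := h
    refine ⟨h1, h2, anc, h3, ?_, ?_, h6⟩
    · exact fun x hx hxX y hy hyX => h4 x hx (fun h => hxX (Finset.mem_inter.1 h).2) y hy
        (fun h => hyX (Finset.mem_inter.1 h).2)
    · exact fun x hx hxX => h5 x hx (fun h => hxX (Finset.mem_inter.1 h).2)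

/-- The invariant of the construction of the elimination forest. -/
def ForestInv (G : SimpleGraph (Fin n)) (p q m L : ℕ) (σ : St) : Prop :=
  ∃ anc, PartialForest G (σ.set n 3) (σ.fn n 6) (σ.fn n 7) anc (σ.x 13) ∧ σ.x 13 ≤ L ∧
    (∀ u ∈ σ.set n 3, ∀ w ∈ comp G (σ.set n 3) u, anc w = anc u) ∧
    ∀ u ∈ σ.set n 3, ∃ j, q ^ j * (comp G (σ.set n 3) u).card ≤ p ^ j * n ∧
      (anc u).card ≤ j * m

/-- One round: separates the component of the node in variable `15`. -/
def separateRound (p q : ℕ) : Cmd := findComponent ;; searchSeparator p q ;; removeSeparator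

/-- The number `j` in the invariant counts the separations above a component: it has at most `(p /
q) ^ j n` nodes and at most `j m` ancestors. A round raises `j` by one on the pieces of `K` and
leaves the other components alone. -/
theorem separateRound_runs (hn : 0 < n) {p q m L : ℕ} (hpq : p < q)
    (hsep : ∀ K : Finset (Fin n), K.Nonempty → ∃ X : Finset (Fin n), X.card ≤ m ∧
      IsGoodSeparator G p q K.card K X)
    (hL : ∀ j, q ^ j ≤ p ^ j * n → (j + 1) * m ≤ L) {σ : St} {u : Fin n} (hu : σ.x 15 = u)
    (huR : u ∈ σ.set n 3) (hI : ForestInv G p q m L σ) :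
    Runs G v (separateRound p q) σ (3000 * ((p + q + 1) * (n + 1) ^ 4 * ((n + 1) ^ m) ^ 3))
      (fun σ' => ForestInv G p q m L σ' ∧ σ'.set n 3 ⊂ σ.set n 3) := by
  obtain ⟨anc, hF, hL13, hconn, hsize⟩ := hI
  set R := σ.set n 3 with hR
  set K := comp G R u with hK
  have hKR : K ⊆ R := comp_subset_self huR
  have huK : u ∈ K := self_mem_comp _ _
  obtain ⟨X, hXm, hX⟩ := hsep K ⟨u, huK⟩
  obtain ⟨c₀, hc₀, hcX⟩ := exists_codeSet_eq hXm
  obtain ⟨j, hj1, hj2⟩ := hsize u huR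
  have hT : (n + 1) ^ 3 ≤ (p + q + 1) * (n + 1) ^ 4 * ((n + 1) ^ m) ^ 3 :=
    (Nat.pow_le_pow_right (by omega) (by norm_num : 3 ≤ 4)).trans
      ((Nat.le_mul_of_pos_left _ (by omega)).trans (Nat.le_mul_of_pos_right _ (by positivity)))
  have hT' : (n + 1) ^ 2 ≤ (n + 1) ^ 3 := Nat.pow_le_pow_right (by omega) (by norm_num)
  refine Runs.seq (T₂ := 2000 * ((p + q + 1) * (n + 1) ^ 4 * ((n + 1) ^ m) ^ 3) +
    400 * (n + 1) ^ 2) (findComponent_runs u hu) ?_ (by omega)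
  rintro σ₁ hf₁ ⟨h14, h16⟩
  rw [← hR, ← hK] at h14 h16
  refine Runs.seq (searchSeparator_runs hn p q hc₀ (by rw [h14, h16, hcX]; exact hX)) ?_ le_rfl
  rintro σ₂ hf₂ ⟨hgood, c, hcc, hc⟩
  rw [h14, h16] at hgood
  set Y := σ₂.set n 5 with hY
  have hYm : Y.card ≤ m := hc ▸ card_codeSet_le (hcc.trans_lt hc₀)
  have hKY : (K ∩ Y).card ≤ m := (Finset.card_le_card Finset.inter_subset_right).trans hYm
  have e3 : σ₂.set n 3 = R := by rw [St.set_congr (hf₂.A 3 rfl), St.set_congr (hf₁.A 3 rfl)]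
  have e4 : σ₂.set n 4 = K := by rw [St.set_congr (hf₂.A 4 rfl), h14]
  have e6 : σ₂.fn n 6 = σ.fn n 6 := by unfold St.fn; rw [hf₂.A 6 rfl, hf₁.A 6 rfl]
  have e7 : σ₂.fn n 7 = σ.fn n 7 := by unfold St.fn; rw [hf₂.A 7 rfl, hf₁.A 7 rfl]
  have e13 : σ₂.x 13 = σ.x 13 := by rw [hf₂.x 13 rfl, hf₁.x 13 rfl]
  have hKpos : 1 ≤ K.card := Finset.card_pos.2 ⟨u, huK⟩
  -- The component is nonempty, so its size bound forces `q ^ j ≤ p ^ j * n`; there is still room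
  -- for one more separator.
  have hjL : (j + 1) * m ≤ L := hL j (le_trans (Nat.le_mul_of_pos_right _ hKpos) hj1)
  have hjm : (j + 1) * m = j * m + m := by ring
  have hancK : ∀ x ∈ K, anc x = anc u := fun x hx => hconn u huR x hx
  refine (removeSeparator_runs (a := j * m) (L := L) e3 e4 rfl hKR (by rw [e6, e7, e13]; exact hF)
    (fun x hx y hy hxy => comp_tail hx hxy hy)
    (fun x hx y hy => by rw [hancK x hx, hancK y hy])
    (fun x hx => by rw [hancK x hx]; exact hj2) (by rw [e13]; exact hL13)
    (show j * m + (K ∩ Y).card ≤ L by omega)).mono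
      le_rfl ?_
  rintro σ₃ - ⟨h1, h2, anc', h3, h4, h5, h6⟩
  rw [← hY] at h1 h3 h4 h5
  set R' := R \ (K ∩ Y) with hR'
  have hR'R : R' ⊆ R := Finset.sdiff_subset
  -- Every round makes progress: removing nothing would leave the connected set `K` as a piece of
  -- itself, contradicting `p < q`.
  have hne : (K ∩ Y).Nonempty := by
    by_contra hemp
    rw [Finset.not_nonempty_iff_eq_empty] at hemp
    have hsd : K \ Y = K := Finset.sdiff_eq_self_of_disjoint
      (Finset.disjoint_iff_inter_eq_empty.2 hemp)
    have hg := hgood u (by rw [hsd]; exact huK)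
    rw [hsd] at hg
    have hcK : comp G K u = K := by
      refine (comp_subset_self huK).antisymm (comp_subset (self_mem_comp _ _) ?_)
      intro a ha b hb hab
      exact comp_tail ha hab (comp_tail (comp_subset_self huK ha) hab hb)
    rw [hcK] at hg
    exact absurd hg (not_le.2 (Nat.mul_lt_mul_of_pos_right hpq hKpos))
  refine ⟨⟨anc', ?_, h2, ?_, ?_⟩, ?_⟩
  · rw [h1]; exact h3
  · rw [h1]
    intro a ha w hw
    have hwR' : w ∈ R' := comp_subset_self ha hw
    have hwcomp : w ∈ comp G R a := comp_mono hR'R a hw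
    have hnotY : ∀ y ∈ R', y ∈ K → y ∉ Y := fun y hy hyK hyY =>
      (Finset.mem_sdiff.1 hy).2 (Finset.mem_inter.2 ⟨hyK, hyY⟩)
    by_cases haK : a ∈ K
    · have hwK : w ∈ K := comp_trans haK hwcomp
      exact h4 w hwK (hnotY w hwR' hwK) a haK (hnotY a ha haK)
    · have hwK : w ∉ K := by
        intro hwK
        exact haK (comp_trans hwK (comp_symm (hR'R ha) hwcomp))
      rw [h6 a haK, h6 w hwK, hconn a (hR'R ha) w hwcomp]
  · rw [h1]
    intro a ha
    by_cases haK : a ∈ K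
    · have haY : a ∉ Y := fun haY => (Finset.mem_sdiff.1 ha).2 (Finset.mem_inter.2 ⟨haK, haY⟩)
      refine ⟨j + 1, ?_, ?_⟩
      · have haKY : a ∈ K \ Y := Finset.mem_sdiff.2 ⟨haK, haY⟩
        -- `K` is a full component of the remaining graph, so a walk from `a` cannot leave it.
        have hsub : comp G R' a ⊆ comp G (K \ Y) a := by
          refine comp_subset (self_mem_comp _ _) ?_
          intro b hb w hw hbw
          have hbK : b ∈ K := (Finset.mem_sdiff.1 (comp_subset_self haKY hb)).1
          have hwK : w ∈ K := comp_tail hbK hbw (hR'R hw)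
          exact comp_tail hb hbw (Finset.mem_sdiff.2 ⟨hwK, fun hwY =>
            (Finset.mem_sdiff.1 hw).2 (Finset.mem_inter.2 ⟨hwK, hwY⟩)⟩)
        calc q ^ (j + 1) * (comp G R' a).card
            ≤ q ^ (j + 1) * (comp G (K \ Y) a).card :=
              Nat.mul_le_mul_left _ (Finset.card_le_card hsub)
          _ = q ^ j * (q * (comp G (K \ Y) a).card) := by ring
          _ ≤ q ^ j * (p * K.card) := Nat.mul_le_mul_left _ (hgood a haKY)
          _ = p * (q ^ j * K.card) := by ring
          _ ≤ p * (p ^ j * n) := Nat.mul_le_mul_left _ hj1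
          _ = p ^ (j + 1) * n := by ring
      · have := h5 a haK haY
        omega
    · obtain ⟨i, hi1, hi2⟩ := hsize a (hR'R ha)
      refine ⟨i, ?_, by rwa [h6 a haK]⟩
      exact (Nat.mul_le_mul_left _ (Finset.card_le_card (comp_mono hR'R a))).trans hi1
  · rw [h1]
    refine ⟨hR'R, fun h => ?_⟩
    obtain ⟨y, hy⟩ := hne
    exact (Finset.mem_sdiff.1 (h (hKR (Finset.mem_inter.1 hy).1))).2 hy

/-- Computes parents (array `6`, shifted by one), depths (array `7`) and height (variable `13`) of
an elimination forest. -/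
def buildForest (p q : ℕ) : Cmd :=
  .fill 2 3 (.lit 1) ;; .for 15 .size (.while (.arr 3 (.var 15)) (separateRound p q))

/-- For each node in turn its component is separated until the node itself has been removed; the
number of remaining nodes is the measure. When none remain, the partial forest is an elimination
forest of the whole graph. -/
theorem buildForest_runs (hn : 0 < n) {p q m L : ℕ} (hpq : p < q)
    (hsep : ∀ K : Finset (Fin n), K.Nonempty → ∃ X : Finset (Fin n), X.card ≤ m ∧
      IsGoodSeparator G p q K.card K X)
    (hL : ∀ j, q ^ j ≤ p ^ j * n → (j + 1) * m ≤ L) {σ : St} (h6 : σ.A 6 = fun _ => 0)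
    (h7 : σ.A 7 = fun _ => 0) (h13 : σ.x 13 = 0) :
    Runs G v (buildForest p q) σ (4000 * ((p + q + 1) * (n + 1) ^ 6 * ((n + 1) ^ m) ^ 3))
      (fun σ' => σ'.x 13 ≤ L ∧ ∃ anc, ElimForest G (σ'.fn n 6) anc ∧
        ∀ x, σ'.fn n 7 x = (anc x).card ∧ σ'.fn n 7 x < σ'.x 13) := by
  set W := (p + q + 1) * (n + 1) ^ 4 * ((n + 1) ^ m) ^ 3 with hW
  have hWpos : 1 ≤ W := Nat.succ_le_of_lt (by positivity)
  have hW6 : (p + q + 1) * (n + 1) ^ 6 * ((n + 1) ^ m) ^ 3 = (n + 1) * ((n + 1) * W) := by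
    rw [hW]; ring
  have hW1 : (n + 1) ≤ (n + 1) * W := Nat.le_mul_of_pos_right _ hWpos
  have hW2 : (n + 1) * W ≤ (n + 1) * ((n + 1) * W) := Nat.le_mul_of_pos_left _ (by omega)
  rw [hW6]
  refine Runs.seq (T₁ := 30 * (n + 1)) (T₂ := (n + 1) * (3500 * ((n + 1) * W)))
    (Runs.fill (fun _ => 1) (fun _ _ _ _ _ => rfl) (by simp only [NExpr.cost]; omega)) ?_ (by
      have : (n + 1) * (3500 * ((n + 1) * W)) = 3500 * ((n + 1) * ((n + 1) * W)) := by ring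
      omega)
  intro σ₁ hf₁ h₁
  have e6 : σ₁.fn n 6 = fun _ => 0 := by unfold St.fn; rw [hf₁.A 6 rfl, h6]
  have e7 : σ₁.fn n 7 = fun _ => 0 := by unfold St.fn; rw [hf₁.A 7 rfl, h7]
  have e13 : σ₁.x 13 = 0 := (hf₁.x 13 rfl).trans h13
  have e3 : σ₁.set n 3 = Finset.univ := by ext; simp [St.mem_set, h₁]
  refine (Runs.for n (3400 * ((n + 1) * W))
    (fun k σ' => ForestInv G p q m L σ' ∧ ∀ x ∈ σ'.set n 3, k ≤ (x : ℕ)) rfl (fun _ _ => rfl)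
    ?_ ?_ ?_).mono le_rfl ?_
  · rintro _ rfl
    -- At the start no node has ancestors, and `j = 0` works for every component.
    refine ⟨⟨fun _ => ∅, ?_, ?_, fun _ _ _ _ => rfl, fun u _ => ⟨0, ?_, ?_⟩⟩, fun _ _ => by omega⟩
    · show PartialForest G (σ₁.set n 3) (σ₁.fn n 6) (σ₁.fn n 7) _ (σ₁.x 13)
      rw [e6, e7, e3]
      exact ⟨fun _ => Or.inl ⟨rfl, rfl⟩, fun _ => rfl, by simp, by simp, by simp⟩
    · show σ₁.x 13 ≤ L
      omega
    · simpa using Finset.card_le_univ (comp G _ u)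
    · simp
  · rintro k hk σ₂ hf₂ hx₂ ⟨hI, hlt⟩
    refine (Runs.while (3000 * W) (fun σ' => ForestInv G p q m L σ' ∧ σ'.x 15 = k ∧
      ∀ x ∈ σ'.set n 3, k ≤ (x : ℕ)) (fun σ' => (σ'.set n 3).card) ⟨hI, hx₂, hlt⟩ ?_ ?_
      (T := 3400 * ((n + 1) * W))).mono le_rfl ?_
    · rintro σ₃ hf₃ ⟨hI₃, hx₃, hlt₃⟩ hne
      have hmem : (⟨k, hk⟩ : Fin n) ∈ σ₃.set n 3 := by
        rw [St.mem_set]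
        simpa [NExpr.eval, hx₃, hk] using hne
      refine (separateRound_runs hn hpq hsep hL (u := ⟨k, hk⟩) hx₃ hmem hI₃).mono le_rfl ?_
      rintro σ₄ hf₄ ⟨hI₄, hsub⟩
      exact ⟨⟨hI₄, (hf₄.x 15 rfl).trans hx₃, fun x hx => hlt₃ x (hsub.1 hx)⟩,
        Finset.card_lt_card hsub⟩
    · have hc : (σ₂.set n 3).card ≤ n := by simpa using Finset.card_le_univ (σ₂.set n 3)
      have : 3400 * ((n + 1) * W) = (n + 1) * (3400 * W) := by ring
      rw [this]
      refine Nat.mul_le_mul (by omega) ?_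
      simp only [NExpr.cost]
      omega
    · rintro σ' hf' ⟨⟨hI', hx', hlt'⟩, h0⟩ -
      refine ⟨hI', fun x hx => ?_⟩
      have h1 := hlt' x hx
      rcases Nat.lt_or_ge k x with h | h
      · exact h
      · have hxk : (x : ℕ) = k := le_antisymm h h1
        have hx : σ'.A 3 x ≠ 0 := St.mem_set.1 hx
        simp [NExpr.eval, hx', hk] at h0
        rw [hxk] at hx
        exact absurd h0 hx
  · refine Nat.mul_le_mul_left _ ?_
    simp only [NExpr.cost]
    have : 1 ≤ (n + 1) * W := by omega
    omega
  · rintro σ' hf' ⟨⟨⟨anc, hF, h13, -, -⟩, hlt⟩, -⟩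
    have hemp : σ'.set n 3 = ∅ := by
      rw [Finset.eq_empty_iff_forall_notMem]
      intro x hx
      have := hlt x hx
      omega
    rw [hemp] at hF
    exact ⟨h13, anc, ⟨hF.step, fun u w huw => hF.edge u w huw (by simp)⟩,
      fun x => ⟨hF.dep_eq x, hF.dep_lt x (by simp)⟩⟩

/-! ### Evaluation of one table entry -/

/-- Multiplies the variable `r` by the variable `16`, into variable `18`. -/
def mulBase (r : ℕ) : Cmd :=
  .asg 18 (.lit 0) ;; .for 3 (.var 16) (.asg 18 (.add (.var 18) (.var r)))

theorem mulBase_runs {r : ℕ} (hr : r ≠ 18) (hr' : r ≠ 3) (σ : St) :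
    Runs G v (mulBase r) σ (30 * (σ.x 16 + 1)) (fun σ' => σ'.x 18 = σ.x r * σ.x 16) := by
  refine Runs.seq (T₁ := 3) (T₂ := (σ.x 16 + 1) * 25)
    (Runs.of_flat (Q := fun σ' => σ'.x 18 = 0) rfl rfl le_rfl) ?_ (by omega)
  intro σ₁ hf₁ h₁
  have h16 : σ₁.x 16 = σ.x 16 := hf₁.x 16 rfl
  have hr₁ : σ₁.x r = σ.x r := hf₁.x r (by simp [Cmd.wx, hr.symm])
  refine (Runs.for (σ.x 16) 7 (fun m σ' => σ'.x 18 = σ.x r * m) rfl ?_ ?_ ?_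
    (by simp only [NExpr.cost]; omega)).mono le_rfl fun _ _ h => h.1
  · intro σ' hf
    rw [NExpr.eval, hf.x 16 rfl, h16]
  · rintro _ rfl
    simpa using h₁
  · intro m hm σ' hf hx hI
    have hr₂ : σ'.x r = σ.x r := by
      rw [hf.x r (by simp [Cmd.for, Cmd.wx, hr.symm, hr'.symm]), hr₁]
    refine Runs.of_flat rfl ?_ le_rfl
    intro _
    simp [Cmd.run, NExpr.eval, hI, hr₂, mul_add]

/-- Puts the address of the table entry of the node in variable `19` with the labels in array `9`
into variable `20`. -/
def findKey : Cmd :=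
  .asg 20 (.var 19) ;; .for 2 .size (mulBase 20 ;; .asg 20 (.add (.var 18) (.arr 9 (.var 2))))

theorem findKey_runs {σ : St} (u : Fin n) (hu : σ.x 19 = u) :
    Runs G v findKey σ (100 * ((n + 1) * (σ.x 16 + 1)))
      (fun σ' => σ'.x 20 = key (σ.x 16) u (σ.fn n 9)) := by
  refine Runs.seq (T₁ := 4) (T₂ := (n + 1) * (90 * (σ.x 16 + 1)))
    (Runs.of_flat (Q := fun σ' => σ'.x 20 = u) rfl hu le_rfl) ?_ (by
      have : (n + 1) * (90 * (σ.x 16 + 1)) = 90 * ((n + 1) * (σ.x 16 + 1)) := by ring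
      have : 1 ≤ (n + 1) * (σ.x 16 + 1) := Nat.succ_le_of_lt (by positivity)
      omega)
  intro σ₁ hf₁ h₁
  refine (Runs.for n (30 * (σ.x 16 + 1) + 20)
    (fun m σ' => σ'.x 20 = horner (σ.x 16) u (ext0 (σ.fn n 9)) m) rfl (fun _ _ => rfl) ?_ ?_
    ?_).mono le_rfl fun _ _ h => h.1
  · rintro _ rfl
    exact h₁
  · intro m hm σ₂ hf₂ hx₂ hI
    have h16 : σ₂.x 16 = σ.x 16 := by rw [hf₂.x 16 rfl, hf₁.x 16 rfl]
    have h9 : σ₂.A 9 = σ.A 9 := by rw [hf₂.A 9 rfl, hf₁.A 9 rfl]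
    refine Runs.seq (mulBase_runs (by decide) (by decide) σ₂) ?_ (T₂ := 20) (by rw [h16])
    intro σ₃ hf₃ h₃
    refine Runs.of_flat rfl ?_ (by decide)
    intro _
    have hx₃ : σ₃.x 2 = m := (hf₃.x 2 rfl).trans hx₂
    have h9' : σ₃.A 9 = σ.A 9 := (hf₃.A 9 rfl).trans h9
    simp [Cmd.run, NExpr.eval, h₃, hI, h16, hx₃, h9', hm, horner, ext0, St.fn]
  · refine Nat.mul_le_mul_left _ ?_
    simp only [NExpr.cost]; omega

/-- Puts the value of giving the label in variable `24` plus one to the node in variable `21` into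
the real variable `0`. -/
def evalLabel : Cmd :=
  .put 9 (.var 21) (.lit 0) ;;
  .fill 2 0 (NExpr.eqb (.arr 9 (.var 2)) (.add (.var 24) (.lit 1))) ;;
  (.query 1 0 ;; .put 0 (.var 21) (.lit 1) ;; .query 0 0 ;; .rsub 0 0 1 ;;
    .put 9 (.var 21) (.add (.var 24) (.lit 1))) ;;
  .for 19 .size (.ite (NExpr.eqb (.arr 6 (.var 19)) (.add (.var 21) (.lit 1)))
    (findKey ;; .rload 1 (.var 20) ;; .radd 0 0 1) .skip)

/-- Array `9` may still hold at `x` the label tried before, so `w` is compared with it after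
resetting that entry. Label `0` means unlabelled, and only ancestors carry the positive label `l +
1`. -/
theorem evalLabel_runs {anc : Fin n → Finset (Fin n)} {σ : St} {x : Fin n} {l : ℕ}
    {w : Fin n → ℕ} (hx : σ.x 21 = x) (hl : σ.x 24 = l)
    (hw : Function.update (σ.fn n 9) x 0 = w) (hanc : ∀ y, y ∉ anc x → w y = 0) :
    Runs G v evalLabel σ (500 * ((n + 1) ^ 2 * (σ.x 16 + 1)))
      (fun σ' => σ'.y 0 = obj v (σ.fn n 6) anc (σ.x 16) σ.M x w (l + 1) ∧
        σ'.fn n 9 = Function.update w x (l + 1)) := by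
  set b := σ.x 16 + 1 with hb
  have hZb : (n + 1) ≤ (n + 1) ^ 2 * b :=
    (Nat.le_self_pow (by norm_num) _).trans (Nat.le_mul_of_pos_right _ (by omega))
  refine Runs.seq (T₁ := 30) (T₂ := 100 * (n + 1) + (50 + (n + 1) * (300 * ((n + 1) * b))))
    (Runs.of_flat (Q := fun σ' => σ'.fn n 9 = w) rfl ?_ (by decide)) ?_ (by
      have : (n + 1) * (300 * ((n + 1) * b)) = 300 * ((n + 1) ^ 2 * b) := by ring
      omega)
  · rw [← hw]
    funext y
    simp only [Cmd.run, NExpr.eval, hx, x.2, if_true, St.fn, Function.update_self,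
      Function.update_apply, Fin.ext_iff]
  intro σ₁ hf₁ h₁
  have h24₁ : σ₁.x 24 = l := (hf₁.x 24 rfl).trans hl
  refine Runs.seq (T₁ := 100 * (n + 1)) (Runs.fill (fun y => if w y = l + 1 then 1 else 0) ?_
    (by simp only [NExpr.eqb, NExpr.cost]; omega)) ?_ le_rfl
  · intro y σ' hf hy _
    have h9 : σ'.A 9 y = w y := by rw [hf.A 9 rfl]; exact congrFun h₁ y
    have h24 : σ'.x 24 = l := (hf.x 24 rfl).trans h24₁
    rw [NExpr.eval_eqb]
    simp [NExpr.eval, hy, h9, h24]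
  intro σ₂ hf₂ h₂
  have hx₂ : σ₂.x 21 = x := by rw [hf₂.x 21 rfl, hf₁.x 21 rfl, hx]
  have h24₂ : σ₂.x 24 = l := (hf₂.x 24 rfl).trans h24₁
  have h9₂ : ∀ y : Fin n, σ₂.A 9 y = w y := fun y => by rw [hf₂.A 9 rfl]; exact congrFun h₁ y
  have hset : σ₂.set n 0 = (anc x).filter fun y => w y = l + 1 := by
    ext y
    rw [St.mem_set, h₂, Finset.mem_filter]
    constructor
    · intro h
      have h' : w y = l + 1 := by by_contra hne; simp [hne] at h
      exact ⟨by_contra fun hy => by simp [hanc y hy] at h', h'⟩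
    · exact fun h => by simp [h.2]
  -- The gain is the difference of two oracle calls, without `x` and with `x`.
  refine Runs.seq (T₁ := 50) (Runs.of_flat (Q := fun σ' => σ'.y 0 = gain v anc w x (l + 1) ∧
    σ'.fn n 9 = Function.update w x (l + 1)) rfl ?_ (by decide)) ?_ le_rfl
  · simp only [Cmd.run, NExpr.eval, hx₂, x.2, if_true, h24₂, Function.update_self]
    constructor
    · unfold gain
      rw [← hset, Function.update_of_ne (by decide), Function.update_self]
      congr 2
      ext y
      by_cases hy : y = x
      · subst hy; simp [St.mem_set]
      · have : (y : ℕ) ≠ x := fun h => hy (Fin.ext h)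
        simp [St.mem_set, hy, this]
    · funext y
      by_cases hy : y = x
      · subst hy; simp [St.fn]
      · have : (y : ℕ) ≠ x := fun h => hy (Fin.ext h)
        simp [St.fn, hy, this, h9₂]
  rintro σ₃ hf₃ ⟨hy₃, h9₃⟩
  have h16₃ : σ₃.x 16 = σ.x 16 := by rw [hf₃.x 16 rfl, hf₂.x 16 rfl, hf₁.x 16 rfl]
  have hx₃ : σ₃.x 21 = x := by rw [hf₃.x 21 rfl, hx₂]
  have h6₃ : σ₃.A 6 = σ.A 6 := by rw [hf₃.A 6 rfl, hf₂.A 6 rfl, hf₁.A 6 rfl]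
  have hM₃ : σ₃.M = σ.M := by rw [hf₃.M rfl, hf₂.M rfl, hf₁.M rfl]
  have hZb1 : 1 ≤ (n + 1) * b := Nat.succ_le_of_lt (by positivity)
  refine (Runs.for n (100 * ((n + 1) * b) + 100)
    (fun m σ' => σ'.y 0 = gain v anc w x (l + 1) + ∑ u with σ.fn n 6 u = x + 1 ∧ (u : ℕ) < m,
      σ.M (key (σ.x 16) u (Function.update w x (l + 1)))) rfl (fun _ _ => rfl) ?_ ?_
      (by simp only [NExpr.cost]; exact Nat.mul_le_mul_left _ (by omega))).mono le_rfl ?_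
  · rintro _ rfl
    simpa using hy₃
  · intro m hm σ₄ hf₄ hx₄ hI
    have h6₄ : σ₄.A 6 = σ.A 6 := (hf₄.A 6 rfl).trans h6₃
    have hx21 : σ₄.x 21 = x := (hf₄.x 21 rfl).trans hx₃
    have h9₄ : σ₄.fn n 9 = Function.update w x (l + 1) := by
      unfold St.fn; rw [hf₄.A 9 rfl]; exact h9₃
    have h16₄ : σ₄.x 16 = σ.x 16 := (hf₄.x 16 rfl).trans h16₃
    have hM₄ : σ₄.M = σ.M := (hf₄.M rfl).trans hM₃
    have hcond : (NExpr.eqb (.arr 6 (.var 19)) (.add (.var 21) (.lit 1))).eval G σ₄ ≠ 0 ↔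
        σ.fn n 6 ⟨m, hm⟩ = x + 1 := by
      rw [NExpr.eval_eqb]
      simp [NExpr.eval, hx₄, hm, h6₄, hx21, St.fn]
    have hsucc : (Finset.univ.filter fun u : Fin n => σ.fn n 6 u = x + 1 ∧ (u : ℕ) < m + 1) =
        if σ.fn n 6 ⟨m, hm⟩ = x + 1 then
          insert ⟨m, hm⟩ (Finset.univ.filter fun u : Fin n => σ.fn n 6 u = x + 1 ∧ (u : ℕ) < m)
        else Finset.univ.filter fun u : Fin n => σ.fn n 6 u = x + 1 ∧ (u : ℕ) < m := by
      ext u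
      by_cases hu : u = ⟨m, hm⟩
      · subst hu
        split_ifs with h' <;> simp [h']
      · have h1 : (u : ℕ) ≠ m := fun h => hu (Fin.ext h)
        have h2 : (u : ℕ) < m + 1 ↔ (u : ℕ) < m := by omega
        split_ifs <;> simp only [Finset.mem_insert, Finset.mem_filter, hu, false_or, h2]
    refine Runs.ite (T := 100 * ((n + 1) * b) + 20) (fun he => ?_) (fun he => ?_)
      (by simp only [NExpr.eqb, NExpr.cost]; omega)
    · rw [hcond] at he
      refine Runs.seq (T₂ := 20) ((findKey_runs ⟨m, hm⟩ hx₄).mono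
        (by rw [h16₄]) (fun _ _ h => h)) ?_ le_rfl
      intro σ₅ hf₅ h₅
      refine Runs.of_flat rfl ?_ (by decide)
      intro _
      rw [hsucc, if_pos he, Finset.sum_insert (by simp)]
      have hM₅ : σ₅.M = σ.M := (hf₅.M rfl).trans hM₄
      have hy₅ : σ₅.y 0 = σ₄.y 0 := hf₅.y 0 rfl
      simp [Cmd.run, NExpr.eval, h₅, hM₅, hy₅, h16₄, h9₄, hI]
      ring
    · have he' : ¬ σ.fn n 6 ⟨m, hm⟩ = x + 1 := fun h => hcond.2 h he
      refine Runs.of_flat rfl ?_ (by simp only [Cmd.cost]; omega)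
      intro _
      rw [hsucc, if_neg he']
      exact hI
  · rintro σ' hf' ⟨h, -⟩
    refine ⟨?_, ?_⟩
    · rw [h]
      unfold obj
      congr 2
      ext u
      simp
    · unfold St.fn; rw [hf'.A 9 rfl]; exact h9₃

/-- Finds the best value (real variable `2`) and the best label (variable `22`) for the node in
variable `21` when its ancestors have the labels in array `9`. -/
def bestLabel : Cmd :=
  .asg 22 (.lit 0) ;;
  .for 24 (.var 13) (evalLabel ;; .rlt 25 2 0 ;;
    .ite (.var 22) (.ite (.var 25) (.radd 2 0 3 ;; .asg 22 (.add (.var 24) (.lit 1))) .skip)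
      (.radd 2 0 3 ;; .asg 22 (.add (.var 24) (.lit 1)))) ;;
  .put 9 (.var 21) (.lit 0)

theorem ltBit_ne_zero {a b : ℝ} : ltBit a b ≠ 0 ↔ a < b := by
  unfold ltBit; split_ifs with h <;> simp [h]

/-- There is no initial value below all candidates, so variable `22` being zero signals that no
label has been chosen yet. Real variable `3` holds zero, and adding it copies a real number. -/
theorem bestLabel_runs {anc : Fin n → Finset (Fin n)} {σ : St} {x : Fin n} {L B : ℕ}
    {w : Fin n → ℕ} (hx : σ.x 21 = x) (hL : σ.x 13 = L) (hL1 : 1 ≤ L) (hB : σ.x 16 = B)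
    (hLB : L < B) (hy3 : σ.y 3 = 0) (hw : σ.fn n 9 = w) (hanc : ∀ y, y ∉ anc x → w y = 0)
    (hwx : x ∉ anc x) :
    Runs G v bestLabel σ (700 * ((n + 1) ^ 2 * (B + 1) ^ 2))
      (fun σ' => IsMaxLabel L (obj v (σ.fn n 6) anc B σ.M x w) (σ'.y 2) ∧
        1 ≤ σ'.x 22 ∧ σ'.x 22 ≤ L ∧ obj v (σ.fn n 6) anc B σ.M x w (σ'.x 22) = σ'.y 2 ∧
        σ'.fn n 9 = w) := by
  set F := obj v (σ.fn n 6) anc B σ.M x w with hF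
  set W := (n + 1) ^ 2 * (B + 1) with hW
  have hW1 : 1 ≤ W := Nat.succ_le_of_lt (by positivity)
  have hWB : (n + 1) ^ 2 * (B + 1) ^ 2 = (B + 1) * W := by rw [hW]; ring
  have hW2 : 1 ≤ (B + 1) * W := Nat.succ_le_of_lt (by positivity)
  have hw0 : Function.update w x 0 = w := by
    rw [← hanc x hwx, Function.update_eq_self]
  rw [hWB]
  refine Runs.seq (T₁ := 3) (T₂ := (L + 1) * (600 * W) + 20)
    (Runs.of_flat (Q := fun σ' => σ'.x 22 = 0) rfl rfl le_rfl) ?_ (by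
      have h1 : (L + 1) * (600 * W) ≤ (B + 1) * (600 * W) := Nat.mul_le_mul_right _ (by omega)
      have h2 : (B + 1) * (600 * W) = 600 * ((B + 1) * W) := by ring
      omega)
  intro σ₁ hf₁ h₁
  have e9 : σ₁.fn n 9 = w := by rw [← hw]; unfold St.fn; rw [hf₁.A 9 rfl]
  refine Runs.seq (T₁ := (L + 1) * (600 * W)) (T₂ := 20) (Runs.for L (500 * W + 50)
    (fun m σ' => Function.update (σ'.fn n 9) x 0 = w ∧ (m = 0 → σ'.x 22 = 0) ∧
      (0 < m → 1 ≤ σ'.x 22 ∧ σ'.x 22 ≤ m ∧ F (σ'.x 22) = σ'.y 2 ∧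
        ∀ l, 1 ≤ l → l ≤ m → F l ≤ σ'.y 2)) rfl ?_ ?_ ?_
        (by simp only [NExpr.cost]; exact Nat.mul_le_mul_left _ (by omega))) ?_ le_rfl
  · intro σ' hf
    rw [NExpr.eval, hf.x 13 rfl, hf₁.x 13 rfl, hL]
  · rintro _ rfl
    refine ⟨?_, fun _ => h₁, fun h => absurd h (lt_irrefl _)⟩
    show Function.update (σ₁.fn n 9) x 0 = w
    rw [e9, hw0]
  · rintro m hm σ₂ hf₂ hx₂ ⟨i1, i2, i3⟩
    have h21 : σ₂.x 21 = x := by rw [hf₂.x 21 rfl, hf₁.x 21 rfl, hx]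
    have h16 : σ₂.x 16 = B := by rw [hf₂.x 16 rfl, hf₁.x 16 rfl, hB]
    have h6 : σ₂.fn n 6 = σ.fn n 6 := by unfold St.fn; rw [hf₂.A 6 rfl, hf₁.A 6 rfl]
    have hM : σ₂.M = σ.M := by rw [hf₂.M rfl, hf₁.M rfl]
    have hy : σ₂.y 3 = 0 := by rw [hf₂.y 3 rfl, hf₁.y 3 rfl, hy3]
    refine Runs.seq (T₂ := 40) ((evalLabel_runs h21 hx₂ i1 hanc).mono
      (by rw [h16]) (fun _ _ h => h)) ?_ (by omega)
    rintro σ₃ hf₃ ⟨h30, h39⟩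
    rw [h6, h16, hM, ← hF] at h30
    have h22 : σ₃.x 22 = σ₂.x 22 := hf₃.x 22 rfl
    have hy2 : σ₃.y 2 = σ₂.y 2 := hf₃.y 2 rfl
    have hy33 : σ₃.y 3 = 0 := (hf₃.y 3 rfl).trans hy
    have h24 : σ₃.x 24 = m := (hf₃.x 24 rfl).trans hx₂
    have hup : Function.update (σ₃.fn n 9) x 0 = w := by
      rw [h39, Function.update_idem, hw0]
    refine (Runs.flat rfl).mono (by decide) ?_
    rintro _ hf₄ rfl _
    have hlt : ltBit (σ₃.y 2) (σ₃.y 0) = 0 ↔ ¬ σ₃.y 2 < σ₃.y 0 := by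
      rw [← ltBit_ne_zero, not_not]
    refine ⟨?_, fun h => absurd h (by omega), fun _ => ?_⟩
    · show Function.update (St.fn _ n 9) x 0 = w
      unfold St.fn
      dsimp only
      rw [hf₄.A 9 rfl]
      exact hup
    · rcases Nat.eq_zero_or_pos m with rfl | hmpos
      · have h220 : σ₃.x 22 = 0 := h22.trans (i2 rfl)
        simp only [Cmd.run, NExpr.eval, Function.update_of_ne (show (22 : ℕ) ≠ 25 by decide),
          Function.update_of_ne (show (24 : ℕ) ≠ 25 by decide),
          Function.update_of_ne (show (22 : ℕ) ≠ 24 by decide),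
          h220, ne_eq, not_true_eq_false, if_false, h24, hy33, add_zero,
          Function.update_self, zero_add]
        refine ⟨le_rfl, le_rfl, h30.symm, fun l hl1 hl2 => ?_⟩
        rw [le_antisymm hl2 hl1, h30, zero_add]
      · obtain ⟨j1, j2, j3, j4⟩ := i3 hmpos
        have h220 : σ₃.x 22 ≠ 0 := by omega
        by_cases hcmp : σ₃.y 2 < σ₃.y 0
        · have hb : ltBit (σ₃.y 2) (σ₃.y 0) ≠ 0 := ltBit_ne_zero.2 hcmp
          simp only [Cmd.run, NExpr.eval, Function.update_of_ne (show (22 : ℕ) ≠ 25 by decide),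
            Function.update_of_ne (show (24 : ℕ) ≠ 25 by decide),
            Function.update_of_ne (show (22 : ℕ) ≠ 24 by decide),
            h220, ne_eq, not_false_eq_true, if_true, hb, h24, hy33, add_zero,
            Function.update_self]
          refine ⟨by omega, le_rfl, h30.symm, fun l hl1 hl2 => ?_⟩
          rcases Nat.lt_or_ge m l with h | h
          · rw [show l = m + 1 by omega, h30]
          · exact (j4 l hl1 h).trans (hy2 ▸ hcmp.le)
        · have hb : ltBit (σ₃.y 2) (σ₃.y 0) = 0 := hlt.2 hcmp
          simp only [Cmd.run, NExpr.eval, Function.update_of_ne (show (22 : ℕ) ≠ 25 by decide),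
            Function.update_of_ne (show (24 : ℕ) ≠ 25 by decide),
            Function.update_of_ne (show (22 : ℕ) ≠ 24 by decide),
            h220, ne_eq, not_false_eq_true, if_true, hb, not_true_eq_false, if_false, h24, hy33,
            add_zero, Function.update_self]
          rw [h22, hy2]
          refine ⟨j1, by omega, j3, fun l hl1 hl2 => ?_⟩
          rcases Nat.lt_or_ge m l with h | h
          · rw [show l = m + 1 by omega, ← h30, ← hy2]
            exact not_lt.1 hcmp
          · exact j4 l hl1 h
  · rintro σ₂ hf₂ ⟨⟨i1, -, i3⟩, -⟩
    obtain ⟨j1, j2, j3, j4⟩ := i3 hL1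
    have h21 : σ₂.x 21 = x := by rw [hf₂.x 21 rfl, hf₁.x 21 rfl, hx]
    refine Runs.of_flat rfl ?_ (by decide)
    simp only [Cmd.run, NExpr.eval, h21, x.2, if_true]
    refine ⟨⟨j4, _, j1, j2, j3⟩, j1, j2, j3, ?_⟩
    rw [← i1]
    funext y
    simp only [St.fn, Function.update_self, Function.update_apply, Fin.ext_iff]

/-! ### Walking along the ancestors of a node -/

/-- Runs `p` for all ancestors `y` of the node in variable `21`, with variable `29` set to
`y + 1`. -/
def Cmd.walk (p : Cmd) : Cmd :=
  .asg 29 (.arr 6 (.var 21)) ;; .while (.var 29) (p ;; .asg 29 (.arr 6 (.sub (.var 29) (.lit 1))))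

/-- The invariant is indexed by the set of ancestors still to be visited, which shrinks from `anc x`
to `∅` as the walk climbs from the parent of `x` to a root. It must not depend on variable `29`,
which the loop itself updates. -/
theorem Runs.walk {p : Cmd} {par : Fin n → ℕ} {anc : Fin n → Finset (Fin n)}
    (hF : ElimForest G par anc) {σ : St} {x : Fin n} (C : ℕ) (I : Finset (Fin n) → St → Prop)
    (hx : σ.x 21 = x) (hpar : σ.fn n 6 = par) (hp : p.wx 29 = false) (hp6 : p.wA 6 = false)
    (hI : ∀ R σ' a, I R σ' → I R { σ' with x := Function.update σ'.x 29 a })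
    (h0 : I (anc x) σ)
    (hstep : ∀ z, z ∉ anc z → insert z (anc z) ⊆ anc x → ∀ σ', Frame (.walk p) σ σ' →
      σ'.x 29 = z + 1 → I (insert z (anc z)) σ' → Runs G v p σ' C (fun σ'' => I (anc z) σ'')) {T : ℕ}
    (hT : (n + 1) * (C + 30) ≤ T) :
    Runs G v (.walk p) σ T (I ∅) := by
  have hnext : ∀ (u : Fin n), (par u = 0 ∧ anc u = ∅) ∨
      ∃ z : Fin n, par u = z + 1 ∧ z ∉ anc z ∧ anc u = insert z (anc z) := hF.step
  refine Runs.seq (T₁ := 15) (T₂ := (n + 1) * (C + 20)) (Runs.of_flat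
    (Q := fun σ' => I (anc x) σ' ∧ σ'.x 29 = par x) rfl ?_ (by decide)) ?_ (by
      have : (n + 1) * (C + 30) = (n + 1) * (C + 20) + (n + 1) * 10 := by ring
      have := x.pos
      omega)
  · refine ⟨hI _ _ _ h0, ?_⟩
    simp only [Cmd.run, NExpr.eval, hx, x.2, if_true, Function.update_self, ← hpar, St.fn]
  rintro σ₁ hf₁ ⟨hI₁, h29⟩
  -- The number of ancestors still to be visited; the outer test only makes this total, since the
  -- variable need not name a node.
  set μ : St → ℕ := fun σ' =>
    if h : σ'.x 29 - 1 < n then if σ'.x 29 = 0 then 0 else (anc ⟨σ'.x 29 - 1, h⟩).card + 1 else 0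
    with hμ
  have hμz : ∀ (σ' : St) (z : Fin n), σ'.x 29 = z + 1 → μ σ' = (anc z).card + 1 := by
    intro σ' z hz
    simp [hμ, hz, z.2]
  have hμ0 : ∀ σ' : St, σ'.x 29 = 0 → μ σ' = 0 := by
    intro σ' hz
    simp [hμ, hz]
  refine (Runs.while (C + 16) (fun σ' => ∃ R, R ⊆ anc x ∧ I R σ' ∧ ((σ'.x 29 = 0 ∧ R = ∅) ∨
    ∃ z : Fin n, σ'.x 29 = z + 1 ∧ z ∉ anc z ∧ R = insert z (anc z))) μ ?_ ?_ ?_).mono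
    le_rfl ?_
  · refine ⟨anc x, subset_rfl, hI₁, ?_⟩
    rw [h29]
    exact hnext x
  · rintro σ' hf ⟨R, hRx, hR, ⟨hz, -⟩ | ⟨z, hz, hzz, rfl⟩⟩ he
    · exact absurd hz he
    have hf' : Frame (.walk p) σ σ' := hf₁.seq_left.trans hf.while.seq_right
    refine Runs.seq (hstep z hzz hRx σ' hf' hz hR) ?_ (T₂ := 16) le_rfl
    intro σ₂ hf₂ hI₂
    have h29' : σ₂.x 29 = z + 1 := (hf₂.x 29 hp).trans hz
    have h6 : σ₂.A 6 z = par z := by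
      rw [hf₂.A 6 hp6, hf'.A 6 (by simp [Cmd.walk, Cmd.wA, hp6]), ← hpar]; rfl
    refine Runs.of_flat rfl ?_ (by decide)
    have hrun : (Cmd.asg 29 (.arr 6 (.sub (.var 29) (.lit 1)))).run G v σ₂ =
        { σ₂ with x := Function.update σ₂.x 29 (par z) } := by
      simp only [Cmd.run, NExpr.eval, h29', Nat.add_sub_cancel, z.2, if_true, h6]
    rw [hrun]
    refine ⟨⟨anc z, (Finset.subset_insert _ _).trans hRx, hI _ _ _ hI₂, ?_⟩, ?_⟩
    · simp only [Function.update_self]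
      exact hnext z
    · rw [hμz σ' z hz]
      rcases hnext z with ⟨h, -⟩ | ⟨z', h, hz', hzz'⟩
      · rw [hμ0 _ (by simp only [Function.update_self]; exact h)]
        omega
      · rw [hμz _ z' (by simp only [Function.update_self]; exact h), hzz',
          Finset.card_insert_of_notMem hz']
        omega
  · have hcard : μ σ₁ ≤ n := by
      rcases hnext x with ⟨h, -⟩ | ⟨z, h, hz, -⟩
      · rw [hμ0 _ (h29.trans h)]; omega
      · rw [hμz _ z (h29.trans h)]
        have := Finset.card_le_univ (insert z (anc z))
        rwa [Finset.card_insert_of_notMem hz, Fintype.card_fin] at this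
    simp only [NExpr.cost]
    exact Nat.mul_le_mul (by omega) (by omega)
  · rintro σ' - ⟨⟨R, -, hR, ⟨-, rfl⟩ | ⟨z, hz, -⟩⟩, he⟩
    · exact hR
    · simp only [NExpr.eval] at he
      omega

/-! ### Decoding the labels of the ancestors -/

/-- The labels of the ancestors of `x` with the code `c`. -/
def decode (anc : Fin n → Finset (Fin n)) (B : ℕ) (x : Fin n) (c : ℕ) (y : Fin n) : ℕ :=
  if y ∈ anc x then c / B ^ ((anc x).card - 1 - (anc y).card) % B else 0

theorem decode_lt {anc : Fin n → Finset (Fin n)} {B : ℕ} (hB : 0 < B) (x : Fin n) (c : ℕ)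
    (y : Fin n) : decode anc B x c y < B := by
  unfold decode
  split_ifs
  · exact Nat.mod_lt _ hB
  · exact hB

theorem decode_of_notMem {anc : Fin n → Finset (Fin n)} {B : ℕ} {x y : Fin n} (c : ℕ)
    (hy : y ∉ anc x) : decode anc B x c y = 0 := if_neg hy

/-- Ancestors of `x` have distinct depths, so counting upwards from the parent gives them distinct
digit positions below `L`. Positions beyond the root are filled with zeros. -/
theorem ElimForest.exists_decode {par : Fin n → ℕ} {anc : Fin n → Finset (Fin n)}
    (hF : ElimForest G par anc) {B L : ℕ} {x : Fin n} (hL : (anc x).card ≤ L) {w : Fin n → ℕ}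
    (hw : ∀ y, w y < B) (hw' : ∀ y, y ∉ anc x → w y = 0) :
    ∃ c < B ^ L, decode anc B x c = w := by
  classical
  have hB : 0 < B := (Nat.zero_le _).trans_lt (hw x)
  set pos : Fin n → ℕ := fun y => (anc x).card - 1 - (anc y).card with hpos
  set d : Fin L → Fin B := fun i =>
    if h : ∃ y ∈ anc x, pos y = i then ⟨w h.choose, hw _⟩ else ⟨0, hB⟩ with hd
  refine ⟨finFunctionFinEquiv d, (finFunctionFinEquiv d).2, ?_⟩
  funext y
  by_cases hy : y ∈ anc x
  · have hlt := hF.card_lt hy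
    have hposL : pos y < L := by simp only [hpos]; omega
    have h1 := finFunctionFinEquiv_symm_apply_val (finFunctionFinEquiv d) ⟨pos y, hposL⟩
    rw [Equiv.symm_apply_apply] at h1
    have hex : ∃ y' ∈ anc x, pos y' = (⟨pos y, hposL⟩ : Fin L) := ⟨y, hy, rfl⟩
    have hch : hex.choose = y := by
      obtain ⟨h2, h3⟩ := hex.choose_spec
      simp only [hpos] at h3
      have h4 := hF.card_lt h2
      have h5 : (anc hex.choose).card = (anc y).card := by omega
      rcases hF.chain hy h2 with h | h | h
      · exact h
      · have := hF.card_lt h; omega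
      · have := hF.card_lt h; omega
    have h6 : (d ⟨pos y, hposL⟩ : ℕ) = w y := by
      simp only [hd]
      rw [dif_pos hex]
      simp only [hch]
    rw [decode, if_pos hy, ← h6, h1]
  · rw [decode_of_notMem _ hy, hw' y hy]

/-- Puts the labels with the code in variable `27` for the ancestors of the node in variable `21`
into array `9`. -/
def decodeLabels : Cmd :=
  .fill 2 9 (.lit 0) ;; .asg 28 (.var 27) ;;
  .walk (.divMod 28 30 (.var 16) ;; .put 9 (.sub (.var 29) (.lit 1)) (.var 28) ;;
    .asg 28 (.var 30))

theorem decodeLabels_runs {par : Fin n → ℕ} {anc : Fin n → Finset (Fin n)}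
    (hF : ElimForest G par anc) {σ : St} {x : Fin n} {B : ℕ} (hx : σ.x 21 = x)
    (hpar : σ.fn n 6 = par) (hB : σ.x 16 = B) (hB0 : 0 < B) :
    Runs G v decodeLabels σ (200 * ((n + 1) * (σ.x 27 + 1)))
      (fun σ' => σ'.fn n 9 = decode anc B x (σ.x 27)) := by
  set c := σ.x 27 with hc
  have hcn : n + 1 ≤ (n + 1) * (c + 1) := Nat.le_mul_of_pos_right _ (by omega)
  refine Runs.seq (T₁ := 40 * (n + 1)) (Runs.fill (fun _ => 0) (fun _ _ _ _ _ => rfl)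
    (by simp only [NExpr.cost]; omega)) ?_ (T₂ := 4 + (n + 1) * ((c + 1) * 100)) (by
      have : (n + 1) * ((c + 1) * 100) = 100 * ((n + 1) * (c + 1)) := by ring
      omega)
  intro σ₁ hf₁ h₁
  refine Runs.seq (T₁ := 4) (Runs.of_flat (Q := fun σ' => σ'.x 28 = c) rfl
    (hf₁.x 27 rfl) le_rfl) ?_ le_rfl
  intro σ₂ hf₂ h₂
  have hx₂ : σ₂.x 21 = x := by rw [hf₂.x 21 rfl, hf₁.x 21 rfl, hx]
  have h6₂ : σ₂.fn n 6 = par := by unfold St.fn; rw [hf₂.A 6 rfl, hf₁.A 6 rfl]; exact hpar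
  have h16₂ : σ₂.x 16 = B := by rw [hf₂.x 16 rfl, hf₁.x 16 rfl, hB]
  have h9₂ : ∀ y : Fin n, σ₂.A 9 y = 0 := fun y => by rw [hf₂.A 9 rfl]; exact h₁ y
  -- The exponent is the number of ancestors already visited, each of which has consumed one digit.
  refine (Runs.walk hF ((c + 1) * 24 + 30) (fun R σ' => σ'.x 28 = c / B ^ ((anc x).card - R.card) ∧
    ∀ y : Fin n, σ'.A 9 y = if y ∈ R then 0 else decode anc B x c y) hx₂ h6₂ rfl rfl
    (fun R σ' a h => h) ⟨by simp [h₂], fun y => ?_⟩ ?_ (Nat.mul_le_mul_left _ (by omega))).mono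
    le_rfl ?_
  · rw [h9₂]
    split_ifs with h
    · rfl
    · rw [decode_of_notMem _ h]
  · rintro z hz hzx σ₃ hf₃ h29 ⟨i1, i2⟩
    have hzx' : z ∈ anc x := hzx (Finset.mem_insert_self _ _)
    have hlt := hF.card_lt hzx'
    rw [Finset.card_insert_of_notMem hz] at i1
    have h28c : σ₃.x 28 ≤ c := i1 ▸ Nat.div_le_self _ _
    refine Runs.seq (T₂ := 30) ((divMod_runs (b := B) hB0 (by decide) fun σ' hf => by
      rw [NExpr.eval, hf.x 16 rfl, hf₃.x 16 rfl, h16₂]).mono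
      (Nat.mul_le_mul_right _ (Nat.succ_le_succ h28c)) (fun _ _ h => h)) ?_ (by
        simp only [NExpr.cost]; omega)
    rintro σ₄ hf₄ ⟨hq, ht⟩
    have h29₄ : σ₄.x 29 = z + 1 := (hf₄.x 29 rfl).trans h29
    have h9₄ : σ₄.A 9 = σ₃.A 9 := hf₄.A 9 rfl
    refine Runs.of_flat rfl ?_ (by decide)
    simp only [Cmd.run, NExpr.eval, h29₄, Nat.add_sub_cancel, z.2, if_true, hq, ht, h9₄,
      Function.update_self, i1]
    refine ⟨?_, fun y => ?_⟩
    · rw [Nat.div_div_eq_div_mul, ← pow_succ]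
      congr 2
      omega
    · by_cases hy : y = z
      · subst hy
        rw [Function.update_self, if_neg hz, decode, if_pos hzx']
        congr 3
        omega
      · rw [Function.update_of_ne (fun h => hy (Fin.ext h)), i2]
        simp only [Finset.mem_insert, hy, false_or]
  · rintro σ' - ⟨-, h⟩
    funext y
    exact (h y).trans (by simp)

/-! ### The table -/

/-- The state after the preparations for the computation of the table. -/
structure Setup (G : SimpleGraph (Fin n)) (par : Fin n → ℕ) (anc : Fin n → Finset (Fin n))
    (L N : ℕ) (σ : St) : Prop where
  forest : ElimForest G par anc
  par_eq : σ.fn n 6 = par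
  dep : ∀ x, σ.fn n 7 x = (anc x).card
  dep_lt : ∀ x, (anc x).card < L
  x13 : σ.x 13 = L
  x16 : σ.x 16 = L + 1
  x17 : σ.x 17 = N
  y3 : σ.y 3 = 0

theorem Setup.frame {par : Fin n → ℕ} {anc : Fin n → Finset (Fin n)} {L N : ℕ} {σ σ' : St} {p : Cmd}
    (h : Setup G par anc L N σ) (hf : Frame p σ σ')
    (hp : (p.wA 6 || p.wA 7 || p.wx 13 || p.wx 16 || p.wx 17 || p.wy 3) = false) :
    Setup G par anc L N σ' := by
  simp only [Bool.or_eq_false_iff] at hp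
  obtain ⟨⟨⟨⟨⟨h6, h7⟩, h13⟩, h16⟩, h17⟩, h3⟩ := hp
  refine ⟨h.forest, ?_, ?_, h.dep_lt, (hf.x 13 h13).trans h.x13, (hf.x 16 h16).trans h.x16,
    (hf.x 17 h17).trans h.x17, (hf.y 3 h3).trans h.y3⟩
  · unfold St.fn; rw [hf.A 6 h6]; exact h.par_eq
  · unfold St.fn; rw [hf.A 7 h7]; exact h.dep

/-- Computes the table entry of the node in variable `21` for the labels with the code in
variable `27`. -/
def tableEntry : Cmd :=
  decodeLabels ;; bestLabel ;; .asg 19 (.var 21) ;; findKey ;; .rstore (.var 20) 2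

theorem tableEntry_runs {par : Fin n → ℕ} {anc : Fin n → Finset (Fin n)} {L N : ℕ} {σ : St}
    (h : Setup G par anc L N σ) {x : Fin n} {c : ℕ} (hx : σ.x 21 = x) (hc : σ.x 27 = c)
    (hcN : c < N) :
    Runs G v tableEntry σ (1300 * ((n + 1) ^ 2 * (L + 2) ^ 2 * N))
      (fun σ' => ∃ a, IsMaxLabel L (obj v par anc (L + 1) σ.M x (decode anc (L + 1) x c)) a ∧
        σ'.M = Function.update σ.M (key (L + 1) x (decode anc (L + 1) x c)) a) := by
  set w := decode anc (L + 1) x c with hw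
  set W := (n + 1) ^ 2 * (L + 2) ^ 2 with hW
  have hL1 : 1 ≤ L := Nat.one_le_of_lt (h.dep_lt x)
  have hn1 : n + 1 ≤ (n + 1) ^ 2 := Nat.le_self_pow (by norm_num) _
  have hWn : n + 1 ≤ W := hn1.trans (Nat.le_mul_of_pos_right _ (by positivity))
  have hWL : (n + 1) * (L + 2) ≤ W :=
    Nat.mul_le_mul hn1 (Nat.le_self_pow (by norm_num) _)
  have hWN : W ≤ W * N := Nat.le_mul_of_pos_right _ (by omega)
  have h1N : (n + 1) * (c + 1) ≤ W * N := Nat.mul_le_mul hWn hcN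
  refine Runs.seq (T₁ := 200 * ((n + 1) * (c + 1))) (T₂ := 700 * W + (4 + (100 * W + 4)))
    ((decodeLabels_runs h.forest hx h.par_eq h.x16 (by omega)).mono (by rw [hc]) (fun _ _ h => h))
    ?_ (by have := Nat.succ_le_of_lt (Nat.pos_of_ne_zero (show n + 1 ≠ 0 by omega)); omega)
  intro σ₁ hf₁ h₁
  rw [hc, ← hw] at h₁
  have s₁ := h.frame hf₁ rfl
  have hx₁ : σ₁.x 21 = x := (hf₁.x 21 rfl).trans hx
  have hM₁ : σ₁.M = σ.M := hf₁.M rfl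
  refine Runs.seq (T₁ := 700 * W) (bestLabel_runs hx₁ s₁.x13 hL1 s₁.x16 (by omega) s₁.y3 h₁
    (fun y hy => decode_of_notMem _ hy) (h.forest.not_mem_self x)) ?_ le_rfl
  rintro σ₂ hf₂ ⟨hmax, -, -, -, h9⟩
  rw [s₁.par_eq, hM₁] at hmax
  have s₂ := s₁.frame hf₂ rfl
  refine Runs.seq (T₁ := 4) (Runs.of_flat (Q := fun σ' => σ'.x 19 = x) rfl
    ((hf₂.x 21 rfl).trans hx₁) le_rfl) ?_ le_rfl
  intro σ₃ hf₃ h₃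
  have s₃ := s₂.frame hf₃ rfl
  refine Runs.seq (T₁ := 100 * W) ((findKey_runs x h₃).mono ?_ fun _ _ h => h) ?_ le_rfl
  · rw [s₃.x16]
    exact Nat.mul_le_mul_left _ hWL
  intro σ₄ hf₄ h₄
  refine Runs.of_flat rfl ⟨σ₂.y 2, hmax, ?_⟩ (by decide)
  have h9₃ : σ₃.fn n 9 = w := by unfold St.fn; rw [hf₃.A 9 rfl]; exact h9
  rw [s₃.x16, h9₃] at h₄
  have hM₄ : σ₄.M = σ.M := by rw [hf₄.M rfl, hf₃.M rfl, hf₂.M rfl, hM₁]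
  have hy₄ : σ₄.y 2 = σ₂.y 2 := by rw [hf₄.y 2 rfl, hf₃.y 2 rfl]
  simp only [Cmd.run, NExpr.eval, h₄, hM₄, hy₄]

/-- The table entries of the node `x` are correct relative to those of its children. -/
def IsEntry (v : Finset (Fin n) → ℝ) (par : Fin n → ℕ) (anc : Fin n → Finset (Fin n)) (L : ℕ)
    (M : ℕ → ℝ) (x : Fin n) : Prop :=
  ∀ w : Fin n → ℕ, (∀ y, w y < L + 1) → (∀ y, y ∉ anc x → w y = 0) →
    IsMaxLabel L (obj v par anc (L + 1) M x w) (M (key (L + 1) x w))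

theorem IsMaxLabel.congr {L : ℕ} {F F' : ℕ → ℝ} {a : ℝ} (h : IsMaxLabel L F a)
    (hF : ∀ l, 1 ≤ l → l ≤ L → F l = F' l) : IsMaxLabel L F' a := by
  obtain ⟨h1, l, h2, h3, h4⟩ := h
  exact ⟨fun l hl hl' => hF l hl hl' ▸ h1 l hl hl', l, h2, h3, hF l h2 h3 ▸ h4⟩

theorem obj_congr {par : Fin n → ℕ} {anc : Fin n → Finset (Fin n)} {L : ℕ} {M M' : ℕ → ℝ}
    {x : Fin n} {w : Fin n → ℕ} (hw : ∀ y, w y < L + 1)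
    (hM : ∀ u, par u = x + 1 → ∀ w : Fin n → ℕ, (∀ y, w y < L + 1) →
      M (key (L + 1) u w) = M' (key (L + 1) u w)) {l : ℕ} (hl : l ≤ L) :
    obj v par anc (L + 1) M x w l = obj v par anc (L + 1) M' x w l := by
  unfold obj
  congr 1
  refine Finset.sum_congr rfl fun u hu => hM u (Finset.mem_filter.1 hu).2 _ fun y => ?_
  rw [Function.update_apply]
  split_ifs
  · omega
  · exact hw y

theorem IsEntry.congr {par : Fin n → ℕ} {anc : Fin n → Finset (Fin n)} {L : ℕ} {M M' : ℕ → ℝ}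
    {x : Fin n} (h : IsEntry v par anc L M x)
    (hM : ∀ u, u = x ∨ par u = x + 1 → ∀ w : Fin n → ℕ, (∀ y, w y < L + 1) →
      M (key (L + 1) u w) = M' (key (L + 1) u w)) : IsEntry v par anc L M' x := by
  intro w hw hw'
  rw [← hM x (Or.inl rfl) w hw]
  exact (h w hw hw').congr fun l _ hl => obj_congr hw (fun u hu => hM u (Or.inr hu)) hl

/-- Computes the table entries of the node in variable `21`. -/
def tableNode : Cmd := .for 27 (.var 17) tableEntry

/-- Only keys of `x` are written, and `x` is not its own child, so the objective may be evaluated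
with the table from before the loop. Running through `(L + 1) ^ L` codes reaches every admissible
labelling of the ancestors. -/
theorem tableNode_runs {par : Fin n → ℕ} {anc : Fin n → Finset (Fin n)} {L : ℕ} {σ : St}
    (h : Setup G par anc L ((L + 1) ^ L) σ) {x : Fin n} (hx : σ.x 21 = x) :
    Runs G v tableNode σ (3000 * ((n + 1) ^ 2 * (L + 2) ^ 2 * ((L + 1) ^ L) ^ 2))
      (fun σ' => IsEntry v par anc L σ'.M x ∧ ∀ u, u ≠ x → ∀ w : Fin n → ℕ,
        (∀ y, w y < L + 1) → σ'.M (key (L + 1) u w) = σ.M (key (L + 1) u w)) := by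
  set N := (L + 1) ^ L with hN
  set W := (n + 1) ^ 2 * (L + 2) ^ 2 with hW
  have hN1 : 1 ≤ N := Nat.one_le_pow _ _ (by omega)
  have hW1 : 1 ≤ W := Nat.succ_le_of_lt (by positivity)
  have hWN : 1 ≤ W * N := Nat.succ_le_of_lt (by positivity)
  have hkey : ∀ (u : Fin n) (w : Fin n → ℕ), (∀ y, w y < L + 1) → ∀ c,
      key (L + 1) u w = key (L + 1) x (decode anc (L + 1) x c) →
        u = x ∧ w = decode anc (L + 1) x c := fun u w hw c he =>
    key_inj hw (decode_lt (by omega) x c) he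
  refine (Runs.for N (1300 * (W * N)) (fun m σ' =>
    (∀ c < m, IsMaxLabel L (obj v par anc (L + 1) σ.M x (decode anc (L + 1) x c))
      (σ'.M (key (L + 1) x (decode anc (L + 1) x c)))) ∧
    ∀ u, u ≠ x → ∀ w : Fin n → ℕ, (∀ y, w y < L + 1) →
      σ'.M (key (L + 1) u w) = σ.M (key (L + 1) u w)) rfl ?_ ?_ ?_ ?_).mono le_rfl ?_
  · intro σ' hf
    rw [NExpr.eval, hf.x 17 rfl, h.x17]
  · rintro _ rfl
    exact ⟨fun c hc => absurd hc (by omega), fun u _ w _ => rfl⟩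
  · rintro m hm σ₁ hf₁ hx₁ ⟨i1, i2⟩
    have s₁ := h.frame hf₁ rfl
    refine (tableEntry_runs s₁ ((hf₁.x 21 rfl).trans hx) hx₁ hm).mono le_rfl ?_
    rintro σ₂ - ⟨a, ha, hM⟩ -
    have ha' : IsMaxLabel L (obj v par anc (L + 1) σ.M x (decode anc (L + 1) x m)) a := by
      refine ha.congr fun l _ hl => obj_congr (decode_lt (by omega) x m) (fun u hu => i2 u ?_) hl
      rintro rfl
      have := h.forest.card_parent hu
      omega
    show (∀ c < m + 1, IsMaxLabel L (obj v par anc (L + 1) σ.M x (decode anc (L + 1) x c))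
      (σ₂.M (key (L + 1) x (decode anc (L + 1) x c)))) ∧
      ∀ u, u ≠ x → ∀ w : Fin n → ℕ, (∀ y, w y < L + 1) →
        σ₂.M (key (L + 1) u w) = σ.M (key (L + 1) u w)
    rw [hM]
    refine ⟨fun c hc => ?_, fun u hu w hw => ?_⟩
    · by_cases he : key (L + 1) x (decode anc (L + 1) x c) =
          key (L + 1) x (decode anc (L + 1) x m)
      · rw [he, Function.update_self, (hkey x _ (decode_lt (by omega) x c) m he).2]
        exact ha'
      · rw [Function.update_of_ne he]
        refine i1 c (lt_of_le_of_ne (by omega) ?_)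
        rintro rfl
        exact he rfl
    · rw [Function.update_of_ne fun he => hu (hkey u w hw m he).1]
      exact i2 u hu w hw
  · simp only [NExpr.cost]
    calc (N + 1) * (1300 * (W * N) + 2 + 13) ≤ (2 * N) * (1400 * (W * N)) :=
          Nat.mul_le_mul (by omega) (by omega)
      _ ≤ 3000 * (W * N ^ 2) := by nlinarith [Nat.zero_le (W * N ^ 2)]
  · rintro σ' - ⟨⟨h1, h2⟩, -⟩
    refine ⟨fun w hw hw' => ?_, h2⟩
    obtain ⟨c, hc, rfl⟩ := h.forest.exists_decode (h.dep_lt x).le hw hw'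
    refine (h1 c hc).congr fun l _ hl => obj_congr hw (fun u hu w hw => (h2 u ?_ w hw).symm) hl
    rintro rfl
    have := h.forest.card_parent hu
    omega

/-- Computes the table. -/
def computeTable : Cmd :=
  .for 26 (.var 13) (.asg 31 (.sub (.sub (.var 13) (.lit 1)) (.var 26)) ;;
    .for 21 .size (.ite (NExpr.eqb (.arr 7 (.var 21)) (.var 31)) tableNode .skip))

/-- Depths are processed downwards from `L - 1`, so the entries of the children are final before
those of their parent are computed. -/
theorem computeTable_runs {par : Fin n → ℕ} {anc : Fin n → Finset (Fin n)} {L : ℕ} {σ : St}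
    (h : Setup G par anc L ((L + 1) ^ L) σ) :
    Runs G v computeTable σ (3200 * ((n + 1) ^ 3 * (L + 2) ^ 3 * ((L + 1) ^ L) ^ 2))
      (fun σ' => ∀ x, IsEntry v par anc L σ'.M x) := by
  set W := (n + 1) ^ 2 * (L + 2) ^ 2 * ((L + 1) ^ L) ^ 2 with hW
  have hW1 : 1 ≤ W := Nat.succ_le_of_lt (by positivity)
  have hnW : 1 ≤ (n + 1) * W := Nat.succ_le_of_lt (by positivity)
  refine (Runs.for L (3100 * ((n + 1) * W) + 12)
    (fun k σ' => ∀ x, L - k ≤ (anc x).card → IsEntry v par anc L σ'.M x) rfl ?_ ?_ ?_ ?_).mono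
    le_rfl ?_
  · intro σ' hf
    rw [NExpr.eval, hf.x 13 rfl, h.x13]
  · rintro _ rfl x hx
    have := h.dep_lt x
    omega
  · intro k hk σ₁ hf₁ hx₁ hI
    have s₁ := h.frame hf₁ rfl
    refine Runs.seq (T₁ := 12) (T₂ := 3100 * ((n + 1) * W)) (Runs.of_flat
      (Q := fun σ' => σ'.x 31 = L - 1 - k) rfl ?_ (by decide)) ?_ (by omega)
    · simp [Cmd.run, NExpr.eval, s₁.x13, hx₁]
    intro σ₂ hf₂ h₂
    have s₂ := s₁.frame hf₂ rfl
    have hM₂ : σ₂.M = σ₁.M := hf₂.M rfl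
    refine (Runs.for n (3000 * W + 50) (fun m σ' => ∀ x : Fin n,
      (L - k ≤ (anc x).card ∨ (anc x).card = L - 1 - k ∧ (x : ℕ) < m) →
        IsEntry v par anc L σ'.M x) rfl (fun _ _ => rfl) ?_ ?_ ?_).mono le_rfl ?_
    · rintro _ rfl x hx
      refine (hI x (by omega)).congr fun _ _ _ _ => by rw [hM₂]
    · intro m hm σ₃ hf₃ hx₃ hI₃
      have s₃ := s₂.frame hf₃ rfl
      have h31 : σ₃.x 31 = L - 1 - k := (hf₃.x 31 rfl).trans h₂
      have hd : σ₃.A 7 m = (anc ⟨m, hm⟩).card := s₃.dep ⟨m, hm⟩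
      have hcond : (NExpr.eqb (.arr 7 (.var 21)) (.var 31)).eval G σ₃ ≠ 0 ↔
          (anc ⟨m, hm⟩).card = L - 1 - k := by
        rw [NExpr.eval_eqb]
        simp [NExpr.eval, hx₃, hm, h31, hd]
      refine Runs.ite (T := 3000 * W) (fun he => ?_) (fun he => ?_)
        (by simp only [NExpr.eqb, NExpr.cost]; omega)
      · rw [hcond] at he
        refine (tableNode_runs s₃ (x := ⟨m, hm⟩) hx₃).mono le_rfl ?_
        rintro σ₄ - ⟨h1, h2⟩ - x hx
        by_cases hxm : x = ⟨m, hm⟩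
        · exact hxm ▸ h1
        · have hxm' : (x : ℕ) ≠ m := fun h => hxm (Fin.ext h)
          -- The node just processed has depth `L - 1 - k`, while children of finished nodes are
          -- deeper; hence it affects no finished entry.
          refine (hI₃ x (by omega)).congr fun u hu w hw => (h2 u ?_ w hw).symm
          rintro rfl
          rcases hu with hu | hu
          · exact hxm hu.symm
          · have := h.forest.card_parent hu
            omega
      · have he' : ¬ (anc ⟨m, hm⟩).card = L - 1 - k := fun h => hcond.2 h he
        refine Runs.of_flat rfl ?_ (by simp only [Cmd.cost]; omega)
        intro _ x hx
        refine hI₃ x (hx.imp_right fun h => ⟨h.1, lt_of_le_of_ne (by omega) ?_⟩)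
        rintro rfl
        exact he' h.1
    · simp only [NExpr.cost]
      calc (n + 1) * (3000 * W + 50 + 2 + 13) ≤ (n + 1) * (3065 * W) :=
            Nat.mul_le_mul_left _ (by omega)
        _ ≤ 3100 * ((n + 1) * W) := by nlinarith [Nat.zero_le ((n + 1) * W)]
    · rintro σ' - ⟨h1, -⟩ - x hx
      exact h1 x (by have := x.2; omega)
  · simp only [NExpr.cost]
    calc (L + 1) * (3100 * ((n + 1) * W) + 12 + 2 + 13) ≤ (L + 2) * (3200 * ((n + 1) * W)) :=
          Nat.mul_le_mul (by omega) (by omega)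
      _ = 3200 * ((n + 1) ^ 3 * (L + 2) ^ 3 * ((L + 1) ^ L) ^ 2) := by rw [hW]; ring
  · rintro σ' - ⟨h1, -⟩ x
    exact h1 x (by omega)

/-! ### Optimal labels from the table -/

/-- The label of `x` is an optimal choice after the labels of its ancestors. -/
def IsGreedyAt (v : Finset (Fin n) → ℝ) (par : Fin n → ℕ) (anc : Fin n → Finset (Fin n)) (L : ℕ)
    (M : ℕ → ℝ) (lam : Fin n → ℕ) (x : Fin n) : Prop :=
  (1 ≤ lam x ∧ lam x ≤ L) ∧ ∀ l, 1 ≤ l → l ≤ L →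
    obj v par anc (L + 1) M x (restr anc lam x) l ≤
      obj v par anc (L + 1) M x (restr anc lam x) (lam x)

theorem restr_update {anc : Fin n → Finset (Fin n)} {lam : Fin n → ℕ} {x y : Fin n} {l : ℕ}
    (h : y ∉ anc x) : restr anc (Function.update lam y l) x = restr anc lam x := by
  funext z
  unfold restr
  split_ifs with hz
  · exact Function.update_of_ne (by rintro rfl; exact h hz) _ _
  · rfl

theorem IsGreedyAt.update {par : Fin n → ℕ} {anc : Fin n → Finset (Fin n)} {L : ℕ} {M : ℕ → ℝ}
    {lam : Fin n → ℕ} {x y : Fin n} {l : ℕ} (h : IsGreedyAt v par anc L M lam x) (hy : y ∉ anc x)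
    (hxy : x ≠ y) : IsGreedyAt v par anc L M (Function.update lam y l) x := by
  unfold IsGreedyAt
  rw [restr_update hy, Function.update_of_ne hxy]
  exact h

/-- Puts the labels in array `10` of the ancestors of the node in variable `21` into array `9`. -/
def gather : Cmd :=
  .fill 2 9 (.lit 0) ;;
  .walk (.put 9 (.sub (.var 29) (.lit 1)) (.arr 10 (.sub (.var 29) (.lit 1))))

theorem gather_runs {par : Fin n → ℕ} {anc : Fin n → Finset (Fin n)} (hF : ElimForest G par anc)
    {σ : St} {x : Fin n} (hx : σ.x 21 = x) (hpar : σ.fn n 6 = par) :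
    Runs G v gather σ (150 * (n + 1)) (fun σ' => σ'.fn n 9 = restr anc (σ.fn n 10) x) := by
  refine Runs.seq (T₁ := 40 * (n + 1)) (Runs.fill (fun _ => 0) (fun _ _ _ _ _ => rfl)
    (by simp only [NExpr.cost]; omega)) ?_ (T₂ := 110 * (n + 1)) (by omega)
  intro σ₁ hf₁ h₁
  have h6 : σ₁.fn n 6 = par := by unfold St.fn; rw [hf₁.A 6 rfl]; exact hpar
  refine (Runs.walk hF 60 (fun R σ' => ∀ y : Fin n, σ'.A 9 y =
    if y ∈ R then 0 else restr anc (σ.fn n 10) x y) ((hf₁.x 21 rfl).trans hx) h6 rfl rfl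
    (fun R σ' a h => h) (fun y => ?_) ?_ (by omega)).mono le_rfl ?_
  · rw [h₁]
    split_ifs with h
    · rfl
    · exact (if_neg h).symm
  · intro z hz hzx σ₂ hf₂ h29 hI
    have h10 : σ₂.A 10 z = σ.fn n 10 z := by rw [hf₂.A 10 rfl, hf₁.A 10 rfl]; rfl
    refine Runs.of_flat rfl ?_ (by decide)
    intro y
    simp only [Cmd.run, NExpr.eval, h29, Nat.add_sub_cancel, z.2, if_true, h10,
      Function.update_self]
    by_cases hy : y = z
    · subst hy
      rw [Function.update_self, if_neg hz, restr, if_pos (hzx (Finset.mem_insert_self _ _))]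
    · rw [Function.update_of_ne (fun h => hy (Fin.ext h)), hI]
      simp only [Finset.mem_insert, hy, false_or]
  · rintro σ' - h
    funext y
    exact (h y).trans (by simp)

/-- Computes an optimal label for the node in variable `21` into array `10`. -/
def traceNode : Cmd := gather ;; bestLabel ;; .put 10 (.var 21) (.var 22)

theorem traceNode_runs {par : Fin n → ℕ} {anc : Fin n → Finset (Fin n)} {L N : ℕ} {σ : St}
    (h : Setup G par anc L N σ) {x : Fin n} (hx : σ.x 21 = x) :
    Runs G v traceNode σ (900 * ((n + 1) ^ 2 * (L + 2) ^ 2))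
      (fun σ' => ∃ l, σ'.fn n 10 = Function.update (σ.fn n 10) x l ∧
        IsGreedyAt v par anc L σ.M (Function.update (σ.fn n 10) x l) x) := by
  have hL1 : 1 ≤ L := Nat.one_le_of_lt (h.dep_lt x)
  have hxx := h.forest.not_mem_self x
  set W := (n + 1) ^ 2 * (L + 2) ^ 2 with hW
  have hWn : n + 1 ≤ W :=
    (Nat.le_self_pow (by norm_num) _).trans (Nat.le_mul_of_pos_right _ (by positivity))
  refine Runs.seq (T₁ := 150 * (n + 1)) (T₂ := 700 * W + 30)
    (gather_runs h.forest hx h.par_eq) ?_ (by omega)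
  intro σ₁ hf₁ h₁
  have s₁ := h.frame hf₁ rfl
  have hx₁ : σ₁.x 21 = x := (hf₁.x 21 rfl).trans hx
  refine Runs.seq (bestLabel_runs hx₁ s₁.x13 hL1 s₁.x16 (by omega) s₁.y3 h₁
    (fun y hy => if_neg hy) hxx) ?_ (T₂ := 30) le_rfl
  rintro σ₂ hf₂ ⟨⟨hmax, -⟩, h1, h2, heq, -⟩
  rw [s₁.par_eq, hf₁.M rfl] at hmax heq
  have hx₂ : σ₂.x 21 = x := (hf₂.x 21 rfl).trans hx₁
  have h10 : ∀ y, σ₂.A 10 y = σ.A 10 y := fun y => by rw [hf₂.A 10 rfl, hf₁.A 10 rfl]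
  refine Runs.of_flat rfl ⟨σ₂.x 22, ?_, ?_⟩ (by decide)
  · funext y
    simp only [Cmd.run, NExpr.eval, hx₂, x.2, if_true, St.fn, Function.update_self,
      Function.update_apply, Fin.ext_iff, h10]
  · unfold IsGreedyAt
    rw [restr_update hxx, Function.update_self]
    exact ⟨⟨h1, h2⟩, fun l hl hl' => heq ▸ hmax l hl hl'⟩

/-- Computes optimal labels for all nodes. -/
def traceLabels : Cmd :=
  .for 26 (.var 13) (.for 21 .size
    (.ite (NExpr.eqb (.arr 7 (.var 21)) (.var 26)) traceNode .skip))

/-- Depths are processed upwards from `0`. Being greedy at `x` involves only the labels of `x` and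
its ancestors, so labels assigned later at the same or greater depth do no damage. -/
theorem traceLabels_runs {par : Fin n → ℕ} {anc : Fin n → Finset (Fin n)} {L N : ℕ} {σ : St}
    (h : Setup G par anc L N σ) :
    Runs G v traceLabels σ (1000 * ((n + 1) ^ 3 * (L + 2) ^ 3))
      (fun σ' => ∀ x, IsGreedyAt v par anc L σ.M (σ'.fn n 10) x) := by
  set W := (n + 1) ^ 2 * (L + 2) ^ 2 with hW
  have hW4 : 4 ≤ W := by
    have h1 : 2 ^ 2 ≤ (L + 2) ^ 2 := Nat.pow_le_pow_left (by omega) _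
    exact h1.trans (Nat.le_mul_of_pos_left _ (by positivity))
  have hnW : W ≤ (n + 1) * W := Nat.le_mul_of_pos_left _ (by omega)
  refine (Runs.for L (920 * ((n + 1) * W)) (fun k σ' => ∀ x, (anc x).card < k →
    IsGreedyAt v par anc L σ.M (σ'.fn n 10) x) rfl ?_ ?_ ?_ ?_).mono le_rfl ?_
  · intro σ' hf
    rw [NExpr.eval, hf.x 13 rfl, h.x13]
  · rintro _ rfl x hx
    omega
  · intro k hk σ₁ hf₁ hx₁ hI
    have s₁ := h.frame hf₁ rfl
    refine (Runs.for n (900 * W + 60) (fun m σ' => ∀ x : Fin n,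
      ((anc x).card < k ∨ (anc x).card = k ∧ (x : ℕ) < m) →
        IsGreedyAt v par anc L σ.M (σ'.fn n 10) x) rfl (fun _ _ => rfl) ?_ ?_ ?_).mono le_rfl ?_
    · rintro _ rfl x hx
      exact hI x (by omega)
    · intro m hm σ₃ hf₃ hx₃ hI₃
      have s₃ := s₁.frame hf₃ rfl
      have h26 : σ₃.x 26 = k := (hf₃.x 26 rfl).trans hx₁
      have hd : σ₃.A 7 m = (anc ⟨m, hm⟩).card := s₃.dep ⟨m, hm⟩
      have hM₃ : σ₃.M = σ.M := by rw [hf₃.M rfl, hf₁.M rfl]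
      have hcond : (NExpr.eqb (.arr 7 (.var 21)) (.var 26)).eval G σ₃ ≠ 0 ↔
          (anc ⟨m, hm⟩).card = k := by
        rw [NExpr.eval_eqb]
        simp [NExpr.eval, hx₃, hm, h26, hd]
      refine Runs.ite (T := 900 * W) (fun he => ?_) (fun he => ?_)
        (by simp only [NExpr.eqb, NExpr.cost]; omega)
      · rw [hcond] at he
        refine (traceNode_runs s₃ (x := ⟨m, hm⟩) hx₃).mono le_rfl ?_
        rintro σ₄ - ⟨l, h1, h2⟩ - x hx
        rw [hM₃] at h2
        show IsGreedyAt v par anc L σ.M (σ₄.fn n 10) x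
        rw [h1]
        by_cases hxm : x = ⟨m, hm⟩
        · exact hxm ▸ h2
        · have hxm' : (x : ℕ) ≠ m := fun h => hxm (Fin.ext h)
          refine (hI₃ x (by omega)).update (fun hmem => ?_) hxm
          have := h.forest.card_lt hmem
          omega
      · have he' : ¬ (anc ⟨m, hm⟩).card = k := fun h => hcond.2 h he
        refine Runs.of_flat rfl ?_ (by simp only [Cmd.cost]; omega)
        intro _ x hx
        refine hI₃ x (hx.imp_right fun h => ⟨h.1, lt_of_le_of_ne (by omega) ?_⟩)
        rintro rfl
        exact he' h.1
    · simp only [NExpr.cost]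
      calc (n + 1) * (900 * W + 60 + 2 + 13) ≤ (n + 1) * (920 * W) :=
            Nat.mul_le_mul_left _ (by omega)
        _ = 920 * ((n + 1) * W) := by ring
    · rintro σ' - ⟨h1, -⟩ - x hx
      exact h1 x (by have := x.2; omega)
  · simp only [NExpr.cost]
    calc (L + 1) * (920 * ((n + 1) * W) + 2 + 13) ≤ (L + 2) * (1000 * ((n + 1) * W)) :=
          Nat.mul_le_mul (by omega) (by omega)
      _ = 1000 * ((n + 1) ^ 3 * (L + 2) ^ 3) := by rw [hW]; ring
  · rintro σ' - ⟨h1, -⟩ x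
    exact h1 x (h.dep_lt x)

/-! ### The coalition structure of a labelling -/

/-- The nodes that are connected to `x` by nodes with the same label. -/
noncomputable def labelComp (G : SimpleGraph (Fin n)) (lam : Fin n → ℕ) (x : Fin n) :
    Finset (Fin n) :=
  comp G (Finset.univ.filter fun z => lam z = lam x) x

theorem labelComp_eq {lam : Fin n → ℕ} {x y : Fin n} (h : y ∈ labelComp G lam x) :
    lam y = lam x ∧ labelComp G lam y = labelComp G lam x := by
  have h1 : lam y = lam x := by
    simpa using comp_subset_self (by simp) h
  refine ⟨h1, ?_⟩
  unfold labelComp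
  rw [h1]
  exact comp_eq (by simp) h

theorem mem_labelComp_iff {lam : Fin n → ℕ} {x y : Fin n} :
    y ∈ labelComp G lam x ↔ labelComp G lam y = labelComp G lam x :=
  ⟨fun h => (labelComp_eq h).2, fun h => h ▸ self_mem_comp _ _⟩

theorem exists_partition_labelComp (G : SimpleGraph (Fin n)) (lam : Fin n → ℕ) :
    ∃ P : Finpartition (Finset.univ : Finset (Fin n)), ∀ x, P.part x = labelComp G lam x := by
  classical
  refine ⟨Finpartition.ofSetoid (Setoid.comap (labelComp G lam) ⊥), fun x => ?_⟩
  ext y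
  rw [Finpartition.mem_part_ofSetoid_iff_rel, mem_labelComp_iff]
  exact eq_comm

theorem IsEntry.isMaxLabel_restr {par : Fin n → ℕ} {anc : Fin n → Finset (Fin n)} {L : ℕ}
    {M : ℕ → ℝ} {x : Fin n} (h : IsEntry v par anc L M x) {lam : Fin n → ℕ}
    (hl : ∀ y, 1 ≤ lam y ∧ lam y ≤ L) :
    IsMaxLabel L (obj v par anc (L + 1) M x (restr anc lam x))
      (M (key (L + 1) x (restr anc lam x))) := by
  refine h _ (fun y => ?_) fun y hy => if_neg hy
  unfold restr
  split_ifs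
  · have := hl y; omega
  · omega

/-- Two adjacent nodes with equal labels are in the same component of their label class, so the
components have the value predicted by the labelling. Any competitor is represented by some
labelling, and the greedy one is at least as good. -/
theorem ElimForest.isSolution {par : Fin n → ℕ} {anc : Fin n → Finset (Fin n)}
    (hF : ElimForest G par anc) {L : ℕ} (hL : ∀ x, (anc x).card < L) (hv : v ∅ = 0)
    (hidm : IDM G v) {M : ℕ → ℝ} (hM : ∀ x, IsEntry v par anc L M x) {lam : Fin n → ℕ}
    (hg : ∀ x, IsGreedyAt v par anc L M lam x)
    {P : Finpartition (Finset.univ : Finset (Fin n))} (hP : ∀ x, P.part x = labelComp G lam x) :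
    IsSolution G v P := by
  refine ⟨fun C hC => ?_, fun Q => ?_⟩
  · obtain ⟨x, hx⟩ := P.nonempty_of_mem_parts hC
    rw [← P.part_eq_of_mem hC hx, hP]
    exact comp_connected
  · obtain ⟨lam', h1, h2⟩ := hF.exists_labelling hL Q
    rw [hF.value_eq_sum_gain hv hidm Q lam' (fun x y hy => (h2 x y hy).2)
        (fun x y hy _ => (h2 x y hy).1),
      hF.value_eq_sum_gain hv hidm P lam (fun x y _ hy => (labelComp_eq (hP x ▸ hy)).1)
        (fun x y _ hadj hy => by
          rw [hP]
          exact comp_tail (self_mem_comp _ _) hadj (by simp [hy]))]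
    exact hF.greedy_optimal (fun x mu hmu => (hM x).isMaxLabel_restr hmu) (fun y => (hg y).1) h1
      fun x => (hg x).2

/-- The last of the first `k` nodes in whose component `y` is. -/
noncomputable def lastRep (G : SimpleGraph (Fin n)) (lam : Fin n → ℕ) (y : Fin n) : ℕ → ℕ
  | 0 => 0
  | k + 1 => open Classical in
    if ∃ h : k < n, y ∈ labelComp G lam ⟨k, h⟩ then k else lastRep G lam y k

theorem lastRep_congr {lam : Fin n → ℕ} {y z : Fin n} (h : labelComp G lam y = labelComp G lam z) :
    ∀ k, lastRep G lam y k = lastRep G lam z k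
  | 0 => rfl
  | k + 1 => by
    rw [lastRep, lastRep, lastRep_congr h k]
    simp only [mem_labelComp_iff, h]

theorem lastRep_spec {lam : Fin n → ℕ} {y : Fin n} : ∀ {k : ℕ}, (y : ℕ) < k →
    ∃ x : Fin n, lastRep G lam y k = x ∧ y ∈ labelComp G lam x
  | 0, h => absurd h (by omega)
  | k + 1, h => by
    rw [lastRep]
    split_ifs with hk
    · exact ⟨⟨k, hk.1⟩, rfl, hk.2⟩
    · refine lastRep_spec (lt_of_le_of_ne (by omega) ?_)
      rintro rfl
      exact hk ⟨y.2, self_mem_comp _ _⟩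

/-- Each node overwrites the output on its component, so what remains there is the last node of that
component, which identifies it. -/
theorem lastRep_eq_iff {lam : Fin n → ℕ} {y z : Fin n} :
    lastRep G lam y n = lastRep G lam z n ↔ labelComp G lam y = labelComp G lam z := by
  refine ⟨fun h => ?_, fun h => lastRep_congr h n⟩
  obtain ⟨x, hx, hy⟩ := lastRep_spec (G := G) (lam := lam) y.2
  obtain ⟨x', hx', hz⟩ := lastRep_spec (G := G) (lam := lam) z.2
  have : x = x' := Fin.ext (by rw [← hx, ← hx', h])
  subst this
  rw [mem_labelComp_iff] at hy hz
  rw [hy, hz]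

/-- Marks in array `0` the component of the node in variable `11`. -/
def outputNode : Cmd :=
  .fill 2 1 (NExpr.eqb (.arr 10 (.var 2)) (.arr 10 (.var 11))) ;; .asg 1 (.var 11) ;; reach ;;
  .for 2 .size (.ite (.arr 2 (.var 2)) (.put 0 (.var 2) (.var 11)) .skip)

theorem outputNode_runs {σ : St} {x : Fin n} (hx : σ.x 11 = x) :
    Runs G v outputNode σ (500 * (n + 1) ^ 3) (fun σ' => ∀ y : Fin n, σ'.A 0 y =
      open Classical in if y ∈ labelComp G (σ.fn n 10) x then (x : ℕ) else σ.A 0 y) := by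
  classical
  have hn : n + 1 ≤ (n + 1) ^ 3 := Nat.le_self_pow (by norm_num) _
  refine Runs.seq (T₁ := 150 * (n + 1)) (T₂ := 4 + (200 * (n + 1) ^ 3 + 100 * (n + 1)))
    (Runs.fill (fun y => if σ.fn n 10 y = σ.fn n 10 x then 1 else 0) ?_
      (by simp only [NExpr.eqb, NExpr.cost]; omega)) ?_ (by omega)
  · intro y σ' hf hy _
    have h10 : σ'.A 10 = σ.A 10 := hf.A 10 rfl
    have h11 : σ'.x 11 = x := (hf.x 11 rfl).trans hx
    rw [NExpr.eval_eqb]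
    simp only [NExpr.eval, hy, h10, h11, St.fn, y.2, x.2, if_true]
    split_ifs with h <;> simp [h]
  intro σ₁ hf₁ h₁
  refine Runs.seq (T₁ := 4) (Runs.of_flat (Q := fun σ' => σ'.x 1 = x) rfl
    ((hf₁.x 11 rfl).trans hx) le_rfl) ?_ le_rfl
  intro σ₂ hf₂ h₂
  refine Runs.seq (reach_runs x h₂) ?_ le_rfl
  intro σ₃ hf₃ h₃
  have hset : σ₂.set n 1 = Finset.univ.filter fun z => σ.fn n 10 z = σ.fn n 10 x := by
    ext z
    rw [St.mem_set, hf₂.A 1 rfl, h₁]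
    simp
  rw [hset] at h₃
  have h11 : σ₃.x 11 = x := by rw [hf₃.x 11 rfl, hf₂.x 11 rfl, hf₁.x 11 rfl, hx]
  have h0 : σ₃.A 0 = σ.A 0 := by rw [hf₃.A 0 rfl, hf₂.A 0 rfl, hf₁.A 0 rfl]
  refine Runs.map _ rfl rfl ?_ (by simp only [Cmd.cost, NExpr.cost]; omega)
  intro y σ' hf hy hA
  have hmem : σ'.A 2 y ≠ 0 ↔ y ∈ labelComp G (σ.fn n 10) x := by
    rw [hf.A 2 rfl, ← St.mem_set, h₃]
    rfl
  have h11' : σ'.x 11 = x := (hf.x 11 rfl).trans h11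
  by_cases hc : y ∈ labelComp G (σ.fn n 10) x
  · simp only [Cmd.run, NExpr.eval, hy, y.2, if_true, hmem.2 hc, ne_eq, not_false_eq_true, h11',
      Function.update_self, hc, true_and]
    exact fun j hj => Function.update_of_ne (fun h => hj (Fin.ext h)) _ _
  · have h2 : σ'.A 2 y = 0 := not_not.1 fun h => hc (hmem.1 h)
    simp only [Cmd.run, NExpr.eval, hy, y.2, if_true, h2, ne_eq, not_true_eq_false, if_false, hc,
      hA, h0, true_and]
    exact fun _ _ => trivial

/-- Writes the components of the label classes into array `0`. -/
def output : Cmd := .fill 2 0 (.lit 0) ;; .for 11 .size outputNode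

theorem output_runs {σ : St} :
    Runs G v output σ (600 * (n + 1) ^ 4)
      (fun σ' => ∀ y : Fin n, σ'.A 0 y = lastRep G (σ.fn n 10) y n) := by
  have hn : n + 1 ≤ (n + 1) ^ 4 := Nat.le_self_pow (by norm_num) _
  have hn3 : 1 ≤ (n + 1) ^ 3 := Nat.one_le_pow _ _ (by omega)
  refine Runs.seq (T₁ := 30 * (n + 1)) (T₂ := 520 * (n + 1) ^ 4) (Runs.fill (fun _ => 0)
    (fun _ _ _ _ _ => rfl) (by simp only [NExpr.cost]; omega)) ?_ (by omega)
  intro σ₁ hf₁ h₁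
  refine (Runs.for n (500 * (n + 1) ^ 3) (fun k σ' => ∀ y : Fin n,
    σ'.A 0 y = lastRep G (σ.fn n 10) y k) rfl (fun _ _ => rfl) ?_ ?_ ?_).mono le_rfl
    fun _ _ h => h.1
  · rintro _ rfl y
    exact h₁ y
  · intro k hk σ₂ hf₂ hx₂ hI
    refine (outputNode_runs (x := ⟨k, hk⟩) hx₂).mono le_rfl ?_
    rintro σ₃ - h₃ - y
    have h10 : σ₂.fn n 10 = σ.fn n 10 := by unfold St.fn; rw [hf₂.A 10 rfl, hf₁.A 10 rfl]
    show σ₃.A 0 y = _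
    rw [h₃, h10, lastRep, hI]
    simp only [hk, exists_true_left]
  · simp only [NExpr.cost]
    calc (n + 1) * (500 * (n + 1) ^ 3 + 1 + 1 + 13) ≤ (n + 1) * (520 * (n + 1) ^ 3) :=
          Nat.mul_le_mul_left _ (by omega)
      _ = 520 * (n + 1) ^ 4 := by ring

/-! ### The complete algorithm -/

/-- Sets variable `16` to the base of the codes and variable `17` to the number of codes. -/
def initCodes : Cmd :=
  (.asg 16 (.add (.var 13) (.lit 1)) ;; .asg 17 (.lit 1)) ;;
  .for 2 (.var 13) (mulBase 17 ;; .asg 17 (.var 18))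

theorem initCodes_runs {σ : St} {L : ℕ} (hL : σ.x 13 = L) :
    Runs G v initCodes σ (100 * (L + 2) ^ 2)
      (fun σ' => σ'.x 16 = L + 1 ∧ σ'.x 17 = (L + 1) ^ L) := by
  refine Runs.seq (T₁ := 9) (T₂ := (L + 1) * (30 * (L + 2) + 20)) (Runs.of_flat
    (Q := fun σ' => σ'.x 16 = L + 1 ∧ σ'.x 17 = 1) rfl ?_ (by decide)) ?_ (by nlinarith)
  · simp [Cmd.run, NExpr.eval, hL]
  rintro σ₁ hf₁ ⟨h16, h17⟩
  refine (Runs.for L (30 * (L + 2) + 5) (fun k σ' => σ'.x 17 = (L + 1) ^ k) rfl ?_ ?_ ?_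
    (by simp only [NExpr.cost]; exact Nat.mul_le_mul_left _ (by omega))).mono le_rfl ?_
  · intro σ' hf
    rw [NExpr.eval, hf.x 13 rfl, hf₁.x 13 rfl, hL]
  · rintro _ rfl
    simpa using h17
  · intro k hk σ₂ hf₂ hx₂ hI
    have h16₂ : σ₂.x 16 = L + 1 := (hf₂.x 16 rfl).trans h16
    refine Runs.seq ((mulBase_runs (by decide) (by decide) σ₂).mono (by rw [h16₂])
      fun _ _ h => h) ?_ (T₂ := 5) le_rfl
    intro σ₃ hf₃ h₃
    refine Runs.of_flat rfl ?_ (by decide)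
    intro _
    simp [Cmd.run, NExpr.eval, h₃, hI, h16₂, pow_succ]
  · exact fun σ' hf h => ⟨(hf.x 16 rfl).trans h16, h.1⟩

/-- The algorithm for graph coalition structure generation. -/
def solve (p q : ℕ) : Cmd :=
  buildForest p q ;; initCodes ;; computeTable ;; traceLabels ;; output

theorem solve_runs (hn : 0 < n) {p q m L : ℕ} (hpq : p < q)
    (hsep : ∀ K : Finset (Fin n), K.Nonempty → ∃ X : Finset (Fin n), X.card ≤ m ∧
      IsGoodSeparator G p q K.card K X)
    (hL : ∀ j, q ^ j ≤ p ^ j * n → (j + 1) * m ≤ L) (hv : v ∅ = 0) (hidm : IDM G v) :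
    Runs G v (solve p q) St.init (4000 * ((p + q + 1) * (n + 1) ^ 6 * ((n + 1) ^ m) ^ 3) +
        5000 * ((n + 1) ^ 4 * (L + 2) ^ 3 * ((L + 1) ^ L) ^ 2))
      (fun σ' => ∃ P, IsSolution G v P ∧ EncodesCS (σ'.A 0) P) := by
  refine Runs.seq (buildForest_runs hn hpq hsep hL rfl rfl rfl) ?_ le_rfl
  rintro σ₁ hf₁ ⟨hle, anc, hF, hdep⟩
  set l := σ₁.x 13 with hl
  set N := (l + 1) ^ l with hN
  set W := (n + 1) ^ 3 * (l + 2) ^ 3 * N ^ 2 with hW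
  have hN1 : 1 ≤ N := Nat.one_le_pow _ _ (by omega)
  have hW0 : (n + 1) ^ 3 * (l + 2) ^ 3 ≤ W := Nat.le_mul_of_pos_right _ (by positivity)
  have hW1 : (l + 2) ^ 2 ≤ W := (Nat.pow_le_pow_right (by omega) (by norm_num : 2 ≤ 3)).trans
    ((Nat.le_mul_of_pos_left _ (by positivity)).trans hW0)
  have hW2 : W ≤ (n + 1) * W := Nat.le_mul_of_pos_left _ (by omega)
  have hW3 : (n + 1) ^ 4 ≤ (n + 1) * W := by
    rw [pow_succ']
    exact Nat.mul_le_mul_left _ ((Nat.le_mul_of_pos_right _ (by positivity)).trans hW0)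
  -- The program works with the actual height `l` of the forest, while the bound is in terms of `L`,
  -- which it need not know.
  have hT : 5000 * ((n + 1) * W) ≤ 5000 * ((n + 1) ^ 4 * (L + 2) ^ 3 * ((L + 1) ^ L) ^ 2) := by
    have h1 : N ≤ (L + 1) ^ L :=
      (Nat.pow_le_pow_left (by omega) l).trans (Nat.pow_le_pow_right (by omega) hle)
    have h2 : (n + 1) * W = (n + 1) ^ 4 * (l + 2) ^ 3 * N ^ 2 := by rw [hW]; ring
    rw [h2]
    gcongr
  refine Runs.mono ?_ hT fun _ _ h => h
  refine Runs.seq (T₁ := 100 * (l + 2) ^ 2) (initCodes_runs hl.symm) ?_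
    (T₂ := 3200 * W + (1000 * ((n + 1) ^ 3 * (l + 2) ^ 3) + 600 * (n + 1) ^ 4)) (by omega)
  rintro σ₂ hf₂ ⟨h16, h17⟩
  have s₂ : Setup G (σ₁.fn n 6) anc l N σ₂ := by
    refine ⟨hF, ?_, fun x => ?_, fun x => ?_, hf₂.x 13 rfl, h16, h17, ?_⟩
    · unfold St.fn; rw [hf₂.A 6 rfl]
    · unfold St.fn; rw [hf₂.A 7 rfl]; exact (hdep x).1
    · rw [← (hdep x).1]; exact (hdep x).2
    · rw [hf₂.y 3 rfl, hf₁.y 3 rfl]; rfl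
  refine Runs.seq (computeTable_runs s₂) ?_ le_rfl
  intro σ₃ hf₃ h₃
  refine Runs.seq (traceLabels_runs (s₂.frame hf₃ rfl)) ?_ le_rfl
  intro σ₄ hf₄ h₄
  refine output_runs.mono le_rfl ?_
  intro σ₅ hf₅ h₅
  obtain ⟨P, hP⟩ := exists_partition_labelComp G (σ₄.fn n 10)
  refine ⟨P, hF.isSolution s₂.dep_lt hv hidm h₃ h₄ hP, fun i j => ?_⟩
  rw [h₅, h₅, lastRep_eq_iff, ← mem_labelComp_iff, ← hP]
  constructor
  · exact fun h => ⟨P.part j, P.part_mem.2 (Finset.mem_univ _), h,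
      P.mem_part (Finset.mem_univ _)⟩
  · rintro ⟨C, hC, hi, hj⟩
    rwa [P.part_eq_of_mem hC hj]

/-! ### Separators of induced subgraphs -/

theorem GraphClass.SubgraphClosed.comap_mem {S : GraphClass} (hS : S.SubgraphClosed) {k : ℕ}
    (e : Fin k ↪ Fin n) (hG : G ∈ S n) : G.comap e ∈ S k :=
  hS k n _ G hG ⟨(SimpleGraph.Embedding.comap e G).toCopy⟩

/-- A walk that avoids `X` cannot leave the side of `A`: an edge at a node outside `B` belongs to
`A`, and its other end, being in `A` but not in `X`, is again outside `B`. -/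
theorem comp_subset_map_of_mem {k : ℕ} {e : Fin k ↪ Fin n} {A B : (G.comap e).Subgraph}
    (hAB : A ⊔ B = ⊤) {K X : Finset (Fin n)} (hK : ∀ y ∈ K, ∃ a, e a = y)
    (hX : ∀ a, e a ∈ X ↔ a ∈ A.verts ∩ B.verts) {a : Fin k} (ha : a ∈ A.verts \ B.verts) :
    (comp G (K \ X) (e a)).card ≤ (A.verts \ B.verts).ncard := by
  classical
  have hsub : comp G (K \ X) (e a) ⊆ (A.verts \ B.verts).toFinset.map e := by
    refine comp_subset (by simpa using ha) fun i hi j hj hij => ?_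
    obtain ⟨b, hb, rfl⟩ := Finset.mem_map.1 hi
    rw [Set.mem_toFinset] at hb
    rw [Finset.mem_sdiff] at hj
    obtain ⟨d, rfl⟩ := hK j hj.1
    have hadj : (A ⊔ B).Adj b d := by rw [hAB]; exact hij
    rcases SimpleGraph.Subgraph.sup_adj.1 hadj with h | h
    · have hd : d ∈ A.verts := A.edge_vert h.symm
      refine Finset.mem_map_of_mem _ (Set.mem_toFinset.2 ⟨hd, fun hd' => ?_⟩)
      exact hj.2 ((hX d).2 ⟨hd, hd'⟩)
    · exact absurd (B.edge_vert h) hb.2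
  refine (Finset.card_le_card hsub).trans ?_
  rw [Finset.card_map, Set.ncard_eq_toFinset_card']

/-- The separator theorem is applied to the subgraph induced on `K`, renumbered by its increasing
enumeration. Each piece left over lies on one side and so has at most `α |K|` nodes. -/
theorem exists_isGoodSeparator {S : GraphClass} {f : ℕ → ℝ} {α : ℝ} (hS : S.SubgraphClosed)
    (hsep : S.SeparatorTheorem f α) (hG : G ∈ S n) {p q : ℕ} (hpq : α * q ≤ p)
    {K : Finset (Fin n)} (hK : K.Nonempty) :
    ∃ X : Finset (Fin n), (X.card : ℝ) ≤ f K.card ∧ IsGoodSeparator G p q K.card K X := by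
  classical
  set e : Fin K.card ↪ Fin n := (K.orderEmbOfFin rfl).toEmbedding with he
  obtain ⟨A, B, hAB, hs, h1, h2⟩ := hsep _ hK.card_pos _ (hS.comap_mem e hG)
  have hKe : ∀ y ∈ K, ∃ a, e a = y := by
    intro y hy
    have : y ∈ Set.range (K.orderEmbOfFin rfl) := by rw [K.range_orderEmbOfFin rfl]; exact hy
    exact this
  set X : Finset (Fin n) := (A.verts ∩ B.verts).toFinset.map e with hX
  have hXe : ∀ a, e a ∈ X ↔ a ∈ A.verts ∩ B.verts := by
    intro a
    rw [hX, Finset.mem_map' e, Set.mem_toFinset]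
  refine ⟨X, ?_, fun z hz => ?_⟩
  · rw [hX, Finset.card_map, ← Set.ncard_eq_toFinset_card']
    exact hs
  · rw [Finset.mem_sdiff] at hz
    obtain ⟨a, rfl⟩ := hKe z hz.1
    have hmem : a ∈ A.verts ∪ B.verts := by
      rw [← SimpleGraph.Subgraph.verts_sup, hAB]
      trivial
    rw [hXe] at hz
    have key : ∀ s : ℕ, (s : ℝ) ≤ α * K.card → (comp G (K \ X) (e a)).card ≤ s →
        q * (comp G (K \ X) (e a)).card ≤ p * K.card := by
      intro s hs hcs
      have h3 : ((q * (comp G (K \ X) (e a)).card : ℕ) : ℝ) ≤ (p * K.card : ℕ) := by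
        push_cast
        calc (q : ℝ) * (comp G (K \ X) (e a)).card ≤ q * (α * K.card) := by
              gcongr
              exact (Nat.cast_le.2 hcs).trans hs
          _ = (α * q) * K.card := by ring
          _ ≤ p * K.card := by gcongr
      exact_mod_cast h3
    by_cases ha : a ∈ A.verts
    · exact key _ h1 (comp_subset_map_of_mem hAB hKe hXe ⟨ha, fun hb => hz.2 ⟨ha, hb⟩⟩)
    · refine key _ h2 (comp_subset_map_of_mem (by rwa [sup_comm]) hKe
        (fun a => by rw [hXe, Set.inter_comm]) ⟨hmem.resolve_left ha, ha⟩)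

/-- With `α < 1` the single node cannot be outside either side, so it is in the separator. The
resulting `f n ≥ 1` lets constants be absorbed into multiples of `f n`. -/
theorem GraphClass.SeparatorTheorem.one_le {S : GraphClass} {f : ℕ → ℝ} {α : ℝ}
    (hsep : S.SeparatorTheorem f α) (hα : α < 1) (hne : (S 1).Nonempty) : 1 ≤ f 1 := by
  obtain ⟨G, hG⟩ := hne
  obtain ⟨A, B, hAB, hs, h1, h2⟩ := hsep 1 one_pos G hG
  have hlt : ∀ T : Set (Fin 1), (T.ncard : ℝ) ≤ α * (1 : ℕ) → T = ∅ := by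
    intro T hT
    have : (T.ncard : ℝ) < 1 := by
      push_cast at hT
      linarith
    rw [← Set.ncard_eq_zero]
    exact_mod_cast Nat.lt_one_iff.1 (by exact_mod_cast this)
  have h1' := hlt _ h1
  have h2' := hlt _ h2
  have hmem : (0 : Fin 1) ∈ A.verts ∪ B.verts := by
    rw [← SimpleGraph.Subgraph.verts_sup, hAB]
    trivial
  have h0 : (0 : Fin 1) ∈ A.verts ∩ B.verts := by
    rw [Set.sdiff_eq_empty] at h1' h2'
    rcases hmem with h | h
    · exact ⟨h, h1' h⟩
    · exact ⟨h2' h, h⟩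
  have hpos : 1 ≤ (A.verts ∩ B.verts).ncard :=
    (Set.ncard_pos (Set.toFinite _)).2 ⟨0, h0⟩
  exact le_trans (by exact_mod_cast hpos) hs

/-! ### The growth of the running time -/

/-- A bound for the number of steps of the algorithm. -/
def timeBound (K m L n : ℕ) : ℕ :=
  4000 * (K * (n + 1) ^ 6 * ((n + 1) ^ m) ^ 3) +
    5000 * ((n + 1) ^ 4 * (L + 2) ^ 3 * ((L + 1) ^ L) ^ 2)

/-- A bound for the depth of the elimination forest. -/
noncomputable def depthBound (c' F : ℝ) (n : ℕ) : ℕ := ⌊(c' * Real.log n + 1) * F⌋₊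

/-- With `x = c log n F`, both summands are at most a constant times `exp (2 c log n F log x)`. The
search has logarithm `O(F log n)` and loses by the factor `log x`; the table has logarithm about `2
c' log n F log x`, and the gap `c - c'` pays for its lower order terms. -/
theorem timeBound_le {K n : ℕ} {F c c' : ℝ} (hn : 2 ≤ n) (hF : 1 ≤ F) (hc' : 0 < c') (hcc : c' < c)
    (h1 : 1 ≤ Real.log n) (h5 : 5 ≤ (c - c') * Real.log n)
    (h9 : 9 ≤ c * Real.log (c * Real.log n)) (h8 : 8 ≤ (c - c') * Real.log (c * Real.log n)) :
    (timeBound K ⌊F⌋₊ (depthBound c' F n) n : ℝ) ≤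
      (4000 * K + 5000) * (n : ℝ) ^ (Real.log 2 * c * F ^ 2 +
        2 * c * F * Real.log (c * Real.log n * F)) := by
  set l := Real.log n with hl
  set L := depthBound c' F n with hL
  have hc : 0 < c := hc'.trans hcc
  have hF0 : 0 < F := by linarith
  have hl0 : 0 < l := by linarith
  have hcl : 0 < c * l := by positivity
  set x := c * l * F with hx
  have hx0 : 0 < x := by positivity
  have hlogx : Real.log (c * l) ≤ Real.log x :=
    Real.log_le_log hcl (le_mul_of_one_le_right hcl.le hF)
  have hlogx0 : 0 ≤ Real.log x := by nlinarith
  have h9' : 9 ≤ c * Real.log x := h9.trans (by gcongr)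
  have h8' : 8 ≤ (c - c') * Real.log x :=
    h8.trans (mul_le_mul_of_nonneg_left hlogx (by linarith))
  have hn0 : (0 : ℝ) < n := by positivity
  have hn1 : ((n : ℝ) + 1) ≤ Real.exp (2 * l) := by
    rw [two_mul, Real.exp_add, hl, Real.exp_log hn0]
    have : (2 : ℝ) ≤ n := by exact_mod_cast hn
    nlinarith
  have hLle : (L : ℝ) ≤ (c' * l + 1) * F := Nat.floor_le (by positivity)
  have hmle : (⌊F⌋₊ : ℝ) ≤ F := Nat.floor_le hF0.le
  -- From `(c' l + 1) F + 2 ≤ (c' l + 3) F`, and `3 ≤ (c - c') l`.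
  have hLx : (L : ℝ) + 2 ≤ x := by
    have : (L : ℝ) + 2 ≤ (c' * l + 3) * F := by nlinarith
    refine this.trans ?_
    rw [hx]
    gcongr
    nlinarith
  have hE : Real.exp (2 * c * l * F * Real.log x) ≤ (n : ℝ) ^ (Real.log 2 * c * F ^ 2 +
      2 * c * F * Real.log x) := by
    rw [Real.rpow_def_of_pos hn0, ← hl, Real.exp_le_exp]
    have : 0 ≤ l * (Real.log 2 * c * F ^ 2) := by
      have := Real.log_nonneg (show (1 : ℝ) ≤ 2 by norm_num)
      positivity
    linarith
  have hA : ((n : ℝ) + 1) ^ 6 * (((n : ℝ) + 1) ^ ⌊F⌋₊) ^ 3 ≤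
      Real.exp (2 * c * l * F * Real.log x) := by
    calc ((n : ℝ) + 1) ^ 6 * (((n : ℝ) + 1) ^ ⌊F⌋₊) ^ 3 = ((n : ℝ) + 1) ^ (6 + ⌊F⌋₊ * 3) := by
          rw [pow_add, pow_mul]
      _ ≤ Real.exp (2 * l) ^ (6 + ⌊F⌋₊ * 3) := by gcongr
      _ = Real.exp (((6 + ⌊F⌋₊ * 3 : ℕ) : ℝ) * (2 * l)) := (Real.exp_nat_mul _ _).symm
      _ ≤ Real.exp (2 * c * l * F * Real.log x) := by
          rw [Real.exp_le_exp]
          push_cast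
          -- The factor `2` comes from `n + 1 ≤ n ^ 2`, and `6 + 3` is the `9` in the hypothesis
          -- `h9`.
          calc (6 + (⌊F⌋₊ : ℝ) * 3) * (2 * l) ≤ (6 * F + F * 3) * (2 * l) := by
                gcongr; linarith
            _ = 2 * (l * F) * 9 := by ring
            _ ≤ 2 * (l * F) * (c * Real.log x) := by gcongr
            _ = _ := by ring
  have hB : ((n : ℝ) + 1) ^ 4 * ((L : ℝ) + 2) ^ 3 * (((L : ℝ) + 1) ^ L) ^ 2 ≤
      Real.exp (2 * c * l * F * Real.log x) := by
    calc ((n : ℝ) + 1) ^ 4 * ((L : ℝ) + 2) ^ 3 * (((L : ℝ) + 1) ^ L) ^ 2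
        ≤ Real.exp (2 * l) ^ 4 * x ^ 3 * (x ^ L) ^ 2 := by
          gcongr
          linarith
      _ = Real.exp (2 * l) ^ 4 * x ^ (3 + L * 2) := by rw [pow_add, pow_mul, mul_assoc]
      _ = Real.exp (8 * l + ((3 + L * 2 : ℕ) : ℝ) * Real.log x) := by
          rw [Real.exp_add, Real.exp_nat_mul, Real.exp_log hx0, ← Real.exp_nat_mul]
          congr 2
          push_cast
          ring
      _ ≤ Real.exp (2 * c * l * F * Real.log x) := by
          rw [Real.exp_le_exp]
          push_cast
          have e1 : 3 + (L : ℝ) * 2 ≤ (2 * c' * l + 5) * F := by nlinarith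
          have e2 : (3 + (L : ℝ) * 2) * Real.log x ≤ (2 * c' * l + 5) * F * Real.log x := by
            gcongr
          have e3 : 8 * l ≤ 8 * l * F := le_mul_of_one_le_right (by positivity) hF
          -- Of the slack `2 (c - c') l log x`, one half covers `8 l` and the other half covers `5
          -- log x`.
          have e4 : 8 * l + (2 * c' * l + 5) * Real.log x ≤ 2 * c * l * Real.log x := by
            have := mul_le_mul_of_nonneg_left h8' hl0.le
            have := mul_le_mul_of_nonneg_right h5 hlogx0
            nlinarith
          have e5 := mul_le_mul_of_nonneg_right e4 hF0.le
          linarith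
  unfold timeBound
  push_cast
  set E := (n : ℝ) ^ (Real.log 2 * c * F ^ 2 + 2 * c * F * Real.log x)
  have hA' := mul_le_mul_of_nonneg_left (hA.trans hE) (show (0 : ℝ) ≤ 4000 * K by positivity)
  have hB' := mul_le_mul_of_nonneg_left (hB.trans hE) (show (0 : ℝ) ≤ 5000 by positivity)
  linarith

theorem timeBound_isBigO {f : ℕ → ℝ} {c c' : ℝ} (hf : ∀ n, 1 ≤ n → 1 ≤ f n) (hc' : 0 < c')
    (hcc : c' < c) (K : ℕ) :
    (fun n : ℕ => (timeBound K ⌊f n⌋₊ (depthBound c' (f n) n) n : ℝ)) =O[atTop]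
      (fun n : ℕ => (n : ℝ) ^ (Real.log 2 * c * f n ^ 2 +
        2 * c * f n * Real.log (c * Real.log n * f n))) := by
  have hc : 0 < c := hc'.trans hcc
  have hl : Tendsto (fun n : ℕ => Real.log n) atTop atTop :=
    Real.tendsto_log_atTop.comp tendsto_natCast_atTop_atTop
  have hll : Tendsto (fun n : ℕ => Real.log (c * Real.log n)) atTop atTop :=
    Real.tendsto_log_atTop.comp (hl.const_mul_atTop hc)
  have hδ : 0 < c - c' := by linarith
  refine IsBigO.of_bound (4000 * K + 5000) ?_
  filter_upwards [eventually_ge_atTop 2, hl.eventually_ge_atTop 1,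
    (hl.const_mul_atTop hδ).eventually_ge_atTop 5, (hll.const_mul_atTop hc).eventually_ge_atTop 9,
    (hll.const_mul_atTop hδ).eventually_ge_atTop 8] with n hn h1 h5 h9 h8
  rw [Real.norm_of_nonneg (Nat.cast_nonneg _),
    Real.norm_of_nonneg (Real.rpow_nonneg (Nat.cast_nonneg _) _)]
  exact timeBound_le hn (hf n (by omega)) hc' hcc h1 h5 h9 h8

theorem le_log_of_pow_le {p q j : ℕ} (hp : 0 < p) (hpq : p < q) (h : q ^ j ≤ p ^ j * n) :
    (j : ℝ) ≤ 1 / -Real.log (p / q) * Real.log n := by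
  have hp' : (0 : ℝ) < p := by exact_mod_cast hp
  have hq' : (0 : ℝ) < q := by exact_mod_cast hp.trans hpq
  have hlog : 0 < -Real.log (p / q) :=
    neg_pos.2 (Real.log_neg (by positivity) ((div_lt_one hq').2 (by exact_mod_cast hpq)))
  rw [one_div, inv_mul_eq_div, le_div_iff₀ hlog, ← Real.log_inv, inv_div, ← Real.log_pow]
  refine Real.log_le_log (by positivity) ?_
  rw [div_pow, div_le_iff₀ (by positivity), mul_comm]
  exact_mod_cast h

theorem solve_exec {S : GraphClass} {f : ℕ → ℝ} {α : ℝ} (hS : S.SubgraphClosed)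
    (hsep : S.SeparatorTheorem f α) (hf : MonotoneOn f (Set.Ici 1)) {p q : ℕ} (hp : 0 < p)
    (hpq : p < q) (hα : α * q ≤ p) (hG : G ∈ S n) (hv : IsInstance G v) :
    ∃ (s : State) (t : ℕ) (P : Finpartition (Finset.univ : Finset (Fin n))),
      Exec G v (solve p q).compile (State.init n) s t ∧
        t ≤ timeBound (p + q + 1) ⌊f n⌋₊ (depthBound (1 / -Real.log (p / q)) (f n) n) n ∧
        IsSolution G v P ∧ EncodesCS s.mem P := by
  obtain ⟨hconn, hv0, hidm⟩ := hv
  have hn : 0 < n := Fin.pos_iff_nonempty.2 hconn.nonempty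
  have hf0 : 0 ≤ f n := by
    obtain ⟨A, B, -, hs, -⟩ := hsep n hn G hG
    exact (Nat.cast_nonneg _).trans hs
  obtain ⟨s, t, σ, hexec, ht, hrel, -, P, hP, henc⟩ := solve_runs (m := ⌊f n⌋₊)
    -- By monotonicity of `f`, one size `⌊f n⌋₊` serves for the separators of all components.
    (L := depthBound (1 / -Real.log (p / q)) (f n) n) hn hpq (fun K hK => by
      obtain ⟨X, hX, hX'⟩ := exists_isGoodSeparator hS hsep hG hα hK
      refine ⟨X, Nat.le_floor (hX.trans (hf hK.card_pos hn ?_)), hX'⟩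
      exact (Finset.card_le_univ K).trans (Fintype.card_fin n).le) (fun j hj => by
      refine Nat.le_floor ?_
      push_cast
      have := le_log_of_pow_le hp hpq hj
      refine mul_le_mul (by linarith) (Nat.floor_le hf0) (Nat.cast_nonneg _) ?_
      linarith [(Nat.cast_nonneg j : (0 : ℝ) ≤ j)]) hv0 hidm _ (rel_init n)
  refine ⟨s, t, P, hexec, ht, hP, fun i j => ?_⟩
  have hmem : ∀ i : Fin n, s.mem i = σ.A 0 i := fun i => by
    have := hrel.mem 0 i i.2
    simpa using this
  rw [hmem, hmem]
  exact henc i j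

theorem GraphClass.SeparatorTheorem.eq_empty_of_neg {S : GraphClass} {f : ℕ → ℝ} {α : ℝ}
    (hsep : S.SeparatorTheorem f α) (hα : α < 0) (hn : 0 < n) : G ∉ S n := by
  intro hG
  obtain ⟨A, B, -, -, h, -⟩ := hsep n hn G hG
  have h1 : (0 : ℝ) < n := by exact_mod_cast hn
  have h2 : (0 : ℝ) ≤ (A.verts \ B.verts).ncard := Nat.cast_nonneg _
  nlinarith

end GCSG

/-! ### The choice of the ratio and the conclusion -/

theorem corollary1
    (S : GCSG.GraphClass) (f : ℕ → ℝ) (g : ℝ → ℝ) (α β c : ℝ)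
    (hS : S.SubgraphClosed)
    (hg : MonotoneOn g (Set.Ici 1))
    (hgS : ∀ n : ℕ, 0 < n → ∀ G ∈ S n, (GCSG.numConnectedCS G : ℝ) ≤ g n)
    (hf : MonotoneOn f (Set.Ici 1))
    (hfo : f =o[atTop] (fun n : ℕ => (n : ℝ)))
    (hsep : S.SeparatorTheorem f α)
    (hfind : ∃ (p : GCSG.Program) (T : ℕ → ℕ), GCSG.FindsSeparatorsWithin S f α p T ∧
      (fun n : ℕ => (T n : ℝ)) =o[atTop]
        (fun n : ℕ => g (f n) ^ 2 * f n ^ (2 * f n)))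
    (hαβ : α < β) (hβ : β < 1)
    (hc : c = 1 / |Real.log β|) :
    ∃ (p : GCSG.Program) (T : ℕ → ℕ), GCSG.SolvesWithin S p T ∧
      (fun n : ℕ => (T n : ℝ)) =O[atTop]
        (fun n : ℕ => (n : ℝ) ^ (Real.log 2 * c * f n ^ 2 +
          2 * c * f n * Real.log (c * Real.log n * f n))) := by
  classical
  -- If `β ≤ 0`, then `α < 0` and the class has no graph with a node. Instances are connected, hence
  -- nonempty, so there is nothing to solve.
  rcases le_or_gt β 0 with hβ0 | hβ0
  · refine ⟨GCSG.Cmd.skip.compile, fun _ => 0, fun n G v hG hv => ?_, ?_⟩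
    · exact absurd hG (hsep.eq_empty_of_neg (hαβ.trans_le hβ0)
        (Fin.pos_iff_nonempty.2 hv.1.nonempty))
    · simpa using isBigO_zero _ _
  -- The machine tests sizes with integers, so the ratio must be rational. Positivity makes its
  -- logarithm meaningful, `α < r` keeps the separators valid, and `r < β` provides the slack `c' <
  -- c`.
  obtain ⟨r, hr1, hr2⟩ := exists_rat_btwn (max_lt hαβ hβ0)
  rw [max_lt_iff] at hr1
  have hr0 : 0 < r := by exact_mod_cast hr1.2
  set p := r.num.toNat with hp
  set q := r.den with hq
  have hpr : (p : ℝ) / q = r := by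
    have h1 : ((p : ℤ) : ℝ) = r.num := by
      rw [hp, Int.toNat_of_nonneg (Rat.num_pos.2 hr0).le]
    rw [Rat.cast_def r, ← h1, Int.cast_natCast]
  have hq0 : (0 : ℝ) < q := by exact_mod_cast r.den_pos
  have hp0 : 0 < p := by
    have := Rat.num_pos.2 hr0
    omega
  have hpq : p < q := by
    have h1 : (p : ℝ) / q < 1 := by rw [hpr]; linarith
    rw [div_lt_one hq0] at h1
    exact_mod_cast h1
  have hα : α * q ≤ p := by
    rw [← le_div_iff₀ hq0, hpr]
    exact hr1.1.le
  have hlogβ : 0 < -Real.log β := neg_pos.2 (Real.log_neg hβ0 hβ)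
  have hlogr : -Real.log β < -Real.log (p / q) := by
    rw [hpr]
    exact neg_lt_neg (Real.log_lt_log hr1.2 hr2)
  have hc' : 0 < 1 / -Real.log ((p : ℝ) / q) := one_div_pos.2 (hlogβ.trans hlogr)
  have hcc : 1 / -Real.log ((p : ℝ) / q) < c := by
    rw [hc, abs_of_neg (neg_pos.1 hlogβ)]
    exact one_div_lt_one_div_of_lt hlogβ hlogr
  -- The time bound is zero for sizes without graphs in the class, where `f` is not controlled.
  refine ⟨(GCSG.solve p q).compile, fun n => if (S n).Nonempty then
    GCSG.timeBound (p + q + 1) ⌊f n⌋₊ (GCSG.depthBound (1 / -Real.log (p / q)) (f n) n) n else 0,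
    fun n G v hG hv => ?_, ?_⟩
  · have hne : (S n).Nonempty := ⟨G, hG⟩
    simp only [hne, if_true]
    exact GCSG.solve_exec hS hsep hf hp0 hpq hα hG hv
  · by_cases hall : ∀ n, (S n).Nonempty
    · simp only [hall, if_true]
      refine GCSG.timeBound_isBigO (fun n hn => ?_) hc' hcc _
      exact (hsep.one_le (hαβ.trans hβ) (hall 1)).trans
        (hf (Set.mem_Ici.2 le_rfl) (Set.mem_Ici.2 hn) hn)
    -- By closure under subgraphs, a size without graphs excludes all larger sizes, so the time
    -- bound is eventually zero.
    · obtain ⟨k, hk⟩ := not_forall.1 hall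
      refine (isBigO_zero _ _).congr' ?_ EventuallyEq.rfl
      filter_upwards [eventually_ge_atTop k] with n hn
      rw [if_neg, Nat.cast_zero]
      rintro ⟨G, hG⟩
      exact hk ⟨_, hS.comap_mem (Fin.castLEEmb hn) hG⟩
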